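/- **Notions.** Let $\lambda$ be the uniform measure on infinite binary sequences. A *partition refinement* $S$ of a set $\Omega$ assigns to some pairs (time $t\in\mathbb N$, finite binary string $x$) a nonempty part $S^t(x)\subseteq\Omega$ such that $S^0(\Lambda)=\Omega$; a part, once defined, stays the same at all later times; and if one of $x0,x1$ is defined at $t$, then both are, $x$ is defined at $t-1$, and $\{S^t(x0),S^t(x1)\}$ is a partition of $S^{t}(x)$. A defined coordinate $x$ (and its part) is *terminal* at $t$ if $x0,x1$ are undefined at $t$; it is *split at $t$* if it is terminal at $t-1$ and not at $t$. A *betting strategy* $(S,\mu)$ is a partition refinement of $\{0,1\}^{\mathbb N}$ into clopen parts with $\mu$ a map from strings to non-negative reals satisfying $\mu(x)=\mu(x0)+\mu(x1)$. It is *computable* if $(t,x)\mapsto S^t(x)$ (including whether it is defined) is computable and an algorithm outputs the rational number $\mu(x)$ for every $x$ that is ever defined. The capital of $x$ is $c(x)=\mu(x)/\lambda(S^t(x))$, and $\hat c(x)$ is the maximum of $c$ over the prefixes of $x$. The strategy *stays below $2$* on $\sigma$ if $\hat c(x)<2$ whenever $x$ is terminal at some $t$ with $\sigma\in S^t(x)$;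 it *wins* on $\sigma$ if these values $\hat c(x)$ are unbounded. A *Martin-Löf test* is a decreasing sequence of sets $U_n$ of sequences, uniformly computable unions of basic sets $[s]$, with $\lambda(U_n)\le 2^{-n}$; $\sigma$ fails it if $\sigma\in\bigcap_nU_n$, and $\sigma$ is non-Martin-Löf-random if it fails some test. A *restriction* is a partial map $r:\mathbb N\to\{0,1\}$; $[r]$ is the set of sequences that agree with it, and $s\hat{\ }r$ is the concatenation of restrictions with disjoint domains. A part is *split on $r$* if it is split into two parts that both meet $[r]$; the number of times a part with coordinate $x$ was split on $r$ is the number of proper prefixes of $x$ whose part is split on $r$. A strategy *$I$-splits on $\sigma$ more than $N$ times* if some part containing $\sigma$ was split more than $N$ times on the restriction of $\sigma$ to $\mathbb N\setminus I$. A *partition evaluation* of a finite set $\Omega$ is a partition refinement of $\Omega$ with a map $\nu^t(x)\ge0$ that is nondecreasing in $t$ and along continuations of $x$. An element is *$(N,\varphi)$-good* at $t$ if the terminal part containing it has a coordinate $x$ with $|x|<N$, more than $\varphi$ elements, and $\nu^t(x)<2$. It *becomes stale after $t$ at $t'$*, for a pair of partition evaluations, if $t'$ is the least number $>t$ such that,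 in one of the two, a part containing the element is split at $t'$ or has evaluation $\ge2$ at $t'$. An *$(N,\varphi)$-sequence* is a finite sequence $s_1,\dots,s_k$ for which there are $t_0=0,t_1,\dots$ such that each $s_i$ is good at $t_{i-1}$ for both, and (for $i<k$) becomes stale after $t_{i-1}$ at $t_i$. Let $Q(\ell,N,\varphi)$ be the largest length of an $(N,\varphi)$-sequence against any pair of partition evaluations of a set with $2^\ell$ elements. **Chosen restrictions.** Fix strategies $A,B$, a finite $I\subset\mathbb N$, numbers $M,\varphi$, and a finite restriction $z$ with domain disjoint from $I$. Let $K_t$ be the set of positions inspected by $A$ or $B$ up to time $t$ (for each strategy, the least set of positions whose values determine the terminal part at $t$). For a head $s\in\{0,1\}^I$ and a tail $r$ such that each $[s'\hat{\ }r]$, $s'\in\{0,1\}^I$, lies in one terminal part of each strategy at $t$, call $s\hat{\ }r$ *good* at $t$ if for both strategies the terminal part $v\supseteq[s\hat{\ }r]$ was split on $r$ less than $M$ times, contains $[s'\hat{\ }r]$ for more than $\varphi$ heads $s'$, and its coordinate has $\hat c<2$. It becomes *stale* after $t$ at $t'$ if $t'>t$ is least such that, for one of the strategies, the part containing $[s\hat{\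 }r]$ is split on $r$ at $t'$, or the terminal part containing it at $t'$ has $\hat c\ge2$. The *basic game* on $I,z$ with parameters $M,\varphi$ chooses: at time $0$, head $0^I$ with tail $z$; and whenever $s\hat{\ }r$ was chosen at $t$, $r'\supseteq r$ has domain $(K_{t'}\cup\operatorname{dom}z)\setminus I$, $s\hat{\ }r'$ becomes stale after $t$ at $t'$, and some $s'\hat{\ }r'$ is good at $t'$, it chooses at $t'$ the one with lexicographically least head $s'$. **Statement.** Let $A=(S_A,\mu_A)$, $B=(S_B,\mu_B)$ be computable betting strategies with $\mu_A(\Lambda)+\mu_B(\Lambda)=1$. Let $(I_i,N_i,\varphi_i)_{i\ge1}$ be a computable sequence of zones: $I_i$ are pairwise disjoint finite sets of positions, $N_i\ge0$ and $\varphi_i\ge1$ are integers. Let $\varepsilon_i$ be the measure of the set of sequences on which $A$ or $B$ $I_i$-splits more than $N_i$ times. Assume (I) $Q(|I_i|,N_i,\varphi_i)\le2^{|I_i|-i-1}$ for all $i$; (II) $\varepsilon_i\to0$; (III) $N_i\le|I_i|-\log_2\varphi_i-i$ for all $i$. Then: (a) There is a non-Martin-Löf-random sequence on which neither $A$ nor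 $B$ wins, and on which both stay below $2$. (b) Let $L_0$ consist of the empty restriction and let $L_{n+1}$ consist of all restrictions chosen, for some $z\in L_n$ and some $i$ with $I_i\cap\operatorname{dom}z=\emptyset$, in the basic game on $I_i,z$ with parameters $N_i+1,\varphi_i$ (so that good parts are those split at most $N_i$ times). If moreover $Q(|I_i|,N_i+1,\varphi_i)\le2^{|I_i|-i-1}$ for all $i$, then the sets $\bigcup_{c\in L_n}[c]$, $n\ge0$, are the levels of a Martin-Löf test, and some sequence that fails this test is one on which both strategies stay below $2$ (so it is non-Martin-Löf-random and neither strategy wins on it). -/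

import Mathlib

open MeasureTheory Filter Topology
open scoped ENNReal

namespace BettingGame

/-- Infinite binary sequences. -/
abbrev Seq : Type := ℕ → Bool

/-- The uniform Lebesgue (fair coin) measure on infinite binary sequences. -/
noncomputable def size : Measure Seq :=
  Measure.infinitePi fun _ : ℕ => (PMF.uniformOfFintype Bool).toMeasure

/-- The basic set `[s]` of the sequences with prefix `s`. -/
def basic (s : List Bool) : Set Seq :=
  {σ | ∀ (k : ℕ) (hk : k < s.length), σ k = s[k]}

/-- The clopen set coded by a finite list of strings: the union of their basic sets. -/
def clopenOf (l : List (List Bool)) : Set Seq := {σ | ∃ s ∈ l, σ ∈ basic s}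

/-! ### Restrictions -/

/-- A restriction: a partial map from positions to bits. -/
abbrev Restriction : Type := ℕ → Option Bool

namespace Restriction

/-- The positions restricted by `r`. -/
def dom (r : Restriction) : Set ℕ := {p | r p ≠ none}

/-- The set `[r]` of the sequences consistent with `r`. -/
def cyl (r : Restriction) : Set Seq := {σ | ∀ p b, r p = some b → σ p = b}

/-- `r'` is an extension of `r`. -/
def Extends (r r' : Restriction) : Prop := ∀ p b, r p = some b → r' p = some b

/-- Concatenation of two restrictions (used for disjoint domains). -/
def concat (s r : Restriction) : Restriction := fun p => (s p).or (r p)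

/-- The empty restriction. -/
def empty : Restriction := fun _ => none

/-- The restriction of exactly the positions in `I`, all to `0`. -/
def zeros (I : Finset ℕ) : Restriction := fun p => if p ∈ I then some false else none

/-- The restriction that agrees with `σ` on all positions outside `I` and leaves `I` free. -/
def outside (I : Finset ℕ) (σ : Seq) : Restriction := fun p => if p ∈ I then none else some (σ p)

/-- Lexicographic order between two restrictions of the same set `I` of positions. -/
def LexLT (I : Finset ℕ) (s s' : Restriction) : Prop :=
  ∃ p ∈ I, s p = some false ∧ s' p = some true ∧ ∀ q ∈ I, q < p → s q = s' q

end Restriction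

/-! ### Partition refinements -/

/-- A partition refinement of `Ω`. The value `part t x` is the part with coordinate `x` at time
`t`, and `none` means that it is undefined. The strings `x0`, `x1` are `x ++ [false]`,
`x ++ [true]`. -/
structure PartitionRefinement (Ω : Type) where
  part : ℕ → List Bool → Option (Set Ω)
  nonempty : ∀ t x v, part t x = some v → v.Nonempty
  root : part 0 [] = some Set.univ
  persist : ∀ t t' x v, part t x = some v → t ≤ t' → part t' x = some v
  split : ∀ t x b w, part t (x ++ [b]) = some w →
    ∃ t' v v₀ v₁, t = t' + 1 ∧ part t' x = some v ∧
      part t (x ++ [false]) = some v₀ ∧ part t (x ++ [true]) = some v₁ ∧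
      v₀ ∪ v₁ = v ∧ Disjoint v₀ v₁

namespace PartitionRefinement

variable {Ω : Type} (S : PartitionRefinement Ω)

/-- The coordinate `x` is terminal at `t`. -/
def IsTerminal (t : ℕ) (x : List Bool) : Prop :=
  S.part t x ≠ none ∧ S.part t (x ++ [false]) = none ∧ S.part t (x ++ [true]) = none

/-- The part with coordinate `x` is split at `t`: it is terminal at `t - 1` but not at `t`. -/
def SplitAt (t : ℕ) (x : List Bool) : Prop :=
  ∃ t', t = t' + 1 ∧ S.IsTerminal t' x ∧ ¬ S.IsTerminal t x

end PartitionRefinement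

/-! ### The finite game: partition evaluations and `(N, φ)`-sequences -/

/-- A partition evaluation of `Ω`: a partition refinement with a nonnegative evaluation function
that is nondecreasing in the time and along continuations of coordinates. -/
structure PartitionEvaluation (Ω : Type) extends PartitionRefinement Ω where
  eval : ℕ → List Bool → ℝ
  eval_nonneg : ∀ t x, 0 ≤ eval t x
  eval_mono : ∀ t t' x x', t ≤ t' → x <+: x' → eval t x ≤ eval t' x'

namespace PartitionEvaluation

variable {Ω : Type} (P : PartitionEvaluation Ω)

/-- The element `s` is `(N, φ)`-good at `t`: the terminal part that contains it was split less
than `N` times, has more than `φ` elements, and its evaluation is less than `2`. -/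
def Good (N φ : ℕ) (s : Ω) (t : ℕ) : Prop :=
  ∃ x v, P.IsTerminal t x ∧ P.part t x = some v ∧ s ∈ v ∧
    x.length < N ∧ φ < v.ncard ∧ P.eval t x < 2

/-- At `t` a part that contains `s` is split, or has an evaluation that is no longer below `2`. -/
def Event (s : Ω) (t : ℕ) : Prop :=
  ∃ x v, P.part t x = some v ∧ s ∈ v ∧ (P.SplitAt t x ∨ 2 ≤ P.eval t x)

end PartitionEvaluation

/-- The element `s` becomes stale after `t` at `t'` with respect to the pair `P, P'`. -/
def StalePE {Ω : Type} (P P' : PartitionEvaluation Ω) (s : Ω) (t t' : ℕ) : Prop :=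
  t < t' ∧ (P.Event s t' ∨ P'.Event s t') ∧
    ∀ t'', t < t'' → t'' < t' → ¬ (P.Event s t'' ∨ P'.Event s t'')

/-- `C 0, …, C (k - 1)` is an `(N, φ)`-sequence with respect to `P, P'`: with `τ 0 = 0`, every
`C i` is good at `τ i`, and becomes stale after `τ i` at `τ (i + 1)` if it is not the last one. -/
def IsGoodSequence {Ω : Type} (P P' : PartitionEvaluation Ω) (N φ k : ℕ) (C : Fin k → Ω) : Prop :=
  ∃ τ : ℕ → ℕ, τ 0 = 0 ∧ ∀ i : Fin k,
    P.Good N φ (C i) (τ i) ∧ P'.Good N φ (C i) (τ i) ∧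
    ((i : ℕ) + 1 < k → StalePE P P' (C i) (τ i) (τ (i + 1)))

/-- `q` is an upper bound on the length of an `(N, φ)`-sequence against a pair of partition
evaluations of a set with `2 ^ ℓ` elements. -/
def IsLengthBound (ℓ N φ : ℕ) (q : ℝ) : Prop :=
  ∀ (Ω : Type) [Finite Ω], Nat.card Ω = 2 ^ ℓ →
    ∀ (P P' : PartitionEvaluation Ω) (k : ℕ) (C : Fin k → Ω),
      IsGoodSequence P P' N φ k C → (k : ℝ) ≤ q

/-! ### Betting strategies -/

/-- A betting strategy: a partition refinement of the set of sequences into clopen parts, with a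
mass function on coordinates. -/
structure BettingStrategy extends PartitionRefinement Seq where
  clopen : ∀ t x v, part t x = some v → IsClopen v
  mass : List Bool → ℝ
  mass_nonneg : ∀ x, 0 ≤ mass x
  mass_add : ∀ x, mass x = mass (x ++ [false]) + mass (x ++ [true])

namespace BettingStrategy

variable (A : BettingStrategy)

/-- The strategy is computable: from `t, x` one can compute whether `S^t(x)` is defined and a code
of this clopen set, and an algorithm computes the (rational) mass of every coordinate that gets
defined. -/
def IsComputable : Prop :=
  (∃ f : ℕ → List Bool → Option (List (List Bool)), Computable₂ f ∧
    ∀ t x, A.part t x = (f t x).map clopenOf) ∧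
  ∃ m : List Bool →. ℕ × ℕ, Partrec m ∧ ∀ t x, A.part t x ≠ none →
    ∃ a b : ℕ, (a, b) ∈ m x ∧ 0 < b ∧ A.mass x = (a : ℝ) / (b : ℝ)

/-- The capital of a coordinate that is defined at time `t`. -/
noncomputable def capital (t : ℕ) (x : List Bool) : ℝ :=
  A.mass x / (size ((A.part t x).getD ∅)).toReal

/-- The maximum capital of a coordinate defined at time `t`: the maximum over its prefixes. -/
noncomputable def maxCapital (t : ℕ) (x : List Bool) : ℝ :=
  (Finset.range (x.length + 1)).sup' ⟨0, by simp⟩ fun k => A.capital t (x.take k)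

/-- The coordinate `x` is terminal at `t` and its part contains the set `E`. -/
def TerminalOver (t : ℕ) (x : List Bool) (E : Set Seq) : Prop :=
  A.IsTerminal t x ∧ ∃ v, A.part t x = some v ∧ E ⊆ v

/-- At all times, the capital achieved on `σ` is below `c`. -/
def AchievesBelow (c : ℝ) (σ : Seq) : Prop :=
  ∀ t x, A.TerminalOver t x {σ} → A.maxCapital t x < c

/-- The strategy wins on `σ`: the achieved capital is unbounded. -/
def Wins (σ : Seq) : Prop :=
  ∀ c : ℝ, ∃ t x, A.TerminalOver t x {σ} ∧ c < A.maxCapital t x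

/-- The part with coordinate `y` is split into two parts that both intersect `[r]`. -/
def SplitOn (r : Restriction) (y : List Bool) : Prop :=
  ∃ t v₀ v₁, A.part t (y ++ [false]) = some v₀ ∧ A.part t (y ++ [true]) = some v₁ ∧
    (v₀ ∩ r.cyl).Nonempty ∧ (v₁ ∩ r.cyl).Nonempty

/-- The number of times the part with coordinate `x` was split on `r`: the number of proper
prefixes of `x` whose part is split on `r`. -/
noncomputable def splitsOn (r : Restriction) (x : List Bool) : ℕ :=
  {k : ℕ | k < x.length ∧ A.SplitOn r (x.take k)}.ncard

/-- The strategy `I`-splits on `σ` more than `N` times. -/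
def Violates (I : Finset ℕ) (N : ℕ) (σ : Seq) : Prop :=
  ∃ t x v, A.part t x = some v ∧ σ ∈ v ∧ N < A.splitsOn (Restriction.outside I σ) x

/-- The restriction `r` is elementary at `t`. -/
def Elementary (t : ℕ) (r : Restriction) : Prop := ∃ x, A.TerminalOver t x r.cyl

/-- The positions inspected up to time `t`: the least set `K` of positions such that all
restrictions of exactly the positions in `K` are elementary at `t`. -/
def inspected (t : ℕ) : Set ℕ :=
  {p | ∀ L : Finset ℕ, (∀ r : Restriction, r.dom = ↑L → A.Elementary t r) → p ∈ L}

/-- For a tail `r` that is `I`-granular at `t` and a head `s` that restricts `I`: the head `s` is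
`(N, φ)`-good at `t` with respect to the strategy projected on `r`. The projection of a part is
the set of heads `s'` for which the part contains `[s'^r]`; the number of times it was split is
the number of splits on `r`; its evaluation is the maximum capital. -/
def Good (I : Finset ℕ) (N φ : ℕ) (s r : Restriction) (t : ℕ) : Prop :=
  ∃ x v, A.IsTerminal t x ∧ A.part t x = some v ∧ (s.concat r).cyl ⊆ v ∧
    A.splitsOn r x < N ∧
    φ < {s' : Restriction | s'.dom = ↑I ∧ (s'.concat r).cyl ⊆ v}.ncard ∧
    A.maxCapital t x < 2

/-- At `t` the part that contains `[s^r]` is split on `r`, or its maximum capital is no longer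
below `2`. -/
def Event (s r : Restriction) (t : ℕ) : Prop :=
  (∃ x v, A.part t x = some v ∧ (s.concat r).cyl ⊆ v ∧ A.SplitAt t x ∧ A.SplitOn r x) ∨
  (∃ x, A.TerminalOver t x (s.concat r).cyl ∧ 2 ≤ A.maxCapital t x)

end BettingStrategy

/-! ### The basic game -/

/-- The restriction `s^r` becomes `I`-stale after `t` at `t'` with respect to `A, B`. -/
def Stale (A B : BettingStrategy) (s r : Restriction) (t t' : ℕ) : Prop :=
  t < t' ∧ (A.Event s r t' ∨ B.Event s r t') ∧
    ∀ t'', t < t'' → t'' < t' → ¬ (A.Event s r t'' ∨ B.Event s r t'')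

/-- `s` is the lexicographically least restriction of `I` such that `s^r` is
`(I, (N, φ))`-good at `t` with respect to `A, B`. -/
def LeastGood (A B : BettingStrategy) (I : Finset ℕ) (N φ : ℕ) (s r : Restriction) (t : ℕ) :
    Prop :=
  s.dom = ↑I ∧ A.Good I N φ s r t ∧ B.Good I N φ s r t ∧
    ∀ s' : Restriction, s'.dom = ↑I → A.Good I N φ s' r t → B.Good I N φ s' r t →
      ¬ Restriction.LexLT I s' s

/-- `Chosen A B I N φ z s r t`: in the basic game on `I, z` against `A, B` with parameters `N, φ`
the restriction with head `s` and tail `r` is chosen at time `t`. The tails considered at time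
`t` restrict the positions outside `I` that were inspected up to time `t` or are restricted by
`z`. -/
inductive Chosen (A B : BettingStrategy) (I : Finset ℕ) (N φ : ℕ) (z : Restriction) :
    Restriction → Restriction → ℕ → Prop
  | start : Chosen A B I N φ z (Restriction.zeros I) z 0
  | next (s r s' r' : Restriction) (t t' : ℕ) (h : Chosen A B I N φ z s r t)
      (hdom : r'.dom = (A.inspected t' ∪ B.inspected t' ∪ z.dom) \ ↑I)
      (hext : r.Extends r') (hstale : Stale A B s r' t t')
      (hgood : LeastGood A B I N φ s' r' t') : Chosen A B I N φ z s' r' t'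

/-! ### Game zones and levels of chosen restrictions -/

/-- A zone `(I, (N, φ))`. -/
structure Zone where
  I : Finset ℕ
  N : ℕ
  φ : ℕ

/-- Game zones `Z 0, Z 1, …` (the first zone is `Z 0`): the sets of positions are disjoint. -/
def IsGameZones (Z : ℕ → Zone) : Prop := Pairwise fun i j => Disjoint (Z i).I (Z j).I

/-- The sequence of zones is computable. -/
def ComputableZones (Z : ℕ → Zone) : Prop :=
  (∃ l : ℕ → List ℕ, Computable l ∧ ∀ i, (l i).toFinset = (Z i).I) ∧
  Computable (fun i => (Z i).N) ∧ Computable (fun i => (Z i).φ)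

/-- The sequences for which the bound on the number of splits in the zone is violated by `A` or
by `B`. -/
def violating (A B : BettingStrategy) (ζ : Zone) : Set Seq :=
  {σ | A.Violates ζ.I ζ.N σ ∨ B.Violates ζ.I ζ.N σ}

/-- The levels of chosen restrictions; in the basic game on a zone `(I, (N, φ))` a part counts as
good only if it was split at most `N` times, that is, less than `N + 1` times. -/
def chosenLevel (A B : BettingStrategy) (Z : ℕ → Zone) : ℕ → Set Restriction
  | 0 => {Restriction.empty}
  | n + 1 => {c | ∃ z ∈ chosenLevel A B Z n, ∃ i, Disjoint z.dom (↑(Z i).I : Set ℕ) ∧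
      ∃ s r t, Chosen A B (Z i).I ((Z i).N + 1) (Z i).φ z s r t ∧ c = s.concat r}

/-- The open set of the sequences consistent with some restriction in the `n`-th level. -/
def chosenSet (A B : BettingStrategy) (Z : ℕ → Zone) (n : ℕ) : Set Seq :=
  {σ | ∃ c ∈ chosenLevel A B Z n, σ ∈ c.cyl}

/-! ### Martin-Löf tests -/

/-- `U 0, U 1, …` are the levels of a Martin-Löf test. -/
def IsMLTest (U : ℕ → Set Seq) : Prop :=
  (∃ f : ℕ → ℕ → List Bool, Computable₂ f ∧ ∀ n, U n = ⋃ k, basic (f n k)) ∧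
  (∀ n, size (U n) ≤ (2⁻¹ : ℝ≥0∞) ^ n) ∧ ∀ n, U (n + 1) ⊆ U n

/-- The sequence `σ` is Martin-Löf random: it fails no Martin-Löf test. -/
def IsMLRandom (σ : Seq) : Prop := ∀ U : ℕ → Set Seq, IsMLTest U → ∃ n, σ ∉ U n

end BettingGame

/-! Let `P` be the closed set of sequences on which both strategies stay below 2. By Kolmogorov's
inequality a strategy reaches capital 2 with probability at most half of its initial mass, so `P`
has measure at least 1/2 (`size_bothBelow_pos`). The basic game produces a null set that meets `P`.

Fix a zone `(I, N, φ)` and the bits outside `I`. The sequences with these bits form a fibre of `2 ^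
|I|` elements, and the game can be played on the fibre itself (`Reach`). Projected to the fibre,
with the splits that leave the fibre on one side dropped (`comap`, `projectEval`), the two
strategies become partition evaluations, and the successive choices form an `(N + 1, φ)`-sequence.
The bound on its length confines the choices to a fraction `2^-(i+2)` of every fibre, where zones
are counted from 0. Averaging over the fibres and summing over the zones, the restrictions chosen
from `z` have at most half the measure of `[z]`, so level `n` has measure at most `2^-n`
(`tsum_size_chosenLevel_le`). A choice made at time `t` depends only on the bits in `I` and at the
positions inspected by then. Runs of the game are therefore finite objects that can be checked, and
the levels are enumerable (`exists_computable_chosenSet`).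

A member of `P` in all levels is found step by step (`exists_next_level`). Let `P ∩ [z]` have
positive measure, and take a late zone disjoint from the domain of `z`. Two kinds of exceptions are
small: sequences with too many splits, by (II), and sequences that get, after at most `N` splits,
into a part with at most `φ` elements of the fibre, by a Kraft inequality and (III). Any other `σ`
in `P ∩ [z]` is good at all times, so the game on its fibre is never stuck. As the game is short,
some choice `τ` never becomes stale, and then `τ` is in `P`. Now `τ` is `σ` with finitely many bits
flipped. Flips preserve the measure and there are countably many chosen restrictions `c`, so some `P
∩ [c]` has positive measure. Iteration and compactness give the sequence.

Parts that were split exactly `N` times must count as good here, whence the parameter `N + 1`. For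
(a) the length bound with `N + 1` comes from counting: every staleness uses up a coordinate shorter
than the parameter in one of the two evaluations (`IsGoodSequence.length_le`). Once the first three
zones are dropped, (III) makes this count small enough, and the argument for (b) applies. -/

/-! ### Closure properties of computable functions -/

namespace Computable

variable {α β γ σ : Type*} [Primcodable α] [Primcodable β] [Primcodable γ] [Primcodable σ]

attribute [fun_prop] Computable

@[fun_prop] theorem fun_id : Computable fun x : α => x := Computable.id

@[fun_prop] theorem fun_const (b : β) : Computable fun _ : α => b := Computable.const b

@[fun_prop] theorem fun_comp {f : β → γ} {g : α → β} (hf : Computable f) (hg : Computable g) :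
    Computable fun x => f (g x) := hf.comp hg

@[fun_prop] theorem fun_fst {g : α → β × γ} (hg : Computable g) : Computable fun x => (g x).1 :=
  Computable.fst.comp hg

@[fun_prop] theorem fun_snd {g : α → β × γ} (hg : Computable g) : Computable fun x => (g x).2 :=
  Computable.snd.comp hg

@[fun_prop] theorem fun_pair {f : α → β} {g : α → γ} (hf : Computable f) (hg : Computable g) :
    Computable fun x => (f x, g x) := hf.pair hg

@[fun_prop] theorem nat_add {f g : α → ℕ} (hf : Computable f) (hg : Computable g) :
    Computable fun x => f x + g x := Primrec.nat_add.to_comp.comp hf hg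

@[fun_prop] theorem nat_sub {f g : α → ℕ} (hf : Computable f) (hg : Computable g) :
    Computable fun x => f x - g x := Primrec.nat_sub.to_comp.comp hf hg

@[fun_prop] theorem nat_mul {f g : α → ℕ} (hf : Computable f) (hg : Computable g) :
    Computable fun x => f x * g x := Primrec.nat_mul.to_comp.comp hf hg

@[fun_prop] theorem fun_append {f g : α → List β} (hf : Computable f) (hg : Computable g) :
    Computable fun x => f x ++ g x := Primrec.list_append.to_comp.comp hf hg

@[fun_prop] theorem fun_cons {f : α → β} {g : α → List β} (hf : Computable f)
    (hg : Computable g) : Computable fun x => f x :: g x := Primrec.list_cons.to_comp.comp hf hg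

@[fun_prop] theorem fun_length {f : α → List β} (hf : Computable f) :
    Computable fun x => (f x).length := Computable.list_length.comp hf

@[fun_prop] theorem fun_flatten {f : α → List (List β)} (hf : Computable f) :
    Computable fun x => (f x).flatten := Primrec.list_flatten.to_comp.comp hf

@[fun_prop] theorem fun_take {f : α → List β} {n : α → ℕ} (hn : Computable n)
    (hf : Computable f) : Computable fun x => (f x).take (n x) :=
  Primrec.list_take.to_comp.comp hn hf

@[fun_prop] theorem fun_drop {f : α → List β} {n : α → ℕ} (hn : Computable n)
    (hf : Computable f) : Computable fun x => (f x).drop (n x) :=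
  Primrec.list_drop.to_comp.comp hn hf

@[fun_prop] theorem fun_range {n : α → ℕ} (hn : Computable n) :
    Computable fun x => List.range (n x) := Primrec.list_range.to_comp.comp hn

@[fun_prop] theorem fun_getD {f : α → List β} {n : α → ℕ} {d : β} (hf : Computable f)
    (hn : Computable n) : Computable fun x => (f x).getD (n x) d :=
  (Primrec.list_getD d).to_comp.comp hf hn

@[fun_prop] theorem fun_getElem? {f : α → List β} {n : α → ℕ} (hf : Computable f)
    (hn : Computable n) : Computable fun x => (f x)[n x]? :=
  Computable.list_getElem?.comp hf hn

@[fun_prop] theorem fun_and {f g : α → Bool} (hf : Computable f) (hg : Computable g) :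
    Computable fun x => f x && g x := Primrec.and.to_comp.comp hf hg

@[fun_prop] theorem fun_or {f g : α → Bool} (hf : Computable f) (hg : Computable g) :
    Computable fun x => f x || g x := Primrec.or.to_comp.comp hf hg

@[fun_prop] theorem fun_not {f : α → Bool} (hf : Computable f) :
    Computable fun x => !(f x) := Primrec.not.to_comp.comp hf

@[fun_prop] theorem fun_bne {f g : α → Bool} (hf : Computable f) (hg : Computable g) :
    Computable fun x => f x == g x :=
  (Primrec.eq (α := Bool)).decide.to_comp.comp hf hg |>.of_eq fun x => by
    cases f x <;> cases g x <;> rfl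

@[fun_prop] theorem fun_ble {f g : α → ℕ} (hf : Computable f) (hg : Computable g) :
    Computable fun x => Nat.ble (f x) (g x) :=
  (Primrec.nat_le.decide.to_comp.comp hf hg).of_eq fun x => by
    rw [Bool.eq_iff_iff, decide_eq_true_iff, Nat.ble_eq]

@[fun_prop] theorem decide_eq [DecidableEq β] {f g : α → β} (hf : Computable f)
    (hg : Computable g) : Computable fun x => decide (f x = g x) :=
  Primrec.eq.decide.to_comp.comp hf hg

@[fun_prop] theorem fun_isSome {f : α → Option β} (hf : Computable f) :
    Computable fun x => (f x).isSome := Primrec.option_isSome.to_comp.comp hf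

@[fun_prop] theorem fun_option_getD {f : α → Option β} {d : β} (hf : Computable f) :
    Computable fun x => (f x).getD d := Computable.option_getD hf (Computable.const d)

@[fun_prop] theorem two_pow {n : α → ℕ} (hn : Computable n) : Computable fun x => 2 ^ n x := by
  have : Computable fun n : ℕ => 2 ^ n := by
    have h : Primrec₂ fun (_ : Unit) (n : ℕ) => 2 ^ n :=
      (Primrec.nat_rec (f := fun _ : Unit => 1) (g := fun _ p => 2 * p.2)
        (Primrec.const 1) ((Primrec.nat_mul.comp (Primrec.const 2)
          (Primrec.snd.comp Primrec.snd)).to₂)).of_eq fun _ n => by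
        induction n with
        | zero => rfl
        | succ n ih => simp only [pow_succ'] at ih ⊢; rw [← ih]
    exact (h.comp (Primrec.const ()) Primrec.id).to_comp
  exact this.comp hn

/-- A fold is a recursion on the index that stands still beyond the end of the list. Map, filter and
the bounded quantifiers below reduce to folds, so that `fun_prop` can settle the decision procedures
of the game. -/
theorem list_foldl {f : α → List β} {g : α → σ} {h : α → σ × β → σ} (hf : Computable f)
    (hg : Computable g) (hh : Computable₂ h) :
    Computable fun a => (f a).foldl (fun s b => h a (s, b)) (g a) := by
  have key : ∀ (a : α) (l : List β) (n : ℕ), Nat.rec (g a) (fun m s =>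
      ((l[m]?).map fun b => h a (s, b)).getD s) n
      = (l.take n).foldl (fun s b => h a (s, b)) (g a) := by
    intro a l n
    induction n with
    | zero => simp
    | succ n ih =>
      simp only [ih]
      rcases lt_or_ge n l.length with hn | hn
      · rw [List.take_add_one, List.foldl_append]
        simp [List.getElem?_eq_getElem hn]
      · simp [List.getElem?_eq_none hn, List.take_of_length_le hn,
          List.take_of_length_le (Nat.le_succ_of_le hn)]
  have h1 : Computable₂ fun (a : α) (p : ℕ × σ) =>
      (((f a)[p.1]?).map fun b => h a (p.2, b)).getD p.2 := by
    refine Computable.option_getD (Computable.option_map ?_ ?_) ?_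
    · fun_prop
    · exact hh.comp (by fun_prop) (by fun_prop)
    · fun_prop
  refine (Computable.nat_rec (f := fun a => (f a).length) (by fun_prop) hg h1).of_eq fun a => ?_
  have := key a (f a) (f a).length
  simp only [List.take_length] at this
  exact this

@[fun_prop] theorem fun_map {f : α → List β} {g : α → β → γ} (hf : Computable f)
    (hg : Computable fun x : α × β => g x.1 x.2) : Computable fun a => (f a).map (g a) := by
  refine (list_foldl (h := fun a p => p.1 ++ [g a p.2]) hf (Computable.const ([] : List γ))
    ?_).of_eq fun a => ?_
  · have : Computable fun x : α × (List γ × β) => g x.1 x.2.2 :=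
      hg.comp (g := fun x : α × (List γ × β) => (x.1, x.2.2)) (by fun_prop)
    exact Computable₂.mk (by fun_prop)
  · suffices ∀ (l : List β) (acc : List γ),
        l.foldl (fun s b => s ++ [g a b]) acc = acc ++ l.map (g a) by simpa using this (f a) []
    intro l
    induction l with
    | nil => simp
    | cons b l ih => intro acc; simp [ih]

@[fun_prop] theorem fun_filter {f : α → List β} {p : α → β → Bool} (hf : Computable f)
    (hp : Computable fun x : α × β => p x.1 x.2) : Computable fun a => (f a).filter (p a) := by
  refine (list_foldl (h := fun a q => bif p a q.2 then q.1 ++ [q.2] else q.1) hf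
    (Computable.const ([] : List β)) ?_).of_eq fun a => ?_
  · have : Computable fun x : α × (List β × β) => p x.1 x.2.2 :=
      hp.comp (g := fun x : α × (List β × β) => (x.1, x.2.2)) (by fun_prop)
    exact Computable₂.mk (Computable.cond this (by fun_prop) (by fun_prop))
  · suffices ∀ (l : List β) (acc : List β),
        l.foldl (fun s b => bif p a b then s ++ [b] else s) acc = acc ++ l.filter (p a) by
      simpa using this (f a) []
    intro l
    induction l with
    | nil => simp
    | cons b l ih => intro acc; cases h : p a b <;> simp [ih, h]

@[fun_prop] theorem fun_all {f : α → List β} {p : α → β → Bool} (hf : Computable f)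
    (hp : Computable fun x : α × β => p x.1 x.2) : Computable fun a => (f a).all (p a) := by
  refine Computable.of_eq (f := fun a => decide (((f a).filter (p a)).length = (f a).length))
    (by fun_prop) fun a => ?_
  rw [Bool.eq_iff_iff, decide_eq_true_iff, List.all_eq_true, List.length_filter_eq_length_iff]

@[fun_prop] theorem fun_any {f : α → List β} {p : α → β → Bool} (hf : Computable f)
    (hp : Computable fun x : α × β => p x.1 x.2) : Computable fun a => (f a).any (p a) := by
  refine Computable.of_eq (f := fun a => !((f a).all fun b => !(p a b)))
    (by fun_prop) fun a => ?_
  rw [Bool.eq_iff_iff]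
  simp

@[fun_prop] theorem fun_flatMap {f : α → List β} {g : α → β → List γ} (hf : Computable f)
    (hg : Computable fun x : α × β => g x.1 x.2) : Computable fun a => (f a).flatMap (g a) := by
  simp only [List.flatMap]
  fun_prop

end Computable

/-- All binary strings of length `n`. -/
def bitStrings : ℕ → List (List Bool)
  | 0 => [[]]
  | n + 1 => (bitStrings n).flatMap fun w => [false :: w, true :: w]

theorem mem_bitStrings {n : ℕ} {w : List Bool} : w ∈ bitStrings n ↔ w.length = n := by
  induction n generalizing w with
  | zero => simp [bitStrings]
  | succ n ih =>
    simp only [bitStrings, List.mem_flatMap, ih]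
    cases w with
    | nil => simp
    | cons b w => cases b <;> simp

theorem nodup_bitStrings (n : ℕ) : (bitStrings n).Nodup := by
  induction n with
  | zero => simp [bitStrings]
  | succ n ih =>
    refine List.nodup_flatMap.2 ⟨fun w _ => by simp, ih.imp fun {a b} hab => ?_⟩
    simp [Function.onFun, hab.symm]

namespace Computable

@[fun_prop] theorem fun_bitStrings {α : Type*} [Primcodable α] {n : α → ℕ} (hn : Computable n) :
    Computable fun a => bitStrings (n a) := by
  have : Computable bitStrings := by
    refine (Computable.nat_rec (f := fun n : ℕ => n) (g := fun _ => [[]])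
      (h := fun _ p => p.2.flatMap fun w => [false :: w, true :: w])
      Computable.id (Computable.const _) (Computable₂.mk (by fun_prop))).of_eq fun n => ?_
    induction n with
    | zero => rfl
    | succ n ih => simp only [bitStrings, ← ih]
  exact this.comp hn

end Computable

namespace BettingGame

/-! ### The tree of a partition refinement -/

theorem exists_branch {x y : List Bool} (h : ¬ x <+: y) (h' : ¬ y <+: x) :
    ∃ c b, c ++ [b] <+: x ∧ c ++ [!b] <+: y := by
  induction x generalizing y with
  | nil => exact absurd List.nil_prefix h
  | cons a x ih =>
    cases y with
    | nil => exact absurd List.nil_prefix h'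
    | cons a' y =>
      by_cases ha : a = a'
      · subst ha
        obtain ⟨c, b, h1, h2⟩ := ih (y := y) (fun hp => h (by simpa using hp))
          (fun hp => h' (by simpa using hp))
        exact ⟨a :: c, b, by simpa using h1, by simpa using h2⟩
      · have : a' = !a := by cases a <;> cases a' <;> simp_all
        exact ⟨[], a, by simp, by simp [this]⟩

namespace PartitionRefinement

variable {Ω : Type} (S : PartitionRefinement Ω)

/-- The part with coordinate `x` is defined at `t` and contains `a`. -/
def Mem (t : ℕ) (x : List Bool) (a : Ω) : Prop := ∃ v, S.part t x = some v ∧ a ∈ v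

variable {S} {t t' : ℕ} {x y : List Bool} {a : Ω} {b : Bool}

theorem mem_iff {v : Set Ω} (h : S.part t x = some v) : S.Mem t x a ↔ a ∈ v := by
  simp [Mem, h]

theorem Mem.defined (h : S.Mem t x a) : S.part t x ≠ none := by
  obtain ⟨v, hv, -⟩ := h
  simp [hv]

theorem exists_mem (h : S.part t x ≠ none) : ∃ a, S.Mem t x a := by
  obtain ⟨v, hv⟩ := Option.ne_none_iff_exists'.1 h
  obtain ⟨a, ha⟩ := S.nonempty t x v hv
  exact ⟨a, v, hv, ha⟩

theorem defined_mono (h : S.part t x ≠ none) (ht : t ≤ t') : S.part t' x = S.part t x := by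
  obtain ⟨v, hv⟩ := Option.ne_none_iff_exists'.1 h
  rw [hv, S.persist t t' x v hv ht]

theorem defined_eq (h : S.part t x ≠ none) (h' : S.part t' x ≠ none) :
    S.part t x = S.part t' x := by
  rcases le_total t t' with ht | ht
  · exact (defined_mono h ht).symm
  · exact defined_mono h' ht

theorem Mem.mono (h : S.Mem t x a) (ht : t ≤ t') : S.Mem t' x a := by
  obtain ⟨v, hv, ha⟩ := h
  exact ⟨v, S.persist t t' x v hv ht, ha⟩

theorem mem_congr (h : S.part t x ≠ none) (h' : S.part t' x ≠ none) :
    S.Mem t x a ↔ S.Mem t' x a := by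
  rw [Mem, Mem, defined_eq h h']

theorem mem_nil : S.Mem t [] a :=
  Mem.mono ⟨_, S.root, Set.mem_univ a⟩ (Nat.zero_le t)

theorem nil_defined : S.part t [] = some Set.univ := S.persist 0 t [] _ S.root (Nat.zero_le t)

theorem children (h : S.part t (x ++ [b]) ≠ none) :
    (∃ t', t = t' + 1 ∧ S.part t' x ≠ none) ∧
      S.part t (x ++ [false]) ≠ none ∧ S.part t (x ++ [true]) ≠ none ∧
      (∀ a, S.Mem t x a ↔ S.Mem t (x ++ [false]) a ∨ S.Mem t (x ++ [true]) a) ∧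
      ∀ a, ¬ (S.Mem t (x ++ [false]) a ∧ S.Mem t (x ++ [true]) a) := by
  obtain ⟨w, hw⟩ := Option.ne_none_iff_exists'.1 h
  obtain ⟨t', v, v₀, v₁, rfl, hv, h0, h1, hu, hd⟩ := S.split t x b w hw
  have hv' := S.persist t' (t' + 1) x v hv (Nat.le_succ _)
  refine ⟨⟨t', rfl, by simp [hv]⟩, by simp [h0], by simp [h1], fun a => ?_, fun a => ?_⟩
  · rw [mem_iff hv', mem_iff h0, mem_iff h1, ← hu, Set.mem_union]
  · rw [mem_iff h0, mem_iff h1]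
    exact fun h => Set.disjoint_left.1 hd h.1 h.2

theorem child_defined (h : S.part t (x ++ [b]) ≠ none) (b' : Bool) :
    S.part t (x ++ [b']) ≠ none := by
  cases b'
  · exact (children h).2.1
  · exact (children h).2.2.1

theorem Mem.parent (h : S.Mem t (x ++ [b]) a) : S.Mem t x a := by
  refine ((children h.defined).2.2.2.1 a).2 ?_
  cases b
  · exact Or.inl h
  · exact Or.inr h

theorem Mem.not_sibling (h : S.Mem t (x ++ [b]) a) : ¬ S.Mem t (x ++ [!b]) a := by
  intro h'
  cases b
  · exact (children h.defined).2.2.2.2 a ⟨h, h'⟩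
  · exact (children h.defined).2.2.2.2 a ⟨h', h⟩

theorem Mem.of_prefix (h : S.Mem t x a) (hy : y <+: x) : S.Mem t y a := by
  obtain ⟨l, rfl⟩ := hy
  induction l using List.reverseRecOn with
  | nil => simpa using h
  | append_singleton l b ih =>
    rw [← List.append_assoc] at h
    exact ih h.parent

theorem defined_of_prefix (h : S.part t x ≠ none) (hy : y <+: x) : S.part t y ≠ none := by
  obtain ⟨a, ha⟩ := exists_mem h
  exact (ha.of_prefix hy).defined

/-- A child requires its parent to be defined at the preceding time, so every bit costs a time step.
Hence only finitely many coordinates are defined at any time, and `tree_induction` is well-founded.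
-/
theorem length_le (h : S.part t x ≠ none) : x.length ≤ t := by
  induction x using List.reverseRecOn generalizing t with
  | nil => simp
  | append_singleton x b ih =>
    obtain ⟨t', rfl, ht'⟩ := (children h).1
    have := ih ht'
    simp only [List.length_append, List.length_singleton]
    omega

/-- Where incomparable coordinates branch, `a` would lie in both halves of a partition. So the
coordinates of the parts containing `a` form a chain, even across different times. -/
theorem Mem.comparable (h : S.Mem t x a) (h' : S.Mem t' y a) : x <+: y ∨ y <+: x := by
  by_contra! hc
  obtain ⟨c, b, h1, h2⟩ := exists_branch hc.1 hc.2
  have e1 := (h.mono (le_max_left t t')).of_prefix h1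
  have e2 := (h'.mono (le_max_right t t')).of_prefix h2
  exact e1.not_sibling e2

theorem isTerminal_iff :
    S.IsTerminal t x ↔ S.part t x ≠ none ∧ S.part t (x ++ [false]) = none := by
  refine ⟨fun h => ⟨h.1, h.2.1⟩, fun h => ⟨h.1, h.2, ?_⟩⟩
  by_contra hc
  exact child_defined hc false h.2

theorem IsTerminal.child_none (h : S.IsTerminal t x) (b : Bool) : S.part t (x ++ [b]) = none := by
  cases b
  · exact h.2.1
  · exact h.2.2

theorem child_defined_of_not_terminal (h : S.part t x ≠ none) (hx : ¬ S.IsTerminal t x)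
    (b : Bool) : S.part t (x ++ [b]) ≠ none := by
  rw [isTerminal_iff] at hx
  push Not at hx
  exact child_defined (hx h) b

theorem IsTerminal.anti (h : S.IsTerminal t' x) (hx : S.part t x ≠ none) (ht : t ≤ t') :
    S.IsTerminal t x := by
  rw [isTerminal_iff] at h ⊢
  refine ⟨hx, ?_⟩
  by_contra hc
  rw [defined_mono hc ht] at h
  exact hc h.2

theorem IsTerminal.prefix_of_comparable (h : S.IsTerminal t x) (hy : S.part t y ≠ none)
    (hc : x <+: y ∨ y <+: x) : y <+: x := by
  rcases hc with hp | hp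
  · obtain ⟨l, rfl⟩ := hp
    cases l with
    | nil => simp
    | cons b l =>
      exact absurd (h.child_none b) (defined_of_prefix hy ⟨l, by simp⟩)
  · exact hp

theorem Mem.prefix_terminal (h' : S.Mem t y a) (h : S.IsTerminal t x) (hx : S.Mem t x a) :
    y <+: x :=
  h.prefix_of_comparable h'.defined (hx.comparable h')

theorem Mem.terminal_unique (hx : S.Mem t x a) (h : S.IsTerminal t x) (hy : S.Mem t y a)
    (h' : S.IsTerminal t y) : x = y :=
  (hx.prefix_terminal h' hy).eq_of_length
    (le_antisymm (hx.prefix_terminal h' hy).length_le (hy.prefix_terminal h hx).length_le)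

/-- Induction from the terminal parts at `t` towards the root. -/
theorem tree_induction {p : List Bool → Prop} (t : ℕ)
    (terminal : ∀ x, S.IsTerminal t x → p x)
    (node : ∀ x, S.part t x ≠ none → (∀ b, S.part t (x ++ [b]) ≠ none) →
      p (x ++ [false]) → p (x ++ [true]) → p x) :
    ∀ x, S.part t x ≠ none → p x := by
  suffices ∀ n x, S.part t x ≠ none → t ≤ x.length + n → p x from
    fun x hx => this t x hx (Nat.le_add_left _ _)
  intro n
  induction n with
  | zero =>
    intro x hx hn
    refine terminal x (isTerminal_iff.2 ⟨hx, ?_⟩)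
    by_contra hc
    have := length_le hc
    simp at this
    omega
  | succ n ih =>
    intro x hx hn
    by_cases hT : S.IsTerminal t x
    · exact terminal x hT
    · have hc := child_defined_of_not_terminal hx hT
      refine node x hx hc (ih _ (hc false) ?_) (ih _ (hc true) ?_) <;> simp <;> omega

theorem exists_terminal_of_mem (h : S.Mem t x a) :
    ∃ y, x <+: y ∧ S.IsTerminal t y ∧ S.Mem t y a := by
  refine tree_induction (S := S) (p := fun x => S.Mem t x a →
    ∃ y, x <+: y ∧ S.IsTerminal t y ∧ S.Mem t y a) t ?_ ?_ x h.defined h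
  · exact fun x hx h => ⟨x, List.prefix_rfl, hx, h⟩
  · intro x hx hc h0 h1 h
    rcases ((children (hc false)).2.2.2.1 a).1 h with h' | h'
    · obtain ⟨y, hy, hy'⟩ := h0 h'
      exact ⟨y, (List.prefix_append x _).trans hy, hy'⟩
    · obtain ⟨y, hy, hy'⟩ := h1 h'
      exact ⟨y, (List.prefix_append x _).trans hy, hy'⟩

theorem exists_terminal (S : PartitionRefinement Ω) (t : ℕ) (a : Ω) :
    ∃ x, S.IsTerminal t x ∧ S.Mem t x a := by
  obtain ⟨y, -, hy⟩ := exists_terminal_of_mem (S := S) (t := t) (x := []) (a := a) mem_nil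
  exact ⟨y, hy⟩

theorem finite_defined (S : PartitionRefinement Ω) (t : ℕ) :
    {x | S.part t x ≠ none}.Finite :=
  (List.finite_length_le Bool t).subset fun _ hx => length_le hx

theorem isTerminal_zero : S.IsTerminal 0 [] := by
  refine isTerminal_iff.2 ⟨nil_defined (S := S) ▸ by simp, ?_⟩
  by_contra hc
  simpa using length_le hc

theorem splitAt_iff : S.SplitAt t x ↔
    ∃ t', t = t' + 1 ∧ S.IsTerminal t' x ∧ ∀ b, S.part t (x ++ [b]) ≠ none := by
  refine ⟨?_, ?_⟩
  · rintro ⟨t', rfl, h, h'⟩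
    exact ⟨t', rfl, h, child_defined_of_not_terminal
      (defined_mono h.1 (Nat.le_succ t') ▸ h.1) h'⟩
  · rintro ⟨t', rfl, h, h'⟩
    exact ⟨t', rfl, h, fun hc => h' false hc.2.1⟩

end PartitionRefinement

end BettingGame

namespace BettingGame

namespace PartitionRefinement

/-! ### Projection of a partition refinement along a map -/

section Projection

variable {Ω Ω' : Type} (S : PartitionRefinement Ω) (g : Ω' → Ω)

/-- The part with coordinate `x` is defined at `t` and meets the range of `g`. -/
def Meets (t : ℕ) (x : List Bool) : Prop := ∃ a, S.Mem t x (g a)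

/-- The part with coordinate `x` is split into two parts that meet the range of `g`. -/
def Splits (x : List Bool) : Prop :=
  ∃ t, S.Meets g t (x ++ [false]) ∧ S.Meets g t (x ++ [true])

open Classical in
/-- Auxiliary to `proj`: works on the reversed coordinate. -/
noncomputable def projRev : List Bool → List Bool
  | [] => []
  | b :: l => if S.Splits g l.reverse then b :: projRev l else projRev l

/-- The coordinate obtained from `x` by dropping the splits that are not splits along `g`. -/
noncomputable def proj (x : List Bool) : List Bool := (S.projRev g x.reverse).reverse

variable {S g} {t t' : ℕ} {x y : List Bool} {a : Ω'} {b : Bool}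

theorem Meets.mono (h : S.Meets g t x) (ht : t ≤ t') : S.Meets g t' x :=
  h.imp fun _ ha => ha.mono ht

theorem Meets.of_prefix (h : S.Meets g t x) (hy : y <+: x) : S.Meets g t y :=
  h.imp fun _ ha => ha.of_prefix hy

theorem Meets.defined (h : S.Meets g t x) : S.part t x ≠ none :=
  h.choose_spec.defined

@[simp] theorem proj_nil : S.proj g [] = [] := rfl

theorem proj_append_of_splits (h : S.Splits g x) : S.proj g (x ++ [b]) = S.proj g x ++ [b] := by
  simp [proj, projRev, h]

theorem proj_append_of_not_splits (h : ¬ S.Splits g x) : S.proj g (x ++ [b]) = S.proj g x := by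
  simp [proj, projRev, h]

theorem proj_prefix (h : x <+: y) : S.proj g x <+: S.proj g y := by
  obtain ⟨l, rfl⟩ := h
  induction l using List.reverseRecOn with
  | nil => simp
  | append_singleton l b ih =>
    rw [← List.append_assoc]
    by_cases hs : S.Splits g (x ++ l)
    · rw [proj_append_of_splits hs]
      exact ih.trans (List.prefix_append _ _)
    · rwa [proj_append_of_not_splits hs]

theorem length_proj : (S.proj g x).length = {k | k < x.length ∧ S.Splits g (x.take k)}.ncard := by
  classical
  have key : ∀ x : List Bool, {k | k < x.length ∧ S.Splits g (x.take k)}.ncard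
      = ((Finset.range x.length).filter fun k => S.Splits g (x.take k)).card := fun x => by
    rw [← Set.ncard_coe_finset]
    congr 1
    ext k
    simp
  induction x using List.reverseRecOn with
  | nil => simp
  | append_singleton x b ih =>
    rw [key] at ih ⊢
    have e : ((Finset.range x.length).filter fun k => S.Splits g ((x ++ [b]).take k))
        = (Finset.range x.length).filter fun k => S.Splits g (x.take k) := by
      refine Finset.filter_congr fun k hk => ?_
      rw [List.take_append_of_le_length (Finset.mem_range.1 hk).le]
    have hx : (x ++ [b]).take x.length = x := by simp
    rw [List.length_append, List.length_singleton, Finset.range_add_one, Finset.filter_insert, e, hx]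
    by_cases hs : S.Splits g x
    · rw [if_pos hs, proj_append_of_splits hs, Finset.card_insert_of_notMem (by simp), ← ih]
      simp
    · rw [if_neg hs, proj_append_of_not_splits hs, ih]

/-- If `x` and `y` branch, both sides of the branching meet the range of `g`; that split is then
kept by `proj`, and the projections branch as well. -/
theorem comparable_of_proj (hx : S.Meets g t x) (hy : S.Meets g t' y)
    (h : S.proj g x <+: S.proj g y ∨ S.proj g y <+: S.proj g x) : x <+: y ∨ y <+: x := by
  by_contra! hc
  obtain ⟨c, b, h1, h2⟩ := exists_branch hc.1 hc.2
  have e1 := (hx.mono (le_max_left t t')).of_prefix h1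
  have e2 := (hy.mono (le_max_right t t')).of_prefix h2
  have hs : S.Splits g c := by
    refine ⟨max t t', ?_⟩
    cases b
    · exact ⟨e1, e2⟩
    · exact ⟨e2, e1⟩
  have p1 := proj_prefix (S := S) (g := g) h1
  have p2 := proj_prefix (S := S) (g := g) h2
  rw [proj_append_of_splits hs] at p1 p2
  have : S.proj g c ++ [b] <+: S.proj g c ++ [!b] ∨
      S.proj g c ++ [!b] <+: S.proj g c ++ [b] := by
    rcases h with h | h
    · exact List.prefix_or_prefix_of_prefix (p1.trans h) p2
    · exact List.prefix_or_prefix_of_prefix p1 (p2.trans h)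
  cases b <;> simp at this

/-- All bits of `y` beyond `x` were dropped, so each of these splits left the range of `g` within
the part on one side, namely the side that leads to `y`. This makes the parts of `comap` independent
of the coordinate that represents them. -/
theorem mem_iff_of_prefix_of_proj_eq (hx : S.part t x ≠ none) (hy : S.Meets g t' y)
    (hp : x <+: y) (h : S.proj g x = S.proj g y) : S.Mem t x (g a) ↔ S.Mem t' y (g a) := by
  obtain ⟨l, rfl⟩ := hp
  induction l using List.reverseRecOn with
  | nil =>
    rw [List.append_nil] at hy ⊢
    exact mem_congr hx hy.defined
  | append_singleton l b ih =>
    rw [← List.append_assoc] at hy h ⊢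
    have hy' : S.Meets g t' (x ++ l) := hy.of_prefix (List.prefix_append _ _)
    have p1 : S.proj g x <+: S.proj g (x ++ l) := proj_prefix (List.prefix_append _ _)
    by_cases hs : S.Splits g (x ++ l)
    · rw [proj_append_of_splits hs] at h
      have := congrArg List.length h
      have := p1.length_le
      simp at *
      omega
    · rw [proj_append_of_not_splits hs] at h
      rw [ih hy' h]
      refine ⟨fun hm => ?_, Mem.parent⟩
      rcases ((children hy.defined).2.2.2.1 (g a)).1 hm with h' | h' <;> cases b
      · exact h'
      · exact absurd ⟨t', ⟨a, h'⟩, hy⟩ hs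
      · exact absurd ⟨t', hy, ⟨a, h'⟩⟩ hs
      · exact h'

theorem mem_iff_of_proj_eq (hx : S.Meets g t x) (hy : S.Meets g t' y)
    (h : S.proj g x = S.proj g y) : S.Mem t x (g a) ↔ S.Mem t' y (g a) := by
  rcases comparable_of_proj hx hy (Or.inl (h ▸ List.prefix_rfl)) with hp | hp
  · exact mem_iff_of_prefix_of_proj_eq hx.defined hy hp h
  · exact (mem_iff_of_prefix_of_proj_eq hy.defined hx hp h.symm).symm

theorem exists_of_proj_eq_append (h : S.proj g x = y ++ [b]) :
    ∃ u, u ++ [b] <+: x ∧ S.proj g u = y ∧ S.Splits g u := by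
  induction x using List.reverseRecOn with
  | nil => simp at h
  | append_singleton x c ih =>
    by_cases hs : S.Splits g x
    · rw [proj_append_of_splits hs] at h
      obtain ⟨h1, h2⟩ := List.append_inj' h rfl
      obtain rfl : c = b := by simpa using h2
      exact ⟨x, List.prefix_rfl, h1, hs⟩
    · rw [proj_append_of_not_splits hs] at h
      obtain ⟨u, hu, hu'⟩ := ih h
      exact ⟨u, hu.trans (List.prefix_append _ _), hu'⟩

theorem Splits.meets_child (hs : S.Splits g x) (b : Bool) (h : S.part t (x ++ [b]) ≠ none)
    (b' : Bool) : S.Meets g t (x ++ [b']) := by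
  obtain ⟨t', h0, h1⟩ := hs
  have h' := child_defined h b'
  cases b'
  · obtain ⟨a, ha⟩ := h0
    exact ⟨a, (mem_congr ha.defined h').1 ha⟩
  · obtain ⟨a, ha⟩ := h1
    exact ⟨a, (mem_congr ha.defined h').1 ha⟩

variable (S g) in
open Classical in
/-- The partition refinement of `Ω'` induced along `g : Ω' → Ω`, without the trivial splits. -/
noncomputable def comap [Nonempty Ω'] : PartitionRefinement Ω' where
  part t y := if ∃ x, S.Meets g t x ∧ S.proj g x = y then
    some {a | ∃ x, S.Mem t x (g a) ∧ S.proj g x = y} else none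
  nonempty := by
    intro t y v h
    split_ifs at h with hx
    obtain ⟨x, ⟨a, ha⟩, hx⟩ := hx
    obtain rfl := Option.some.inj h
    exact ⟨a, x, ha, hx⟩
  root := by
    have a := Classical.arbitrary Ω'
    rw [if_pos ⟨[], ⟨a, mem_nil⟩, rfl⟩]
    congr 1
    ext a
    simpa using ⟨[], mem_nil, rfl⟩
  persist := by
    intro t t' y v h ht
    split_ifs at h with hx
    obtain ⟨x, hm, hx⟩ := hx
    rw [if_pos ⟨x, hm.mono ht, hx⟩, ← h]
    congr 1
    ext a
    constructor
    · rintro ⟨x', ha, hx'⟩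
      exact ⟨x, (mem_iff_of_proj_eq hm ⟨a, ha⟩ (hx.trans hx'.symm)).2 ha, hx⟩
    · rintro ⟨x', ha, hx'⟩
      exact ⟨x', ha.mono ht, hx'⟩
  split := by
    intro t y b w h
    split_ifs at h with hx
    obtain ⟨x, hm, hx⟩ := hx
    -- The last bit of the projected coordinate stems from a nontrivial split of some `u`; the two
    -- halves of that split give the two projected children.
    obtain ⟨u, hu, hy, hs⟩ := exists_of_proj_eq_append hx
    have hd := (hm.of_prefix hu).defined
    obtain ⟨⟨t', rfl, ht'⟩, -, -, hun, hdj⟩ := children hd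
    have hc : ∀ b', S.Meets g (t' + 1) (u ++ [b']) := hs.meets_child b hd
    have hcm : ∀ b' a, (∃ x, S.Mem (t' + 1) x (g a) ∧ S.proj g x = y ++ [b']) ↔
        S.Mem (t' + 1) (u ++ [b']) (g a) := by
      intro b' a
      refine ⟨?_, fun ha => ⟨_, ha, by rw [proj_append_of_splits hs, hy]⟩⟩
      rintro ⟨x', ha, hx'⟩
      exact (mem_iff_of_proj_eq (hc b') ⟨a, ha⟩
        (by rw [proj_append_of_splits hs, hy, hx'])).2 ha
    obtain ⟨a₀, ha₀⟩ := hc false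
    have hu' : S.Meets g t' u := ⟨a₀, (mem_congr ha₀.parent.defined ht').1 ha₀.parent⟩
    refine ⟨t', _, _, _, rfl, if_pos ⟨u, hu', hy⟩,
      if_pos ⟨_, hc false, by rw [proj_append_of_splits hs, hy]⟩,
      if_pos ⟨_, hc true, by rw [proj_append_of_splits hs, hy]⟩, ?_, ?_⟩
    · ext a
      simp only [hcm, Set.mem_union, Set.mem_ofPred_eq]
      rw [← hun]
      constructor
      · intro ha
        exact ⟨u, (mem_congr ha.defined ht').1 ha, hy⟩
      · rintro ⟨x', ha, hx'⟩
        exact ((mem_iff_of_proj_eq hu' ⟨a, ha⟩ (hy.trans hx'.symm)).2 ha).mono (Nat.le_succ _)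
    · simp only [hcm]
      exact Set.disjoint_left.2 fun a h0 h1 => hdj (g a) ⟨h0, h1⟩

variable [Nonempty Ω']

theorem comap_defined {y : List Bool} :
    (S.comap g).part t y ≠ none ↔ ∃ x, S.Meets g t x ∧ S.proj g x = y := by
  simp [comap]

theorem mem_comap {y : List Bool} :
    (S.comap g).Mem t y a ↔ ∃ x, S.Mem t x (g a) ∧ S.proj g x = y := by
  constructor
  · rintro ⟨v, hv, ha⟩
    simp only [comap] at hv
    split_ifs at hv
    obtain rfl := Option.some.inj hv
    exact ha
  · rintro ⟨x, ha, hx⟩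
    exact ⟨_, if_pos ⟨x, ⟨a, ha⟩, hx⟩, x, ha, hx⟩

theorem mem_comap_proj (hx : S.Meets g t x) :
    (S.comap g).Mem t (S.proj g x) a ↔ S.Mem t x (g a) := by
  rw [mem_comap]
  refine ⟨?_, fun h => ⟨x, h, rfl⟩⟩
  rintro ⟨x', ha, hx'⟩
  exact (mem_iff_of_proj_eq hx ⟨a, ha⟩ hx'.symm).2 ha

theorem IsTerminal.comap (h : S.IsTerminal t x) (hm : S.Meets g t x) :
    (S.comap g).IsTerminal t (S.proj g x) := by
  refine isTerminal_iff.2 ⟨comap_defined.2 ⟨x, hm, rfl⟩, ?_⟩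
  by_contra hc
  obtain ⟨x', hm', hx'⟩ := comap_defined.1 hc
  have := (proj_prefix (S := S) (g := g) (h.prefix_of_comparable hm'.defined
    (comparable_of_proj hm hm' (Or.inl (hx' ▸ List.prefix_append _ _))))).length_le
  simp [hx'] at this

theorem exists_terminal_of_comap {y : List Bool} (h : (S.comap g).IsTerminal t y)
    (ha : (S.comap g).Mem t y a) :
    ∃ x, S.IsTerminal t x ∧ S.Mem t x (g a) ∧ S.proj g x = y := by
  obtain ⟨x, hx, hm⟩ := S.exists_terminal t (g a)
  refine ⟨x, hx, hm, ?_⟩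
  exact ((mem_comap_proj ⟨a, hm⟩).2 hm).terminal_unique (hx.comap ⟨a, hm⟩) ha h

theorem comap_splitAt :
    (∃ y, (S.comap g).Mem t y a ∧ (S.comap g).SplitAt t y) ↔
      ∃ x, S.Mem t x (g a) ∧ S.SplitAt t x ∧ S.Splits g x := by
  constructor
  · rintro ⟨y, hm, hy⟩
    obtain ⟨t', rfl, hT, hc⟩ := splitAt_iff.1 hy
    have hm' : (S.comap g).Mem t' y a := (mem_congr hm.defined hT.1).1 hm
    obtain ⟨x, hx, hxm, rfl⟩ := exists_terminal_of_comap hT hm'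
    obtain ⟨x', hx'm, hx'⟩ := comap_defined.1 (hc false)
    have hxm' : S.Meets g (t' + 1) x := ⟨a, hxm.mono (Nat.le_succ _)⟩
    have hlt : ¬ x' <+: x := fun hp => by
      have := (proj_prefix (S := S) (g := g) hp).length_le
      simp [hx'] at this
    obtain ⟨l, rfl⟩ := (comparable_of_proj hxm' hx'm
      (Or.inl (hx' ▸ List.prefix_append _ _))).resolve_right hlt
    cases l with
    | nil => exact absurd (by simp) hlt
    | cons c l =>
      have hc' : S.part (t' + 1) (x ++ [c]) ≠ none :=
        defined_of_prefix hx'm.defined ⟨l, by simp⟩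
      refine ⟨x, hxm.mono (Nat.le_succ _), splitAt_iff.2 ⟨t', rfl, hx, child_defined hc'⟩, ?_⟩
      cases l with
      | nil =>
        by_contra hs
        rw [proj_append_of_not_splits hs] at hx'
        simpa using congrArg List.length hx'
      | cons d l =>
        -- A second new bit would need its parent to be defined already at `t'`, when `x` was
        -- terminal. So the split seen in the projection is the split of `x` itself.
        have : S.part (t' + 1) ((x ++ [c]) ++ [d]) ≠ none :=
          defined_of_prefix hx'm.defined ⟨l, by simp⟩
        obtain ⟨t'', ht'', h⟩ := (children this).1
        obtain rfl : t' = t'' := by omega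
        exact absurd (hx.child_none c) h
  · rintro ⟨x, hm, hx, hs⟩
    obtain ⟨t', rfl, hT, hc⟩ := splitAt_iff.1 hx
    have hm' : S.Mem t' x (g a) := (mem_congr hm.defined hT.1).1 hm
    refine ⟨S.proj g x, (mem_comap_proj ⟨a, hm⟩).2 hm,
      splitAt_iff.2 ⟨t', rfl, hT.comap ⟨a, hm'⟩, fun b => ?_⟩⟩
    exact comap_defined.2 ⟨x ++ [b], hs.meets_child b (hc b) b, proj_append_of_splits hs⟩

variable (S g) in
open Classical in
/-- The projected partition refinement, evaluated by `2` on the continuations of the projections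
of coordinates with a property that is inherited by later times and continuations. -/
noncomputable def projectEval (heavy : ℕ → List Bool → Prop)
    (hmono : ∀ t t' x, S.part t x ≠ none → t ≤ t' → heavy t x → heavy t' x) :
    PartitionEvaluation Ω' where
  toPartitionRefinement := S.comap g
  -- The game only asks whether the evaluation is below 2, so the values 0 and 2 suffice.
  eval t y := if ∃ x, S.Meets g t x ∧ S.proj g x <+: y ∧ heavy t x then 2 else 0
  eval_nonneg t y := by split_ifs <;> norm_num
  eval_mono t t' y y' ht hy := by
    split_ifs with h h' h'
    · exact le_rfl
    · obtain ⟨x, hx, hp, hh⟩ := h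
      exact absurd ⟨x, hx.mono ht, hp.trans hy, hmono t t' x hx.defined ht hh⟩ h'
    · norm_num
    · exact le_rfl

variable {heavy : ℕ → List Bool → Prop}
  {hmono : ∀ t t' x, S.part t x ≠ none → t ≤ t' → heavy t x → heavy t' x}

theorem two_le_projectEval {y : List Bool} : 2 ≤ (S.projectEval g heavy hmono).eval t y ↔
    ∃ x, S.Meets g t x ∧ S.proj g x <+: y ∧ heavy t x := by
  simp only [projectEval]
  split_ifs with h <;> simp [h]

theorem two_le_projectEval_proj
    (hpre : ∀ t x y, S.part t y ≠ none → x <+: y → heavy t x → heavy t y)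
    (hT : S.IsTerminal t x) (hm : S.Meets g t x) :
    2 ≤ (S.projectEval g heavy hmono).eval t (S.proj g x) ↔ heavy t x := by
  rw [two_le_projectEval]
  refine ⟨?_, fun h => ⟨x, hm, List.prefix_rfl, h⟩⟩
  rintro ⟨x', hm', hp, hh⟩
  exact hpre t x' x hm.defined (hT.prefix_of_comparable hm'.defined
    (comparable_of_proj hm hm' (Or.inr hp))) hh

theorem projectEval_good
    (hpre : ∀ t x y, S.part t y ≠ none → x <+: y → heavy t x → heavy t y) {N φ : ℕ} :
    (S.projectEval g heavy hmono).Good N φ a t ↔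
      ∃ x, S.IsTerminal t x ∧ S.Mem t x (g a) ∧ (S.proj g x).length < N ∧
        φ < {a' | S.Mem t x (g a')}.ncard ∧ ¬ heavy t x := by
  constructor
  · rintro ⟨y, v, hT, hv, ha, hN, hφ, he⟩
    obtain ⟨x, hx, hm, rfl⟩ := exists_terminal_of_comap hT ⟨v, hv, ha⟩
    refine ⟨x, hx, hm, hN, ?_, ?_⟩
    · convert hφ using 2
      ext a'
      exact (mem_comap_proj ⟨a, hm⟩).symm.trans (mem_iff hv)
    · rwa [← two_le_projectEval_proj (hmono := hmono) hpre hx ⟨a, hm⟩, not_le]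
  · rintro ⟨x, hx, hm, hN, hφ, hh⟩
    obtain ⟨v, hv, ha⟩ := (mem_comap_proj ⟨a, hm⟩).2 hm
    refine ⟨_, v, hx.comap ⟨a, hm⟩, hv, ha, hN, ?_, ?_⟩
    · convert hφ using 2
      ext a'
      exact (mem_iff hv).symm.trans (mem_comap_proj ⟨a, hm⟩)
    · rwa [← not_le, two_le_projectEval_proj hpre hx ⟨a, hm⟩]

theorem projectEval_event
    (hpre : ∀ t x y, S.part t y ≠ none → x <+: y → heavy t x → heavy t y) :
    (S.projectEval g heavy hmono).Event a t ↔
      (∃ x, S.Mem t x (g a) ∧ S.SplitAt t x ∧ S.Splits g x) ∨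
        ∃ x, S.IsTerminal t x ∧ S.Mem t x (g a) ∧ heavy t x := by
  constructor
  · rintro ⟨y, v, hv, ha, h | h⟩
    · exact Or.inl (comap_splitAt.1 ⟨y, ⟨v, hv, ha⟩, h⟩)
    · right
      obtain ⟨x, hx, hm⟩ := S.exists_terminal t (g a)
      refine ⟨x, hx, hm, (two_le_projectEval_proj (hmono := hmono) hpre hx ⟨a, hm⟩).1 ?_⟩
      refine h.trans ((S.projectEval g heavy hmono).eval_mono t t _ _ le_rfl ?_)
      exact Mem.prefix_terminal (S := S.comap g) ⟨v, hv, ha⟩ (hx.comap ⟨a, hm⟩)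
        ((mem_comap_proj ⟨a, hm⟩).2 hm)
  · rintro (h | ⟨x, hx, hm, hh⟩)
    · obtain ⟨y, ⟨v, hv, ha⟩, hy⟩ := comap_splitAt.2 h
      exact ⟨y, v, hv, ha, Or.inl hy⟩
    · obtain ⟨v, hv, ha⟩ := (mem_comap_proj ⟨a, hm⟩).2 hm
      exact ⟨_, v, hv, ha, Or.inr ((two_le_projectEval_proj hpre hx ⟨a, hm⟩).2 hh)⟩

end Projection

end PartitionRefinement

end BettingGame

namespace BettingGame

/-! ### A bound on the length of good sequences -/

theorem card_strings_lt (N : ℕ) :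
    {x : List Bool | x.length < N}.Finite ∧ {x : List Bool | x.length < N}.ncard < 2 ^ N := by
  classical
  have hlen : ∀ n, (bitStrings n).length = 2 ^ n := by
    intro n
    induction n with
    | zero => rfl
    | succ n ih => simp [bitStrings, ih, pow_succ]
  have e : {x : List Bool | x.length < N}
      = ↑((Finset.range N).biUnion fun n => (bitStrings n).toFinset) := by
    ext x
    simp [mem_bitStrings]
  refine ⟨e ▸ Finset.finite_toSet _, ?_⟩
  rw [e, Set.ncard_coe_finset]
  refine Finset.card_biUnion_le.trans_lt ?_
  have : ∀ n ∈ Finset.range N, (bitStrings n).toFinset.card ≤ 2 ^ n := fun n _ =>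
    (List.toFinset_card_le _).trans (hlen n).le
  refine (Finset.sum_le_sum this).trans_lt ?_
  rw [Nat.geomSum_eq le_rfl]
  have := Nat.one_le_two_pow (n := N)
  simp

namespace PartitionEvaluation

open PartitionRefinement

variable {Ω : Type} {P : PartitionEvaluation Ω} {N φ t t' : ℕ} {s : Ω}

/-- If `x` is still terminal at `t'`, no part containing `s` can have been split at `t'`, and a
value of at least 2 at a prefix of `x` passes to `x` by monotonicity. -/
theorem Good.exists_terminal_of_event (h : P.Good N φ s t) (ht : t < t') (h' : P.Event s t') :
    ∃ x, x.length < N ∧ P.IsTerminal t x ∧ P.Mem t x s ∧ P.eval t x < 2 ∧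
      (¬ P.IsTerminal t' x ∨ 2 ≤ P.eval t' x) := by
  obtain ⟨x, v, hT, hv, hs, hN, -, he⟩ := h
  have hx : P.Mem t x s := ⟨v, hv, hs⟩
  refine ⟨x, hN, hT, hx, he, ?_⟩
  by_cases hT' : P.IsTerminal t' x
  · right
    obtain ⟨y, w, hw, hsw, h | h⟩ := h'
    · obtain ⟨t'', rfl, hy, hny⟩ := h
      have hyt : P.Mem t'' y s :=
        (mem_congr (by simp [hw]) hy.1).1 (⟨w, hw, hsw⟩ : P.Mem (t'' + 1) y s)
      have hxt : P.Mem t'' x s := hx.mono (by omega)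
      have hxT : P.IsTerminal t'' x := hT'.anti hxt.defined (Nat.le_succ _)
      rw [hyt.terminal_unique hy hxt hxT] at hny
      exact absurd hT' hny
    · exact h.trans (P.eval_mono t' t' y x le_rfl
        (Mem.prefix_terminal ⟨w, hw, hsw⟩ hT' (hx.mono ht.le)))
  · exact Or.inl hT'

end PartitionEvaluation

open PartitionRefinement in
-- Every staleness spoils, in one of the two evaluations, a coordinate shorter than `N` that was
-- terminal with value below 2; it can never be so again. There are fewer than `2 ^ N` such
-- coordinates in each evaluation.
theorem IsGoodSequence.length_le {Ω : Type} {P P' : PartitionEvaluation Ω} {N φ k : ℕ}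
    {C : Fin k → Ω} (h : IsGoodSequence P P' N φ k C) : k ≤ 2 * 2 ^ N := by
  obtain ⟨τ, h0, h⟩ := h
  have hpos := Nat.one_le_two_pow (n := N)
  rcases Nat.eq_zero_or_pos k with rfl | hk
  · omega
  let Q : Bool → PartitionEvaluation Ω := fun b => bif b then P else P'
  have hgood : ∀ b (i : Fin k), (Q b).Good N φ (C i) (τ i) := by
    intro b i
    cases b
    · exact (h i).2.1
    · exact (h i).1
  -- The last element need not become stale, so only `k - 1` coordinates are spoiled.
  have hx : ∀ i : Fin (k - 1), ∃ b x, x.length < N ∧ (Q b).IsTerminal (τ i) x ∧ (Q b).eval (τ i) x < 2 ∧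
      (¬ (Q b).IsTerminal (τ (i + 1)) x ∨ 2 ≤ (Q b).eval (τ (i + 1)) x) := by
    intro i
    have hik : (i : ℕ) < k := by omega
    obtain ⟨h1, h2, h3⟩ := (h ⟨i, hik⟩).2.2 (by simp; omega)
    rcases h2 with h2 | h2
    · obtain ⟨x, hx, hT, -, he, hx'⟩ := (hgood true ⟨i, hik⟩).exists_terminal_of_event h1 h2
      exact ⟨true, x, hx, hT, he, hx'⟩
    · obtain ⟨x, hx, hT, -, he, hx'⟩ := (hgood false ⟨i, hik⟩).exists_terminal_of_event h1 h2
      exact ⟨false, x, hx, hT, he, hx'⟩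
  have hmono : ∀ i j, i ≤ j → j < k → τ i ≤ τ j := by
    intro i j hij
    induction j, hij using Nat.le_induction with
    | base => exact fun _ => le_rfl
    | succ j hij ih =>
      intro hj
      exact (ih (by omega)).trans ((h ⟨j, by omega⟩).2.2 hj).1.le
  choose β x hlen hT heval hev using hx
  have hne : ∀ i j : Fin (k - 1), i < j → β i = β j → x i = x j → False := by
    intro i j hij hb hxx
    have hjk : (j : ℕ) < k := by omega
    have hτ : τ (i + 1) ≤ τ j := hmono _ _ (by simpa using hij) hjk
    have hτ' : τ i ≤ τ (i + 1) := hmono _ _ (by omega) (by omega)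
    have hTj := hT j
    rw [← hb, ← hxx] at hTj
    -- A coordinate in use again at `j` was terminal throughout, so its evaluation must have been
    -- what spoiled it, and it is still at least 2 at time `τ j`.
    have hTi : (Q (β i)).IsTerminal (τ (i + 1)) (x i) :=
      hTj.anti (by rw [defined_mono (hT i).1 hτ']; exact (hT i).1) hτ
    have he := ((hev i).resolve_left (not_not.2 hTi)).trans
      ((Q (β i)).eval_mono _ _ _ _ hτ List.prefix_rfl)
    have := heval j
    rw [← hb, ← hxx] at this
    linarith
  have hinj : Function.Injective fun i => (β i, x i) := by
    intro i j hij
    have h1 : β i = β j := congrArg Prod.fst hij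
    have h2 : x i = x j := congrArg Prod.snd hij
    rcases lt_trichotomy i j with hl | hl | hl
    · exact (hne i j hl h1 h2).elim
    · exact hl
    · exact (hne j i hl h1.symm h2.symm).elim
  obtain ⟨hfin, hcard⟩ := card_strings_lt N
  have hle : (Set.range fun i => (β i, x i)).ncard ≤
      ((Set.univ : Set Bool) ×ˢ {x : List Bool | x.length < N}).ncard := by
    refine Set.ncard_le_ncard ?_ (Set.finite_univ.prod hfin)
    rintro _ ⟨i, rfl⟩
    exact ⟨trivial, hlen i⟩
  rw [Set.ncard_prod, ← Set.image_univ, Set.ncard_image_of_injective _ hinj, Set.ncard_univ,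
    Set.ncard_univ] at hle
  simp at hle
  omega

theorem isLengthBound_two_pow (l N φ : ℕ) : IsLengthBound l N φ (2 * 2 ^ N) :=
  fun _ _ _ _ _ _ _ h => by exact_mod_cast h.length_le

end BettingGame

namespace BettingGame

/-! ### Fibres: the sequences that differ from a given one only on `I` -/

/-- The sequences that agree with `τ` outside `I`. -/
def fib (I : Finset ℕ) (τ : Seq) : Set Seq := {σ | Set.EqOn σ τ (↑I)ᶜ}

/-- Flip the bits of `σ` at the positions in `F`. -/
def flip (F : Finset ℕ) (σ : Seq) : Seq := fun p => xor (decide (p ∈ F)) (σ p)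

theorem self_mem_fib (I : Finset ℕ) (τ : Seq) : τ ∈ fib I τ := fun _ _ => rfl

theorem fib_eq {I : Finset ℕ} {σ τ : Seq} (h : σ ∈ fib I τ) : fib I σ = fib I τ := by
  ext ρ
  exact ⟨fun hρ => Set.EqOn.trans hρ h, fun hρ => Set.EqOn.trans hρ (Set.EqOn.symm h)⟩

theorem fib_comm {I : Finset ℕ} {σ τ : Seq} (h : σ ∈ fib I τ) : τ ∈ fib I σ :=
  Set.EqOn.symm h

theorem flip_mem_fib {I F : Finset ℕ} (h : F ⊆ I) (τ : Seq) : flip F τ ∈ fib I τ := by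
  intro p hp
  have : p ∉ F := fun hF => hp (h hF)
  simp [flip, this]

theorem exists_flip_of_mem_fib {I : Finset ℕ} {σ τ : Seq} (h : σ ∈ fib I τ) :
    ∃ F ⊆ I, flip F τ = σ := by
  refine ⟨I.filter fun p => σ p ≠ τ p, Finset.filter_subset _ _, ?_⟩
  funext p
  by_cases hp : p ∈ I
  · cases hs : σ p <;> cases ht : τ p <;> simp [flip, hp, hs, ht]
  · have := h (show p ∈ (↑I : Set ℕ)ᶜ by simpa using hp)
    simp [flip, hp, this]

theorem flip_injective (τ : Seq) : Function.Injective fun F => flip F τ := by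
  intro F G h
  ext p
  have := congrFun h p
  by_cases h1 : p ∈ F <;> by_cases h2 : p ∈ G <;> simp_all [flip]

/-- Flips by subsets of `I` parametrize the fibre. This turns counts in fibres into sums over
measure-preserving maps. -/
theorem ncard_fib_inter (I : Finset ℕ) (τ : Seq) (E : Set Seq) [DecidablePred (· ∈ E)] :
    {σ ∈ fib I τ | σ ∈ E}.ncard = (I.powerset.filter fun F => flip F τ ∈ E).card := by
  rw [← Set.ncard_coe_finset, ← Set.ncard_image_of_injective _ (flip_injective τ)]
  congr 1
  ext σ
  simp only [Set.mem_ofPred_eq, Finset.coe_filter, Finset.mem_powerset, Set.mem_image]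
  constructor
  · rintro ⟨h, hE⟩
    obtain ⟨F, hF, rfl⟩ := exists_flip_of_mem_fib h
    exact ⟨F, ⟨hF, hE⟩, rfl⟩
  · rintro ⟨F, ⟨hF, hE⟩, rfl⟩
    exact ⟨flip_mem_fib hF τ, hE⟩

theorem finite_fib (I : Finset ℕ) (τ : Seq) : (fib I τ).Finite := by
  refine ((I.powerset.finite_toSet).image fun F => flip F τ).subset fun σ h => ?_
  obtain ⟨F, hF, rfl⟩ := exists_flip_of_mem_fib h
  exact ⟨F, by simpa using hF, rfl⟩

theorem ncard_fib (I : Finset ℕ) (τ : Seq) : (fib I τ).ncard = 2 ^ I.card := by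
  classical
  have := ncard_fib_inter I τ Set.univ
  simpa using this

instance (I : Finset ℕ) (τ : Seq) : Nonempty (fib I τ) := ⟨⟨τ, self_mem_fib I τ⟩⟩

instance (I : Finset ℕ) (τ : Seq) : Finite (fib I τ) := finite_fib I τ

/-! ### Capital -/

namespace BettingStrategy

open PartitionRefinement

variable {A B : BettingStrategy} {t t' : ℕ} {x y : List Bool} {σ τ : Seq}

theorem capital_congr (h : A.part t x ≠ none) (h' : A.part t' x ≠ none) :
    A.capital t x = A.capital t' x := by
  rw [capital, capital, defined_eq h h']

theorem le_maxCapital_iff {c : ℝ} :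
    c ≤ A.maxCapital t x ↔ ∃ y, y <+: x ∧ c ≤ A.capital t y := by
  have hne : (Finset.range (x.length + 1)).Nonempty := ⟨0, by simp⟩
  refine (Finset.le_sup'_iff (H := hne)).trans ?_
  constructor
  · rintro ⟨k, -, h⟩
    exact ⟨_, List.take_prefix k x, h⟩
  · rintro ⟨y, hy, h⟩
    refine ⟨y.length, Finset.mem_range.2 (Nat.lt_succ_of_le hy.length_le), ?_⟩
    rwa [← List.prefix_iff_eq_take.1 hy]

theorem maxCapital_mono_time (c : ℝ) (t t' : ℕ) (x : List Bool) (h : A.part t x ≠ none)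
    (ht : t ≤ t') (hc : c ≤ A.maxCapital t x) : c ≤ A.maxCapital t' x := by
  rw [le_maxCapital_iff] at hc ⊢
  obtain ⟨y, hy, hc⟩ := hc
  have hd := defined_of_prefix h hy
  exact ⟨y, hy, by rwa [← capital_congr hd (defined_mono hd ht ▸ hd)]⟩

theorem maxCapital_mono_prefix (c : ℝ) (t : ℕ) (x y : List Bool) (hxy : x <+: y)
    (hc : c ≤ A.maxCapital t x) : c ≤ A.maxCapital t y := by
  rw [le_maxCapital_iff] at hc ⊢
  exact hc.imp fun z hz => ⟨hz.1.trans hxy, hz.2⟩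

theorem terminalOver_iff {E : Set Seq} (hE : E.Nonempty) :
    A.TerminalOver t x E ↔ A.IsTerminal t x ∧ ∀ σ ∈ E, A.Mem t x σ := by
  refine and_congr_right fun _ => ⟨?_, fun h => ?_⟩
  · rintro ⟨v, hv, hE⟩ σ hσ
    exact ⟨v, hv, hE hσ⟩
  · obtain ⟨σ₀, h₀⟩ := hE
    obtain ⟨v, hv, -⟩ := h σ₀ h₀
    exact ⟨v, hv, fun σ hσ => (mem_iff hv).1 (h σ hσ)⟩

theorem achievesBelow_iff {c : ℝ} : A.AchievesBelow c σ ↔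
    ∀ t x, A.IsTerminal t x → A.Mem t x σ → A.maxCapital t x < c := by
  simp [AchievesBelow, terminalOver_iff]

theorem AchievesBelow.not_wins {c : ℝ} (h : A.AchievesBelow c σ) : ¬ A.Wins σ := by
  intro hw
  obtain ⟨t, x, hx, hc⟩ := hw c
  exact absurd (h t x hx) (not_lt.2 hc.le)

/-! ### Inspected positions -/

/-- The positions in `L` determine the terminal part at `t`. -/
def Determines (A : BettingStrategy) (t : ℕ) (L : Set ℕ) : Prop :=
  ∀ σ τ, Set.EqOn σ τ L → ∀ x, A.Mem t x σ → A.Mem t x τ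

theorem elementary_iff_determines (L : Finset ℕ) :
    (∀ r : Restriction, r.dom = ↑L → A.Elementary t r) ↔ A.Determines t ↑L := by
  constructor
  · intro h σ τ hστ x hx
    let r : Restriction := fun p => if p ∈ L then some (σ p) else none
    have hr : r.dom = ↑L := by
      ext p
      by_cases hp : p ∈ L <;> simp [r, Restriction.dom, hp]
    have hcyl : ∀ ρ : Seq, Set.EqOn σ ρ ↑L → ρ ∈ r.cyl := by
      intro ρ hρ p b hb
      by_cases hp : p ∈ L
      · simp only [r, hp, if_true, Option.some.injEq] at hb
        rw [← hb, hρ (by simpa using hp)]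
      · simp [r, hp] at hb
    obtain ⟨y, hy⟩ := h r hr
    obtain ⟨hT, hm⟩ := (terminalOver_iff ⟨σ, hcyl σ fun _ _ => rfl⟩).1 hy
    exact (hm τ (hcyl τ hστ)).of_prefix (hx.prefix_terminal hT (hm σ (hcyl σ fun _ _ => rfl)))
  · intro h r hr
    let σ : Seq := fun p => (r p).getD false
    have hσ : σ ∈ r.cyl := fun p b hb => by simp [σ, hb]
    obtain ⟨x, hT, hx⟩ := A.exists_terminal t σ
    refine ⟨x, (terminalOver_iff ⟨σ, hσ⟩).2 ⟨hT, fun τ hτ => h σ τ (fun p hp => ?_) x hx⟩⟩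
    rw [← hr] at hp
    obtain ⟨b, hb⟩ := Option.ne_none_iff_exists'.1 hp
    rw [hσ p b hb, hτ p b hb]

/-- Every sequence has a cylinder on which membership in `v` is constant; finitely many of these
cover the space by compactness. -/
theorem exists_nat_of_isClopen {v : Set Seq} (hv : IsClopen v) :
    ∃ n : ℕ, ∀ σ τ : Seq, Set.EqOn σ τ (Set.Iio n) → σ ∈ v → τ ∈ v := by
  have key : ∀ σ : Seq, ∃ n : ℕ, (∀ τ τ' : Seq, Set.EqOn τ σ (Set.Iio n) →
      Set.EqOn τ' σ (Set.Iio n) → τ ∈ v → τ' ∈ v) := by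
    intro σ
    have hb := PiNat.isTopologicalBasis_cylinders (fun _ : ℕ => Bool)
    by_cases hσ : σ ∈ v
    · obtain ⟨_, ⟨ρ, n, rfl⟩, hm, hsub⟩ := hb.exists_subset_of_mem_open hσ hv.2
      refine ⟨n, fun τ τ' _ h _ => hsub fun i hi => ?_⟩
      rw [h hi, hm i hi]
    · obtain ⟨_, ⟨ρ, n, rfl⟩, hm, hsub⟩ := hb.exists_subset_of_mem_open
        (show σ ∈ vᶜ from hσ) hv.compl.2
      refine ⟨n, fun τ τ' h _ hτ => absurd hτ (hsub fun i hi => ?_)⟩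
      rw [h hi, hm i hi]
  choose n hn using key
  obtain ⟨s, -, hs⟩ := (isCompact_univ (X := Seq)).elim_nhds_subcover
    (fun σ => PiNat.cylinder σ (n σ))
    fun σ _ => (PiNat.isOpen_cylinder _ σ (n σ)).mem_nhds (PiNat.self_mem_cylinder σ _)
  refine ⟨s.sup n, fun σ τ h hσ => ?_⟩
  obtain ⟨ρ, hρ, hσρ⟩ := Set.mem_iUnion₂.1 (hs (Set.mem_univ σ))
  have hle : n ρ ≤ s.sup n := Finset.le_sup hρ
  refine hn ρ σ τ (fun i hi => hσρ i hi) (fun i hi => ?_) hσ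
  rw [← h (lt_of_lt_of_le hi hle), hσρ i hi]

theorem exists_determines (A : BettingStrategy) (t : ℕ) : ∃ n, A.Determines t (Set.Iio n) := by
  have hn : ∀ x, ∃ n : ℕ, ∀ σ τ : Seq, Set.EqOn σ τ (Set.Iio n) → A.Mem t x σ → A.Mem t x τ := by
    intro x
    by_cases hx : A.part t x = none
    · exact ⟨0, fun σ τ _ h => absurd hx h.defined⟩
    · obtain ⟨v, hv⟩ := Option.ne_none_iff_exists'.1 hx
      simpa only [mem_iff hv] using exists_nat_of_isClopen (A.clopen t x v hv)
  choose n hn using hn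
  refine ⟨(A.finite_defined t).toFinset.sup n, fun σ τ h x hx => hn x σ τ (fun i hi => h ?_) hx⟩
  exact lt_of_lt_of_le hi (Finset.le_sup (f := n) (by simpa using hx.defined))

/-- If a change at `p` alone never affects a part, then a long initial segment without `p` still
determines the parts. If it does affect one, every determining set has to contain `p`. -/
theorem mem_inspected_iff {p : ℕ} : p ∈ A.inspected t ↔
    ∃ σ τ, Set.EqOn σ τ {p}ᶜ ∧ ∃ x, A.Mem t x σ ∧ ¬ A.Mem t x τ := by
  constructor
  · intro h
    by_contra! hc
    obtain ⟨n, hn⟩ := A.exists_determines t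
    have := h ((Finset.range n).erase p) ?_
    · simp at this
    · refine (elementary_iff_determines _).2 fun σ τ hστ x hx => ?_
      have h1 : A.Mem t x (Function.update σ p (τ p)) := by
        refine hc σ _ (fun q hq => ?_) x hx
        rw [Function.update_of_ne hq]
      refine hn _ τ (fun q hq => ?_) x h1
      by_cases hqp : q = p
      · subst hqp
        simp
      · rw [Function.update_of_ne hqp]
        exact hστ (by simpa [hqp] using hq)
  · rintro ⟨σ, τ, h, x, hσ, hτ⟩ L hL
    by_contra hp
    refine hτ ((elementary_iff_determines L).1 hL σ τ (fun q hq => h ?_) x hσ)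
    rintro rfl
    exact hp (by simpa using hq)

theorem inspected_subset_of_determines {L : Set ℕ} (h : A.Determines t L) :
    A.inspected t ⊆ L := by
  intro p hp
  obtain ⟨σ, τ, hst, x, hσ, hτ⟩ := mem_inspected_iff.1 hp
  by_contra hpL
  exact hτ (h σ τ (fun q hq => hst fun hqp => hpL (hqp ▸ hq)) x hσ)

theorem finite_inspected (A : BettingStrategy) (t : ℕ) : (A.inspected t).Finite := by
  obtain ⟨n, hn⟩ := A.exists_determines t
  exact (Set.finite_Iio n).subset (inspected_subset_of_determines hn)

/-- The intersection of all determining sets is itself determining: positions from `n` on do not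
matter, and the finitely many uninspected positions below `n` can be changed one at a time without
effect. -/
theorem determines_inspected (A : BettingStrategy) (t : ℕ) :
    A.Determines t (A.inspected t) := by
  obtain ⟨n, hn⟩ := A.exists_determines t
  have key : ∀ F : Finset ℕ, Disjoint (↑F : Set ℕ) (A.inspected t) →
      ∀ σ τ, Set.EqOn σ τ (↑F)ᶜ → ∀ x, A.Mem t x σ → A.Mem t x τ := by
    intro F
    induction F using Finset.induction_on with
    | empty =>
      intro _ σ τ h x hx
      have : σ = τ := funext fun p => h (by simp)
      exact this ▸ hx
    | insert p F hp ih =>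
      intro hd σ τ h x hx
      rw [Finset.coe_insert, Set.disjoint_insert_left] at hd
      have h1 : A.Mem t x (Function.update σ p (τ p)) := by
        by_contra hc
        refine hd.1 (mem_inspected_iff.2 ⟨σ, _, fun q hq => ?_, x, hx, hc⟩)
        rw [Function.update_of_ne hq]
      refine ih hd.2 _ τ (fun q hq => ?_) x h1
      by_cases hqp : q = p
      · subst hqp
        simp
      · rw [Function.update_of_ne hqp]
        exact h (by simpa [hqp] using hq)
  intro σ τ h x hx
  classical
  let F := (Finset.range n).filter fun p => p ∉ A.inspected t
  have h1 : A.Mem t x fun p => if p ∈ F then τ p else σ p := by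
    refine key F ?_ σ _ (fun p hp => ?_) x hx
    · exact Set.disjoint_left.2 fun p hp => (Finset.mem_filter.1 hp).2
    · have : p ∉ F := hp
      simp [this]
  refine hn _ τ (fun p hp => ?_) x h1
  by_cases hpi : p ∈ A.inspected t
  · simp [F, hpi, h hpi]
  · have : p ∈ F := Finset.mem_filter.2 ⟨by simpa using hp, hpi⟩
    simp [this]

theorem inspected_mono (A : BettingStrategy) (ht : t ≤ t') :
    A.inspected t ⊆ A.inspected t' := by
  intro p hp
  obtain ⟨σ, τ, hst, x, hσ, hτ⟩ := mem_inspected_iff.1 hp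
  refine mem_inspected_iff.2 ⟨σ, τ, hst, x, hσ.mono ht, fun h => hτ ?_⟩
  exact (mem_congr hσ.defined h.defined).2 h

theorem inspected_zero (A : BettingStrategy) : A.inspected 0 = ∅ := by
  refine Set.eq_empty_of_forall_notMem fun p hp => ?_
  obtain ⟨σ, τ, hst, x, hσ, hτ⟩ := mem_inspected_iff.1 hp
  obtain rfl : x = [] := by simpa using PartitionRefinement.length_le hσ.defined
  exact hτ mem_nil

theorem mem_congr_of_eqOn {L : Set ℕ} (hL : A.inspected t ⊆ L) (h : Set.EqOn σ τ L) :
    A.Mem t x σ ↔ A.Mem t x τ :=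
  ⟨A.determines_inspected t σ τ (h.mono hL) x,
    A.determines_inspected t τ σ (h.mono hL).symm x⟩

end BettingStrategy

end BettingGame

namespace BettingGame

open PartitionRefinement BettingStrategy

/-! ### The basic game on the sequences of a fibre -/

namespace BettingStrategy

variable (A : BettingStrategy)

/-- `τ` is good at `t` for the strategy projected on the set `F` of sequences. -/
def FullGood (F : Set Seq) (M φ : ℕ) (τ : Seq) (t : ℕ) : Prop :=
  ∃ x, A.IsTerminal t x ∧ A.Mem t x τ ∧ (A.proj (Subtype.val : F → Seq) x).length < M ∧
    φ < {σ ∈ F | A.Mem t x σ}.ncard ∧ A.maxCapital t x < 2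

/-- At `t` a part that contains `τ` is split on `F`, or has maximum capital at least `2`. -/
def FullEvent (F : Set Seq) (τ : Seq) (t : ℕ) : Prop :=
  (∃ x, A.Mem t x τ ∧ A.SplitAt t x ∧ A.Splits (Subtype.val : F → Seq) x) ∨
    ∃ x, A.IsTerminal t x ∧ A.Mem t x τ ∧ 2 ≤ A.maxCapital t x

/-- The strategy projected on `F`. -/
noncomputable def projected (F : Set Seq) [Nonempty F] : PartitionEvaluation F :=
  A.projectEval (Subtype.val : F → Seq) (fun t x => 2 ≤ A.maxCapital t x)
    (maxCapital_mono_time 2)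

variable {A} {F : Set Seq} [Nonempty F] {M φ t : ℕ} {a : F}

theorem projected_good : (A.projected F).Good M φ a t ↔ A.FullGood F M φ a t := by
  rw [projected, projectEval_good fun t x y _ => maxCapital_mono_prefix 2 t x y]
  have e : ∀ x, {a' : F | A.Mem t x a'}.ncard = {σ ∈ F | A.Mem t x σ}.ncard := fun x => by
    rw [← Set.ncard_image_of_injective _ Subtype.val_injective]
    congr 1
    ext σ
    simp [and_comm]
  simp only [e, not_le, FullGood]

theorem projected_event : (A.projected F).Event a t ↔ A.FullEvent F a t :=
  projectEval_event fun t x y _ => maxCapital_mono_prefix 2 t x y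

end BettingStrategy

/-- `τ` becomes stale after `t` at `t'`. -/
def FullStale (A B : BettingStrategy) (F : Set Seq) (τ : Seq) (t t' : ℕ) : Prop :=
  t < t' ∧ (A.FullEvent F τ t' ∨ B.FullEvent F τ t') ∧
    ∀ t'', t < t'' → t'' < t' → ¬ (A.FullEvent F τ t'' ∨ B.FullEvent F τ t'')

/-- Lexicographic order on the bits in `I`. -/
def FullLexLT (I : Finset ℕ) (σ τ : Seq) : Prop :=
  ∃ p ∈ I, σ p = false ∧ τ p = true ∧ ∀ q ∈ I, q < p → σ q = τ q

/-- `τ` is the lexicographically least good element of `F` at `t`. -/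
def FullLeastGood (A B : BettingStrategy) (I : Finset ℕ) (F : Set Seq) (M φ : ℕ) (τ : Seq)
    (t : ℕ) : Prop :=
  τ ∈ F ∧ A.FullGood F M φ τ t ∧ B.FullGood F M φ τ t ∧
    ∀ σ ∈ F, A.FullGood F M φ σ t → B.FullGood F M φ σ t → ¬ FullLexLT I σ τ

/-- `τ` is the choice number `j`, made at time `t`, in the game on `F`. -/
inductive Reach (A B : BettingStrategy) (I : Finset ℕ) (F : Set Seq) (M φ : ℕ) :
    ℕ → Seq → ℕ → Prop
  | start (τ : Seq) (hτ : τ ∈ F) (h0 : ∀ p ∈ I, τ p = false) : Reach A B I F M φ 0 τ 0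
  | next (j : ℕ) (τ τ' : Seq) (t t' : ℕ) (h : Reach A B I F M φ j τ t)
      (hs : FullStale A B F τ t t') (hg : FullLeastGood A B I F M φ τ' t') :
      Reach A B I F M φ (j + 1) τ' t'

variable {A B : BettingStrategy} {I : Finset ℕ} {F : Set Seq} {M φ j t t' : ℕ} {ρ τ τ' : Seq}

theorem Reach.mem (h : Reach A B I F M φ j τ t) : τ ∈ F := by
  cases h with
  | start _ hτ _ => exact hτ
  | next _ _ _ _ _ _ _ hg => exact hg.1

theorem FullStale.unique {t₁ t₂ : ℕ} (h₁ : FullStale A B F τ t t₁)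
    (h₂ : FullStale A B F τ t t₂) : t₁ = t₂ := by
  rcases lt_trichotomy t₁ t₂ with h | h | h
  · exact absurd h₁.2.1 (h₂.2.2 t₁ h₁.1 h)
  · exact h
  · exact absurd h₂.2.1 (h₁.2.2 t₂ h₂.1 h)

theorem fullLexLT_total (hτ : τ ∈ fib I ρ) (hτ' : τ' ∈ fib I ρ) (hne : τ ≠ τ') :
    FullLexLT I τ τ' ∨ FullLexLT I τ' τ := by
  have hout : ∀ p, τ p ≠ τ' p → p ∈ I := fun p hp => by
    by_contra hc
    exact hp ((hτ (show p ∈ (↑I : Set ℕ)ᶜ from hc)).trans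
      (hτ' (show p ∈ (↑I : Set ℕ)ᶜ from hc)).symm)
  have hex : ∃ p, τ p ≠ τ' p := Function.ne_iff.1 hne
  classical
  have h1 := Nat.find_spec hex
  have h2 : ∀ q < Nat.find hex, τ q = τ' q := fun q hq => not_not.1 (Nat.find_min hex hq)
  generalize Nat.find hex = p at h1 h2
  cases h : τ p <;> cases h' : τ' p
  · simp [h, h'] at h1
  · exact Or.inl ⟨p, hout p h1, h, h', fun q _ hq => h2 q hq⟩
  · exact Or.inr ⟨p, hout p h1, h', h, fun q _ hq => (h2 q hq).symm⟩
  · simp [h, h'] at h1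

/-- The game on a fibre is deterministic: the start is forced, staleness occurs at the first event,
and the least good element is unique because the lexicographic order is total on the fibre. -/
theorem Reach.unique (h : Reach A B I (fib I ρ) M φ j τ t)
    (h' : Reach A B I (fib I ρ) M φ j τ' t') : τ = τ' ∧ t = t' := by
  induction h generalizing τ' t' with
  | start τ hτ h0 =>
    cases h' with
    | start τ' hτ' h0' =>
      refine ⟨funext fun p => ?_, rfl⟩
      by_cases hp : p ∈ I
      · rw [h0 p hp, h0' p hp]
      · exact (hτ (show p ∈ (↑I : Set ℕ)ᶜ from hp)).trans
          (hτ' (show p ∈ (↑I : Set ℕ)ᶜ from hp)).symm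
  | next j τ₁ τ₂ t₁ t₂ h hs hg ih =>
    cases h' with
    | next _ σ₁ _ s₁ _ h' hs' hg' =>
      obtain ⟨rfl, rfl⟩ := ih h'
      obtain rfl := hs.unique hs'
      refine ⟨?_, rfl⟩
      by_contra hne
      rcases fullLexLT_total hg.1 hg'.1 hne with hl | hl
      · exact hg'.2.2.2 _ hg.1 hg.2.1 hg.2.2.1 hl
      · exact hg.2.2.2 _ hg'.1 hg'.2.1 hg'.2.2.1 hl

theorem Reach.exists_of_le (h : Reach A B I F M φ j τ t) {i : ℕ} (hi : i ≤ j) :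
    ∃ σ s, Reach A B I F M φ i σ s := by
  induction h with
  | start τ hτ h0 =>
    obtain rfl : i = 0 := by omega
    exact ⟨_, _, .start τ hτ h0⟩
  | next j τ₁ τ₂ t₁ t₂ h hs hg ih =>
    rcases Nat.lt_or_eq_of_le hi with hl | rfl
    · exact ih (by omega)
    · exact ⟨_, _, .next j τ₁ τ₂ t₁ t₂ h hs hg⟩

/-- The first choice is made without a test. It is good because at time 0 nothing has been split,
the only part contains the whole fibre, and the capital is the initial mass. -/
theorem start_fullGood (hmass : A.mass [] < 2) (hM : 0 < M) (hφ : φ < 2 ^ I.card)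
    (ρ τ : Seq) : A.FullGood (fib I ρ) M φ τ 0 := by
  refine ⟨[], isTerminal_zero, mem_nil, by simpa using hM, ?_, ?_⟩
  · simpa [mem_nil, ncard_fib] using hφ
  · rw [← not_le, le_maxCapital_iff]
    rintro ⟨y, hy, h⟩
    obtain rfl : y = [] := by simpa using hy
    have : IsProbabilityMeasure size := by unfold size; infer_instance
    simp [capital, A.root] at h
    linarith

theorem Reach.fullGood (hA : A.mass [] < 2) (hB : B.mass [] < 2) (hM : 0 < M)
    (hφ : φ < 2 ^ I.card) (h : Reach A B I (fib I ρ) M φ j τ t) :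
    A.FullGood (fib I ρ) M φ τ t ∧ B.FullGood (fib I ρ) M φ τ t := by
  cases h with
  | start => exact ⟨start_fullGood hA hM hφ ρ τ, start_fullGood hB hM hφ ρ τ⟩
  | next _ _ _ _ _ _ _ hg => exact ⟨hg.2.1, hg.2.2.1⟩

/-- The choices numbered `0, …, j` are an `(M, φ)`-sequence for the two projected strategies on the
`2 ^ |I|` elements of the fibre. -/
theorem Reach.succ_le (hA : A.mass [] < 2) (hB : B.mass [] < 2) (hM : 0 < M)
    (hφ : φ < 2 ^ I.card) {q : ℝ} (hq : IsLengthBound I.card M φ q)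
    (h : Reach A B I (fib I ρ) M φ j τ t) : (j : ℝ) + 1 ≤ q := by
  have hex : ∀ i : Fin (j + 1), ∃ σ s, Reach A B I (fib I ρ) M φ i σ s := fun i =>
    h.exists_of_le (Nat.lt_succ_iff.1 i.2)
  choose C T hC using hex
  have hcard : Nat.card (fib I ρ) = 2 ^ I.card := by
    rw [Nat.card_coe_set_eq, ncard_fib]
  -- The times are extended by the dummy value 0 beyond the last choice.
  have := hq (fib I ρ) hcard (A.projected _) (B.projected _) (j + 1)
    (fun i => ⟨C i, (hC i).mem⟩)
    ⟨fun i => if hi : i < j + 1 then T ⟨i, hi⟩ else 0, ?_, fun i => ?_⟩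
  · exact_mod_cast this
  · have := hC ⟨0, Nat.succ_pos j⟩
    simp only [Nat.succ_pos, dif_pos]
    generalize T ⟨0, Nat.succ_pos j⟩ = s at this
    cases this
    rfl
  · simp only [i.2, dif_pos, projected_good]
    have hg := (hC i).fullGood hA hB hM hφ
    refine ⟨hg.1, hg.2, fun hi => ?_⟩
    simp only [hi, dif_pos]
    have h1 := hC ⟨i + 1, hi⟩
    have h2 := hC i
    simp only [StalePE, projected_event]
    generalize C ⟨i + 1, hi⟩ = σ at h1
    generalize T ⟨i + 1, hi⟩ = s at h1
    cases h1 with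
    | next _ τ₁ _ t₁ _ h' hs _ =>
      obtain ⟨rfl, rfl⟩ := h2.unique h'
      exact hs

end BettingGame

namespace BettingGame

/-! ### Restrictions of sequences -/

namespace Restriction

open Classical in
/-- The restriction of exactly the positions in `S` to the bits of `σ`. -/
noncomputable def ofSeq (σ : Seq) (S : Set ℕ) : Restriction :=
  fun p => if p ∈ S then some (σ p) else none

variable {σ τ : Seq} {S : Set ℕ} {r s z : Restriction} {p : ℕ}

@[simp] theorem dom_ofSeq (σ : Seq) (S : Set ℕ) : (ofSeq σ S).dom = S := by
  ext p
  by_cases hp : p ∈ S <;> simp [ofSeq, dom, hp]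

theorem mem_cyl_ofSeq : τ ∈ (ofSeq σ S).cyl ↔ Set.EqOn τ σ S := by
  constructor
  · intro h p hp
    exact h p (σ p) (by simp [ofSeq, hp])
  · intro h p b hb
    by_cases hp : p ∈ S
    · simp only [ofSeq, hp, if_true, Option.some.injEq] at hb
      rw [h hp, hb]
    · simp [ofSeq, hp] at hb

theorem eqOn_of_mem_cyl (hσ : σ ∈ r.cyl) (hτ : τ ∈ r.cyl) : Set.EqOn σ τ r.dom := by
  intro p hp
  obtain ⟨b, hb⟩ := Option.ne_none_iff_exists'.1 hp
  rw [hσ p b hb, hτ p b hb]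

theorem mem_cyl_of_eqOn (hσ : σ ∈ r.cyl) (h : Set.EqOn τ σ r.dom) : τ ∈ r.cyl := by
  intro p b hb
  rw [h (show r p ≠ none by simp [hb]), hσ p b hb]

theorem eq_ofSeq (hσ : σ ∈ r.cyl) : r = ofSeq σ r.dom := by
  funext p
  by_cases hp : r p = none
  · simp [ofSeq, dom, hp]
  · obtain ⟨b, hb⟩ := Option.ne_none_iff_exists'.1 hp
    rw [ofSeq, if_pos (show p ∈ r.dom from hp), hb, hσ p b hb]

theorem cyl_nonempty (r : Restriction) : r.cyl.Nonempty :=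
  ⟨fun p => (r p).getD false, fun p b hb => by simp [hb]⟩

theorem Extends.cyl_subset (h : z.Extends r) : r.cyl ⊆ z.cyl :=
  fun _ hσ p b hb => hσ p b (h p b hb)

theorem dom_concat : (s.concat r).dom = s.dom ∪ r.dom := by
  ext p
  cases h : s p <;> simp [dom, concat, h]

theorem mem_cyl_concat (h : Disjoint s.dom r.dom) :
    σ ∈ (s.concat r).cyl ↔ σ ∈ s.cyl ∧ σ ∈ r.cyl := by
  constructor
  · intro hσ
    refine ⟨fun p b hb => hσ p b (by simp [concat, hb]), fun p b hb => hσ p b ?_⟩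
    have : s p = none := by
      by_contra hc
      exact Set.disjoint_left.1 h hc (show r p ≠ none by simp [hb])
    simp [concat, this, hb]
  · rintro ⟨h1, h2⟩ p b hb
    cases hs : s p with
    | none => exact h2 p b (by simpa [concat, hs] using hb)
    | some c => exact h1 p b (by simpa [concat, hs] using hb)

theorem dom_zeros (I : Finset ℕ) : (zeros I).dom = ↑I := by
  ext p
  by_cases hp : p ∈ I <;> simp [zeros, dom, hp]

theorem ofSeq_eq_zeros {I : Finset ℕ} (h : ∀ p ∈ I, σ p = false) : ofSeq σ ↑I = zeros I := by
  funext p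
  by_cases hp : p ∈ I <;> simp [ofSeq, zeros, hp, h]

theorem concat_ofSeq {S' : Set ℕ} : (ofSeq σ S).concat (ofSeq σ S') = ofSeq σ (S ∪ S') := by
  funext p
  by_cases h : p ∈ S <;> by_cases h' : p ∈ S' <;> simp [concat, ofSeq, h, h']

end Restriction

open PartitionRefinement BettingStrategy Restriction

/-! ### Heads and tails versus full sequences -/

section Bridge

variable {A B : BettingStrategy} {I : Finset ℕ} {M φ t t' : ℕ} {s s' r r' z : Restriction}
  {σ τ : Seq} {x : List Bool}

theorem fib_subset_cyl (hr : Disjoint r.dom ↑I) (hτ : τ ∈ r.cyl) : fib I τ ⊆ r.cyl :=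
  fun _ hσ => mem_cyl_of_eqOn hτ fun _ hp => hσ (Set.disjoint_left.1 hr hp)

theorem exists_fib_of_head (hs : s.dom = ↑I) (τ : Seq) : ∃ σ ∈ fib I τ, σ ∈ s.cyl := by
  refine ⟨fun p => (s p).getD (τ p), fun p hp => ?_, fun p b hb => by simp [hb]⟩
  have : s p = none := by
    by_contra hc
    rw [← hs] at hp
    exact hp hc
  simp [this]

variable (hr : Disjoint r.dom ↑I) (hK : A.inspected t ⊆ ↑I ∪ r.dom)

include hK in
-- The restriction `s^r` fixes all inspected positions, so `[s^r]` lies either inside a part or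
-- outside it, and one element decides.
theorem head_subset_iff (hs : s.dom = ↑I) (hτ : τ ∈ (s.concat r).cyl) {v : Set Seq}
    (hv : A.part t x = some v) : (s.concat r).cyl ⊆ v ↔ A.Mem t x τ := by
  refine ⟨fun h => ⟨v, hv, h hτ⟩, fun h σ hσ => ?_⟩
  rw [← mem_iff hv]
  refine (mem_congr_of_eqOn ?_ (eqOn_of_mem_cyl hτ hσ)).1 h
  rwa [dom_concat, hs]

include hr hK in
-- Replacing the bits of `τ` in `I` by those of `σ` does not leave the part of `σ`, since both agree
-- with `r` at the inspected positions outside `I`. Hence a single fibre shows which parts meet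
-- `[r]`.
theorem exists_mem_cyl_iff (hτ : τ ∈ r.cyl) :
    (∃ σ ∈ r.cyl, A.Mem t x σ) ↔ ∃ σ ∈ fib I τ, A.Mem t x σ := by
  classical
  constructor
  · rintro ⟨σ, hσ, h⟩
    refine ⟨fun p => if p ∈ I then σ p else τ p, fun p hp => ?_, ?_⟩
    · have : p ∉ I := hp
      simp [this]
    · refine (mem_congr_of_eqOn hK fun p hp => ?_).1 h
      by_cases hI : p ∈ I
      · simp [hI]
      · simp only [hI, if_false]
        exact eqOn_of_mem_cyl hσ hτ (hp.resolve_left hI)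
  · rintro ⟨σ, hσ, h⟩
    exact ⟨σ, fib_subset_cyl hr hτ hσ, h⟩

include hr hK in
theorem splitOn_iff (hτ : τ ∈ r.cyl) (hd : ∀ b, A.part t (x ++ [b]) ≠ none) :
    A.SplitOn r x ↔ A.Splits (Subtype.val : fib I τ → Seq) x := by
  have h1 : A.SplitOn r x ↔ (∃ σ ∈ r.cyl, A.Mem t (x ++ [false]) σ) ∧
      ∃ σ ∈ r.cyl, A.Mem t (x ++ [true]) σ := by
    constructor
    · rintro ⟨t', v₀, v₁, h0, h1, ⟨σ, hσ, hσr⟩, ⟨σ', hσ', hσr'⟩⟩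
      exact ⟨⟨σ, hσr, (mem_congr (by simp [h0]) (hd false)).1 ⟨v₀, h0, hσ⟩⟩,
        ⟨σ', hσr', (mem_congr (by simp [h1]) (hd true)).1 ⟨v₁, h1, hσ'⟩⟩⟩
    · rintro ⟨⟨σ, hσr, v₀, h0, hσ⟩, ⟨σ', hσr', v₁, h1, hσ'⟩⟩
      exact ⟨t, v₀, v₁, h0, h1, ⟨σ, hσ, hσr⟩, ⟨σ', hσ', hσr'⟩⟩
  have h2 : A.Splits (Subtype.val : fib I τ → Seq) x ↔
      (∃ σ ∈ fib I τ, A.Mem t (x ++ [false]) σ) ∧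
        ∃ σ ∈ fib I τ, A.Mem t (x ++ [true]) σ := by
    constructor
    · intro h
      obtain ⟨⟨σ, hσ⟩, h0⟩ := h.meets_child false (hd false) false
      obtain ⟨⟨σ', hσ'⟩, h1⟩ := h.meets_child false (hd false) true
      exact ⟨⟨σ, hσ, h0⟩, ⟨σ', hσ', h1⟩⟩
    · rintro ⟨⟨σ, hσ, h0⟩, ⟨σ', hσ', h1⟩⟩
      exact ⟨t, ⟨⟨σ, hσ⟩, h0⟩, ⟨⟨σ', hσ'⟩, h1⟩⟩
  rw [h1, h2, exists_mem_cyl_iff hr hK hτ, exists_mem_cyl_iff hr hK hτ]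

theorem children_defined_of_lt (hx : A.part t x ≠ none) {k : ℕ} (hk : k < x.length) (b : Bool) :
    A.part t (x.take k ++ [b]) ≠ none := by
  refine child_defined (b := x[k]) (defined_of_prefix hx ?_) b
  rw [List.take_concat_get' x k hk]
  exact List.take_prefix _ _

include hr hK in
theorem splitsOn_eq (hτ : τ ∈ r.cyl) (hx : A.part t x ≠ none) :
    A.splitsOn r x = (A.proj (Subtype.val : fib I τ → Seq) x).length := by
  rw [length_proj, splitsOn]
  congr 1
  ext k
  exact and_congr_right fun hk => splitOn_iff hr hK hτ fun b => children_defined_of_lt hx hk b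

include hr hK in
theorem ncard_heads (hτ : τ ∈ r.cyl) {v : Set Seq} (hv : A.part t x = some v) :
    {s' : Restriction | s'.dom = ↑I ∧ (s'.concat r).cyl ⊆ v}.ncard
      = {σ ∈ fib I τ | A.Mem t x σ}.ncard := by
  have hinj : Set.InjOn (fun σ => ofSeq σ ↑I) {σ ∈ fib I τ | A.Mem t x σ} := by
    intro σ hσ σ' hσ' h
    funext p
    by_cases hp : p ∈ I
    · have := congrFun h p
      simpa [ofSeq, hp] using this
    · exact (hσ.1 (show p ∈ (↑I : Set ℕ)ᶜ from hp)).trans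
        (hσ'.1 (show p ∈ (↑I : Set ℕ)ᶜ from hp)).symm
  rw [← hinj.ncard_image]
  congr 1
  ext s'
  simp only [Set.mem_ofPred_eq, Set.mem_image]
  have hcat : ∀ {u : Restriction} {σ : Seq}, u.dom = ↑I → σ ∈ fib I τ → σ ∈ u.cyl →
      σ ∈ (u.concat r).cyl := fun hu hσ hσu =>
    (mem_cyl_concat (hu ▸ hr.symm)).2 ⟨hσu, fib_subset_cyl hr hτ hσ⟩
  constructor
  · rintro ⟨hs', h⟩
    obtain ⟨σ, hσ, hσs⟩ := exists_fib_of_head hs' τ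
    exact ⟨σ, ⟨hσ, ⟨v, hv, h (hcat hs' hσ hσs)⟩⟩, by rw [← hs', ← eq_ofSeq hσs]⟩
  · rintro ⟨σ, ⟨hσ, hm⟩, rfl⟩
    refine ⟨dom_ofSeq _ _, (head_subset_iff hK (dom_ofSeq _ _) (hcat (dom_ofSeq _ _) hσ ?_) hv).2 hm⟩
    exact mem_cyl_ofSeq.2 fun _ _ => rfl

include hr hK in
theorem good_iff (hs : s.dom = ↑I) (hτ : τ ∈ (s.concat r).cyl) :
    A.Good I M φ s r t ↔ A.FullGood (fib I τ) M φ τ t := by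
  have hτr : τ ∈ r.cyl := ((mem_cyl_concat (hs ▸ hr.symm)).1 hτ).2
  constructor
  · rintro ⟨x, v, hT, hv, hsub, hM, hφ, hc⟩
    refine ⟨x, hT, (head_subset_iff hK hs hτ hv).1 hsub, ?_, ?_, hc⟩
    · rwa [← splitsOn_eq hr hK hτr hT.1]
    · rwa [← ncard_heads hr hK hτr hv]
  · rintro ⟨x, hT, hm, hM, hφ, hc⟩
    obtain ⟨v, hv, -⟩ := id hm
    refine ⟨x, v, hT, hv, (head_subset_iff hK hs hτ hv).2 hm, ?_, ?_, hc⟩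
    · rwa [splitsOn_eq hr hK hτr hT.1]
    · rwa [ncard_heads hr hK hτr hv]

include hr hK in
theorem event_iff (hs : s.dom = ↑I) (hτ : τ ∈ (s.concat r).cyl) :
    A.Event s r t ↔ A.FullEvent (fib I τ) τ t := by
  have hτr : τ ∈ r.cyl := ((mem_cyl_concat (hs ▸ hr.symm)).1 hτ).2
  refine or_congr ⟨?_, ?_⟩ ⟨?_, ?_⟩
  · rintro ⟨x, v, hv, hsub, hS, hO⟩
    obtain ⟨t'', rfl, -, hc⟩ := splitAt_iff.1 hS
    exact ⟨x, (head_subset_iff hK hs hτ hv).1 hsub, hS, (splitOn_iff hr hK hτr hc).1 hO⟩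
  · rintro ⟨x, hm, hS, hO⟩
    obtain ⟨v, hv, -⟩ := id hm
    obtain ⟨t'', rfl, -, hc⟩ := splitAt_iff.1 hS
    exact ⟨x, v, hv, (head_subset_iff hK hs hτ hv).2 hm, hS, (splitOn_iff hr hK hτr hc).2 hO⟩
  · rintro ⟨x, ⟨hT, v, hv, hsub⟩, hc⟩
    exact ⟨x, hT, (head_subset_iff hK hs hτ hv).1 hsub, hc⟩
  · rintro ⟨x, hT, hm, hc⟩
    obtain ⟨v, hv, -⟩ := id hm
    exact ⟨x, ⟨hT, v, hv, (head_subset_iff hK hs hτ hv).2 hm⟩, hc⟩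

variable (hKB : B.inspected t ⊆ ↑I ∪ r.dom)

include hr hK hKB in
-- Inspected sets grow with time, so the tail taken at `t` also covers all earlier times at which an
-- event must be excluded.
theorem stale_iff {t₀ : ℕ} (hs : s.dom = ↑I) (hτ : τ ∈ (s.concat r).cyl) :
    Stale A B s r t₀ t ↔ FullStale A B (fib I τ) τ t₀ t := by
  have h : ∀ u ≤ t, (A.Event s r u ∨ B.Event s r u) ↔
      (A.FullEvent (fib I τ) τ u ∨ B.FullEvent (fib I τ) τ u) := fun u hu =>
    or_congr (event_iff hr ((A.inspected_mono hu).trans hK) hs hτ)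
      (event_iff hr ((B.inspected_mono hu).trans hKB) hs hτ)
  refine and_congr_right fun _ => and_congr (h t le_rfl) (forall_congr' fun u => ?_)
  exact imp_congr_right fun _ => imp_congr_right fun hu => not_congr (h u hu.le)

theorem lexLT_iff (hs : s.dom = ↑I) (hs' : s'.dom = ↑I) (hσ : σ ∈ s.cyl) (hτ : τ ∈ s'.cyl) :
    LexLT I s s' ↔ FullLexLT I σ τ := by
  have e : ∀ p ∈ I, s p = some (σ p) := fun p hp => by
    rw [eq_ofSeq hσ, hs]
    simp [ofSeq, hp]
  have e' : ∀ p ∈ I, s' p = some (τ p) := fun p hp => by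
    rw [eq_ofSeq hτ, hs']
    simp [ofSeq, hp]
  refine exists_congr fun p => and_congr_right fun hp => ?_
  rw [e p hp, e' p hp, Option.some.injEq, Option.some.injEq]
  refine and_congr_right fun _ => and_congr_right fun _ => forall_congr' fun q =>
    forall_congr' fun hq => ?_
  rw [e q hq, e' q hq, Option.some.injEq]

include hr hK hKB in
theorem leastGood_iff (hs : s.dom = ↑I) (hτ : τ ∈ (s.concat r).cyl) :
    LeastGood A B I M φ s r t ↔ FullLeastGood A B I (fib I τ) M φ τ t := by
  obtain ⟨hτs, hτr⟩ := (mem_cyl_concat (hs ▸ hr.symm)).1 hτ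
  have key : ∀ u : Restriction, u.dom = ↑I → ∀ σ ∈ fib I τ, σ ∈ u.cyl →
      ((A.Good I M φ u r t ↔ A.FullGood (fib I τ) M φ σ t) ∧
        (B.Good I M φ u r t ↔ B.FullGood (fib I τ) M φ σ t)) := by
    intro u hu σ hσ hσu
    have : σ ∈ (u.concat r).cyl :=
      (mem_cyl_concat (hu ▸ hr.symm)).2 ⟨hσu, fib_subset_cyl hr hτr hσ⟩
    rw [← fib_eq hσ]
    exact ⟨good_iff hr hK hu this, good_iff hr hKB hu this⟩
  rw [LeastGood, FullLeastGood, (key s hs τ (self_mem_fib I τ) hτs).1,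
    (key s hs τ (self_mem_fib I τ) hτs).2]
  refine and_congr (by simp [hs, self_mem_fib]) (and_congr_right fun _ =>
    and_congr_right fun _ => ⟨fun h σ hσ hA hB => ?_, fun h u hu hA hB => ?_⟩)
  · have hσu : σ ∈ (ofSeq σ ↑I).cyl := mem_cyl_ofSeq.2 fun _ _ => rfl
    have k := key _ (dom_ofSeq σ ↑I) σ hσ hσu
    rw [← lexLT_iff (dom_ofSeq σ ↑I) hs hσu hτs]
    exact h _ (dom_ofSeq _ _) (k.1.2 hA) (k.2.2 hB)
  · obtain ⟨σ, hσ, hσu⟩ := exists_fib_of_head hu τ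
    have k := key u hu σ hσ hσu
    rw [lexLT_iff hu hs hσu hτs]
    exact h σ hσ (k.1.1 hA) (k.2.1 hB)

end Bridge

/-! ### Chosen restrictions versus the game on fibres -/

variable {A B : BettingStrategy} {I : Finset ℕ} {M φ j t t' : ℕ} {s r z : Restriction}
  {ρ σ τ : Seq}

/-- The positions inspected by one of the two strategies. -/
def inspectedBy (A B : BettingStrategy) (t : ℕ) : Set ℕ := A.inspected t ∪ B.inspected t

theorem inspectedBy_mono (ht : t ≤ t') : inspectedBy A B t ⊆ inspectedBy A B t' :=
  Set.union_subset_union (A.inspected_mono ht) (B.inspected_mono ht)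

theorem finite_inspectedBy (A B : BettingStrategy) (t : ℕ) : (inspectedBy A B t).Finite :=
  (A.finite_inspected t).union (B.finite_inspected t)

theorem subset_of_dom (hr : r.dom = (inspectedBy A B t ∪ z.dom) \ ↑I) :
    A.inspected t ⊆ ↑I ∪ r.dom ∧ B.inspected t ⊆ ↑I ∪ r.dom := by
  rw [hr, Set.union_sdiff_self]
  exact ⟨fun p hp => Or.inr (Or.inl (Or.inl hp)), fun p hp => Or.inr (Or.inl (Or.inr hp))⟩

/-- A chosen restriction describes the same play in the fibre of each sequence consistent with it,
because its tail contains all positions outside `I` inspected so far. -/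
theorem Chosen.reach (hz : Disjoint z.dom ↑I) (h : Chosen A B I M φ z s r t) :
    s.dom = ↑I ∧ r.dom = (inspectedBy A B t ∪ z.dom) \ ↑I ∧ z.Extends r ∧
      ∀ τ ∈ (s.concat r).cyl, ∃ j, Reach A B I (fib I τ) M φ j τ t := by
  induction h with
  | start =>
    refine ⟨dom_zeros I, ?_, fun _ _ h => h, fun τ hτ => ⟨0, .start τ (self_mem_fib I τ) ?_⟩⟩
    · simp [inspectedBy, inspected_zero, hz.sdiff_eq_left]
    · intro p hp
      exact hτ p false (by simp [concat, zeros, hp])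
  | next s r s' r' t t' h hdom hext hstale hgood ih =>
    obtain ⟨hs, hrd, hzr, ih⟩ := ih
    have hs' := hgood.1
    refine ⟨hs', hdom, fun p b hb => hext p b (hzr p b hb), fun τ hτ => ?_⟩
    have hr' : Disjoint r'.dom ↑I := hdom ▸ Set.disjoint_sdiff_left
    obtain ⟨hKA, hKB⟩ := subset_of_dom hdom
    obtain ⟨hτs', hτr'⟩ := (mem_cyl_concat (hs' ▸ hr'.symm)).1 hτ
    -- `σ` is the previous choice as it appears in the fibre of `τ`.
    obtain ⟨σ, hσ, hσs⟩ := exists_fib_of_head hs τ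
    have hσr' := fib_subset_cyl hr' hτr' hσ
    have hσ' : σ ∈ (s.concat r').cyl := (mem_cyl_concat (hs ▸ hr'.symm)).2 ⟨hσs, hσr'⟩
    have hσ0 : σ ∈ (s.concat r).cyl := by
      refine (mem_cyl_concat ?_).2 ⟨hσs, hext.cyl_subset hσr'⟩
      rw [hs, hrd]
      exact Set.disjoint_sdiff_right
    obtain ⟨j, hj⟩ := ih σ hσ0
    have h1 := (stale_iff hr' hKA hKB hs hσ').1 hstale
    rw [fib_eq hσ] at hj h1
    exact ⟨j + 1, .next j σ τ t t' hj h1 ((leastGood_iff hr' hKA hKB hs' hτ).1 hgood)⟩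

theorem Reach.chosen (hz : Disjoint z.dom ↑I) (hρ : ρ ∈ z.cyl)
    (h : Reach A B I (fib I ρ) M φ j τ t) :
    Chosen A B I M φ z (ofSeq τ ↑I) (ofSeq ρ ((inspectedBy A B t ∪ z.dom) \ ↑I)) t := by
  induction h with
  | start τ hτ h0 =>
    rw [ofSeq_eq_zeros h0, inspectedBy, inspected_zero, inspected_zero, Set.empty_union,
      Set.empty_union, hz.sdiff_eq_left, ← eq_ofSeq hρ]
    exact .start
  | next j τ τ' t t' h hs hg ih =>
    have hτ := h.mem
    have hτ' := hg.1
    set r' := ofSeq ρ ((inspectedBy A B t' ∪ z.dom) \ ↑I) with hr'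
    have hdom : r'.dom = (inspectedBy A B t' ∪ z.dom) \ ↑I := dom_ofSeq _ _
    have hrI : Disjoint r'.dom ↑I := hdom ▸ Set.disjoint_sdiff_left
    obtain ⟨hKA, hKB⟩ := subset_of_dom hdom
    have hρr : ρ ∈ r'.cyl := mem_cyl_ofSeq.2 fun _ _ => rfl
    have hmem : ∀ σ ∈ fib I ρ, σ ∈ ((ofSeq σ ↑I).concat r').cyl := fun σ hσ =>
      (mem_cyl_concat (by rw [dom_ofSeq]; exact hrI.symm)).2
        ⟨mem_cyl_ofSeq.2 fun _ _ => rfl, fib_subset_cyl hrI hρr hσ⟩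
    refine .next _ _ _ _ t t' ih hdom (fun p b hb => ?_) ?_ ?_
    · have hp : p ∈ (inspectedBy A B t ∪ z.dom) \ ↑I := by
        by_contra hc
        simp [ofSeq, hc] at hb
      have hp' : p ∈ (inspectedBy A B t' ∪ z.dom) \ ↑I :=
        ⟨hp.1.imp_left fun h => inspectedBy_mono hs.1.le h, hp.2⟩
      rw [hr', ofSeq, if_pos hp', ← hb, ofSeq, if_pos hp]
    · rw [stale_iff hrI hKA hKB (dom_ofSeq _ _) (hmem τ hτ), fib_eq hτ]
      exact hs
    · rw [leastGood_iff hrI hKA hKB (dom_ofSeq _ _) (hmem τ' hτ'), fib_eq hτ']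
      exact hg

/-- With the empty restriction as `z`, the chosen restriction involves only `I` and inspected
positions. Going to `Chosen` and back therefore transfers the play to any sequence that agrees
there. -/
theorem Reach.congr (h : Reach A B I (fib I τ) M φ j τ t)
    (hσ : Set.EqOn σ τ (↑I ∪ inspectedBy A B t)) :
    ∃ j, Reach A B I (fib I σ) M φ j σ t := by
  have hz : Disjoint Restriction.empty.dom (↑I : Set ℕ) := by simp [Restriction.empty, dom]
  have hc := h.chosen hz (fun p b hb => by simp [Restriction.empty] at hb)
  refine (hc.reach hz).2.2.2 σ ?_
  rw [concat_ofSeq, mem_cyl_ofSeq]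
  refine hσ.mono fun p hp => ?_
  rcases hp with hp | ⟨hp | hp, -⟩
  · exact Or.inl hp
  · exact Or.inr hp
  · simp [Restriction.empty, dom] at hp

/-! ### Levels of chosen restrictions as paths -/

/-- The positions restricted after the choices `l`, a list of pairs of a zone and a time. -/
def pathDom (A B : BettingStrategy) (Z : ℕ → Zone) : List (ℕ × ℕ) → Set ℕ
  | [] => ∅
  | (i, t) :: l => ↑(Z i).I ∪ (inspectedBy A B t ∪ pathDom A B Z l)

/-- The restrictions of `τ` at the zones and times in `l` are chosen one after the other. -/
def IsPath (A B : BettingStrategy) (Z : ℕ → Zone) (τ : Seq) : List (ℕ × ℕ) → Prop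
  | [] => True
  | (i, t) :: l => IsPath A B Z τ l ∧ Disjoint (pathDom A B Z l) ↑(Z i).I ∧
      ∃ j, Reach A B (Z i).I (fib (Z i).I τ) ((Z i).N + 1) (Z i).φ j τ t

variable {Z : ℕ → Zone} {l : List (ℕ × ℕ)}

theorem finite_pathDom (A B : BettingStrategy) (Z : ℕ → Zone) (l : List (ℕ × ℕ)) :
    (pathDom A B Z l).Finite := by
  induction l with
  | nil => exact Set.finite_empty
  | cons p l ih => exact (Finset.finite_toSet _).union ((finite_inspectedBy A B _).union ih)

theorem IsPath.congr (h : IsPath A B Z τ l) (hσ : Set.EqOn σ τ (pathDom A B Z l)) :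
    IsPath A B Z σ l := by
  induction l with
  | nil => trivial
  | cons p l ih =>
    obtain ⟨h1, h2, j, h3⟩ := h
    refine ⟨ih h1 (hσ.mono fun p hp => Or.inr (Or.inr hp)), h2, h3.congr (hσ.mono ?_)⟩
    rintro p (hp | hp)
    · exact Or.inl hp
    · exact Or.inr (Or.inl hp)

theorem mem_chosenLevel_succ {n : ℕ} {c : Restriction} : c ∈ chosenLevel A B Z (n + 1) ↔
    ∃ z ∈ chosenLevel A B Z n, ∃ i, Disjoint z.dom (↑(Z i).I : Set ℕ) ∧ ∃ τ ∈ z.cyl, ∃ j t,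
      Reach A B (Z i).I (fib (Z i).I τ) ((Z i).N + 1) (Z i).φ j τ t ∧
        c = ofSeq τ (↑(Z i).I ∪ (inspectedBy A B t ∪ z.dom)) := by
  constructor
  · rintro ⟨z, hz, i, hd, s, r, t, hc, rfl⟩
    obtain ⟨hs, hr, hzr, hre⟩ := hc.reach hd
    obtain ⟨τ, hτ⟩ := (s.concat r).cyl_nonempty
    obtain ⟨j, hj⟩ := hre τ hτ
    have hsr : Disjoint s.dom r.dom := by
      rw [hs, hr]
      exact Set.disjoint_sdiff_right
    refine ⟨z, hz, i, hd, τ, hzr.cyl_subset ((mem_cyl_concat hsr).1 hτ).2, j, t, hj, ?_⟩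
    rw [eq_ofSeq hτ, dom_concat, hs, hr, Set.union_sdiff_self]
  · rintro ⟨z, hz, i, hd, τ, hτ, j, t, hj, rfl⟩
    refine ⟨z, hz, i, hd, _, _, t, hj.chosen hd hτ, ?_⟩
    rw [concat_ofSeq, Set.union_sdiff_self]

/-- A restriction in a level is recovered from one consistent sequence and the list of zones and
times of the choices, the latest first. In this form membership depends on finitely many bits and
can be searched for. -/
theorem mem_chosenLevel_iff {n : ℕ} {c : Restriction} : c ∈ chosenLevel A B Z n ↔
    ∃ l τ, l.length = n ∧ IsPath A B Z τ l ∧ c = ofSeq τ (pathDom A B Z l) := by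
  induction n generalizing c with
  | zero =>
    have : c ∈ chosenLevel A B Z 0 ↔ c = Restriction.empty := Iff.rfl
    rw [this]
    constructor
    · rintro rfl
      refine ⟨[], fun _ => false, rfl, trivial, ?_⟩
      funext p
      simp [Restriction.empty, ofSeq, pathDom]
    · rintro ⟨l, τ, hl, -, rfl⟩
      obtain rfl := List.length_eq_zero_iff.1 hl
      funext p
      simp [Restriction.empty, ofSeq, pathDom]
  | succ n ih =>
    rw [mem_chosenLevel_succ]
    constructor
    · rintro ⟨z, hz, i, hd, τ, hτ, j, t, hj, rfl⟩
      obtain ⟨l, σ, hl, hp, rfl⟩ := ih.1 hz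
      rw [dom_ofSeq] at hd
      exact ⟨(i, t) :: l, τ, by simp [hl],
        ⟨hp.congr (mem_cyl_ofSeq.1 hτ), hd, j, hj⟩, by rw [dom_ofSeq, pathDom]⟩
    · rintro ⟨l, τ, hl, hp, rfl⟩
      obtain _ | ⟨⟨i, t⟩, l⟩ := l
      · simp at hl
      · obtain ⟨hp, hd, j, hj⟩ := hp
        exact ⟨_, ih.2 ⟨l, τ, by simpa using hl, hp, rfl⟩, i, by rwa [dom_ofSeq], τ,
          mem_cyl_ofSeq.2 fun _ _ => rfl, j, t, hj, by rw [dom_ofSeq, pathDom]⟩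

theorem mem_chosenSet_iff {n : ℕ} :
    σ ∈ chosenSet A B Z n ↔ ∃ l, l.length = n ∧ IsPath A B Z σ l := by
  constructor
  · rintro ⟨c, hc, hσ⟩
    obtain ⟨l, τ, hl, hp, rfl⟩ := mem_chosenLevel_iff.1 hc
    exact ⟨l, hl, hp.congr (mem_cyl_ofSeq.1 hσ)⟩
  · rintro ⟨l, hl, hp⟩
    exact ⟨_, mem_chosenLevel_iff.2 ⟨l, σ, hl, hp, rfl⟩, mem_cyl_ofSeq.2 fun _ _ => rfl⟩

theorem chosenSet_succ_subset (n : ℕ) : chosenSet A B Z (n + 1) ⊆ chosenSet A B Z n := by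
  intro σ hσ
  obtain ⟨l, hl, hp⟩ := mem_chosenSet_iff.1 hσ
  obtain _ | ⟨p, l⟩ := l
  · simp at hl
  · exact mem_chosenSet_iff.2 ⟨l, by simpa using hl, hp.1⟩

end BettingGame

namespace BettingGame

open PartitionRefinement BettingStrategy Restriction

/-! ### The uniform measure and flips -/

instance : IsProbabilityMeasure size := by
  unfold size
  infer_instance

theorem measurable_flip (F : Finset ℕ) : Measurable (flip F) :=
  measurable_pi_lambda _ fun p =>
    (measurable_of_countable fun b => xor (decide (p ∈ F)) b).comp (measurable_pi_apply p)

theorem measurePreserving_flip (F : Finset ℕ) : MeasurePreserving (flip F) size size := by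
  refine ⟨measurable_flip F, ?_⟩
  have h := Measure.infinitePi_map_pi (fun _ : ℕ => (PMF.uniformOfFintype Bool).toMeasure)
    (f := fun p b => xor (decide (p ∈ F)) b) fun p => measurable_of_countable _
  refine h.trans ?_
  rw [size]
  congr 1
  funext p
  refine Measure.ext_of_singleton fun b => ?_
  rw [Measure.map_apply (measurable_of_countable _) (measurableSet_singleton b)]
  have : (fun b' => xor (decide (p ∈ F)) b') ⁻¹' {b} = {xor (decide (p ∈ F)) b} := by
    ext b'
    by_cases hp : p ∈ F <;> cases b <;> cases b' <;> simp [hp]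
  rw [this, PMF.toMeasure_apply_singleton _ _ (measurableSet_singleton _),
    PMF.toMeasure_apply_singleton _ _ (measurableSet_singleton _)]
  simp

/-- The count is a sum over the `2 ^ |I|` flips of indicators of preimages of `E`, and flips
preserve the measure. -/
theorem lintegral_ncard_fib (I : Finset ℕ) {E : Set Seq} (hE : MeasurableSet E) :
    ∫⁻ τ, ({σ ∈ fib I τ | σ ∈ E}.ncard : ℝ≥0∞) ∂size = 2 ^ I.card * size E := by
  classical
  have h : ∀ τ, ({σ ∈ fib I τ | σ ∈ E}.ncard : ℝ≥0∞)
      = ∑ F ∈ I.powerset, (flip F ⁻¹' E).indicator 1 τ := by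
    intro τ
    rw [ncard_fib_inter, Finset.card_filter]
    push_cast
    refine Finset.sum_congr rfl fun F _ => ?_
    simp [Set.indicator_apply]
  simp only [h]
  rw [lintegral_finsetSum _ fun F _ => measurable_one.indicator (measurable_flip F hE)]
  have : ∀ F ∈ I.powerset, ∫⁻ τ, (flip F ⁻¹' E).indicator 1 τ ∂size = size E := fun F _ => by
    rw [lintegral_indicator_one (measurable_flip F hE),
      (measurePreserving_flip F).measure_preimage hE.nullMeasurableSet]
  rw [Finset.sum_congr rfl this, Finset.sum_const, Finset.card_powerset, nsmul_eq_mul]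
  norm_num

theorem measurableSet_of_dependsOn {E : Set Seq} {K : Set ℕ} (hK : K.Finite)
    (h : ∀ σ τ, Set.EqOn σ τ K → σ ∈ E → τ ∈ E) : MeasurableSet E := by
  have : Finite K := hK
  have e : E = (fun (σ : Seq) (p : K) => σ p) ⁻¹' ((fun (σ : Seq) (p : K) => σ p) '' E) := by
    refine Set.Subset.antisymm (Set.subset_preimage_image _ _) ?_
    rintro τ ⟨σ, hσ, he⟩
    exact h σ τ (fun p hp => congrFun he ⟨p, hp⟩) hσ
  rw [e]
  exact measurable_pi_lambda _ (fun p => measurable_pi_apply _) (Set.toFinite _).measurableSet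

theorem isClosed_cyl (r : Restriction) : IsClosed r.cyl := by
  have : r.cyl = ⋂ p, ⋂ b, ⋂ (_ : r p = some b), {σ : Seq | σ p = b} := by
    ext σ
    simp [cyl]
  rw [this]
  exact isClosed_iInter fun p => isClosed_iInter fun b => isClosed_iInter fun _ =>
    isClosed_eq (continuous_apply p) continuous_const

theorem measurableSet_cyl (r : Restriction) : MeasurableSet r.cyl := (isClosed_cyl r).measurableSet

theorem countable_finite_dom : {r : Restriction | r.dom.Finite}.Countable := by
  have : Function.Injective fun r : {r : Restriction | r.dom.Finite} =>
      (r.2.toFinset, (r.2.subset (t := {p | r.1 p = some true})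
        fun p (hp : r.1 p = some true) => show r.1 p ≠ none by simp [hp]).toFinset) := by
    rintro ⟨r, hr⟩ ⟨s, hs⟩ h
    simp only [Prod.mk.injEq, Set.Finite.toFinset_inj] at h
    refine Subtype.ext (funext fun p => ?_)
    have h1 : r p ≠ none ↔ s p ≠ none := Set.ext_iff.1 h.1 p
    have h2 : r p = some true ↔ s p = some true := Set.ext_iff.1 h.2 p
    show r p = s p
    rcases hrp : r p with _ | _ | _ <;> rcases hsp : s p with _ | _ | _ <;> simp_all
  exact this.countable

theorem finite_dom_of_mem_chosenLevel {A B : BettingStrategy} {Z : ℕ → Zone} {n : ℕ}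
    {c : Restriction} (h : c ∈ chosenLevel A B Z n) : c.dom.Finite := by
  obtain ⟨l, τ, -, -, rfl⟩ := mem_chosenLevel_iff.1 h
  rw [dom_ofSeq]
  exact finite_pathDom A B Z l

theorem countable_chosenLevel (A B : BettingStrategy) (Z : ℕ → Zone) (n : ℕ) :
    (chosenLevel A B Z n).Countable :=
  countable_finite_dom.mono fun _ h => finite_dom_of_mem_chosenLevel h

/-! ### The measure of the levels -/

/-- The restrictions chosen in the game on `I` and `z`. -/
def chosenFrom (A B : BettingStrategy) (I : Finset ℕ) (M φ : ℕ) (z : Restriction) :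
    Set Restriction :=
  {c | ∃ τ ∈ z.cyl, ∃ j t, Reach A B I (fib I τ) M φ j τ t ∧
    c = ofSeq τ (↑I ∪ (inspectedBy A B t ∪ z.dom))}

variable {A B : BettingStrategy} {I : Finset ℕ} {M φ : ℕ} {z : Restriction}

theorem cyl_subset_of_mem_chosenFrom {c : Restriction} (hc : c ∈ chosenFrom A B I M φ z) :
    c.cyl ⊆ z.cyl := by
  obtain ⟨τ, hτ, j, t, -, rfl⟩ := hc
  intro σ hσ
  exact mem_cyl_of_eqOn hτ ((mem_cyl_ofSeq.1 hσ).mono fun p hp => Or.inr (Or.inr hp))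

/-- Each pair of a chosen restriction and an element of the fibre consistent with it gets a number
in the game on the fibre. The number determines the pair, by determinism, and the numbers are
bounded by the length of the game. -/
theorem sum_ncard_chosenFrom_le (hA : A.mass [] < 2) (hB : B.mass [] < 2) (hM : 0 < M)
    (hφ : φ < 2 ^ I.card) {q : ℝ} (hq : IsLengthBound I.card M φ q) (C : Finset Restriction)
    (hC : ↑C ⊆ chosenFrom A B I M φ z) (τ : Seq) :
    ∑ c ∈ C, {σ ∈ fib I τ | σ ∈ c.cyl}.ncard ≤ ⌊q⌋₊ := by
  classical
  simp only [ncard_fib_inter]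
  rw [← Finset.card_sigma]
  have hex : ∀ x ∈ C.sigma fun c => I.powerset.filter fun F => flip F τ ∈ c.cyl, ∃ j t,
      Reach A B I (fib I τ) M φ j (flip x.2 τ) t ∧
        x.1 = ofSeq (flip x.2 τ) (↑I ∪ (inspectedBy A B t ∪ z.dom)) := by
    rintro ⟨c, F⟩ hx
    simp only [Finset.mem_sigma, Finset.mem_filter, Finset.mem_powerset] at hx
    obtain ⟨hc, hF, hm⟩ := hx
    obtain ⟨σ, hσ, j, t, hj, rfl⟩ := hC hc
    have he := mem_cyl_ofSeq.1 hm
    obtain ⟨j', hj'⟩ := hj.congr (σ := flip F τ) (he.mono fun p hp =>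
      hp.imp_right Or.inl)
    rw [fib_eq (flip_mem_fib hF τ)] at hj'
    refine ⟨j', t, hj', ?_⟩
    rw [eq_ofSeq hm, dom_ofSeq]
  choose! j t hj hc using hex
  rw [← Finset.card_range ⌊q⌋₊]
  refine Finset.card_le_card_of_injOn j (fun x hx => ?_) fun x hx y hy hxy => ?_
  · have := (hj x hx).succ_le hA hB hM hφ hq
    simp only [Finset.coe_range, Set.mem_Iio]
    exact Nat.lt_of_succ_le (Nat.le_floor (by exact_mod_cast this))
  · have h1 := hj x hx
    rw [hxy] at h1
    obtain ⟨h2, h3⟩ := h1.unique (hj y hy)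
    have h4 : x.2 = y.2 := flip_injective τ h2
    have h5 : x.1 = y.1 := by rw [hc x hx, hc y hy, h2, h3]
    exact Sigma.ext h5 (heq_of_eq h4)

theorem sum_size_chosenFrom_le (hA : A.mass [] < 2) (hB : B.mass [] < 2) (hM : 0 < M)
    (hφ : φ < 2 ^ I.card) {q : ℝ} (hq : IsLengthBound I.card M φ q) (hz : Disjoint z.dom ↑I)
    (C : Finset Restriction) (hC : ↑C ⊆ chosenFrom A B I M φ z) :
    2 ^ I.card * ∑ c ∈ C, size c.cyl ≤ ⌊q⌋₊ * size z.cyl := by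
  have hmeas : ∀ c : Restriction,
      Measurable fun τ => ({σ ∈ fib I τ | σ ∈ c.cyl}.ncard : ℝ≥0∞) := by
    classical
    intro c
    simp only [ncard_fib_inter, Finset.card_filter]
    push_cast
    exact Finset.measurable_sum _ fun F _ => Measurable.ite
      (measurable_flip F (measurableSet_cyl c)) measurable_const measurable_const
  calc 2 ^ I.card * ∑ c ∈ C, size c.cyl
      = ∫⁻ τ, ∑ c ∈ C, ({σ ∈ fib I τ | σ ∈ c.cyl}.ncard : ℝ≥0∞) ∂size := by
        rw [lintegral_finsetSum _ fun c _ => hmeas c, Finset.mul_sum]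
        exact Finset.sum_congr rfl fun c _ => (lintegral_ncard_fib I (measurableSet_cyl c)).symm
    _ ≤ ∫⁻ τ, z.cyl.indicator (fun _ => (⌊q⌋₊ : ℝ≥0∞)) τ ∂size := by
        refine lintegral_mono fun τ => ?_
        by_cases hτ : τ ∈ z.cyl
        · rw [Set.indicator_of_mem hτ]
          rw [← Nat.cast_sum]
          exact Nat.cast_le.2 (sum_ncard_chosenFrom_le hA hB hM hφ hq C hC τ)
        · rw [Set.indicator_of_notMem hτ]
          refine (Finset.sum_eq_zero fun c hc => ?_).le
          -- As `z` does not restrict `I`, a fibre lies either inside `[z]` or outside it.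
          have : {σ ∈ fib I τ | σ ∈ c.cyl} = ∅ := by
            refine Set.eq_empty_of_forall_notMem fun σ hσ => hτ ?_
            exact fib_subset_cyl hz (cyl_subset_of_mem_chosenFrom (hC hc) hσ.2)
              (fib_comm hσ.1)
          rw [this]
          simp
    _ = ⌊q⌋₊ * size z.cyl := lintegral_indicator_const (measurableSet_cyl z) _

theorem tsum_size_chosenFrom_le (hA : A.mass [] < 2) (hB : B.mass [] < 2) (hM : 0 < M)
    (hφ : φ < 2 ^ I.card) {k : ℕ}
    (hq : IsLengthBound I.card M φ ((2 : ℝ) ^ ((I.card : ℤ) - k))) (hz : Disjoint z.dom ↑I) :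
    ∑' c : chosenFrom A B I M φ z, size c.1.cyl ≤ (2⁻¹ : ℝ≥0∞) ^ k * size z.cyl := by
  rw [ENNReal.tsum_eq_iSup_sum]
  refine iSup_le fun C => ?_
  have h := sum_size_chosenFrom_le hA hB hM hφ hq hz (C.map (Function.Embedding.subtype _))
    (by intro c hc; simp at hc; exact hc.choose)
  rw [Finset.sum_map] at h
  simp only [Function.Embedding.subtype_apply] at h
  have hfl : (⌊(2 : ℝ) ^ ((I.card : ℤ) - k)⌋₊ : ℝ≥0∞) ≤ 2 ^ I.card * (2⁻¹ : ℝ≥0∞) ^ k := by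
    have h1 : ((⌊(2 : ℝ) ^ ((I.card : ℤ) - k)⌋₊ : ℕ) : ℝ) ≤ 2 ^ I.card * (2⁻¹) ^ k := by
      refine (Nat.floor_le (by positivity)).trans_eq ?_
      rw [zpow_sub₀ two_ne_zero, zpow_natCast, zpow_natCast, inv_pow, div_eq_mul_inv]
    have h2 := ENNReal.ofReal_le_ofReal h1
    rw [ENNReal.ofReal_natCast, ENNReal.ofReal_mul (by positivity),
      ENNReal.ofReal_pow (by norm_num), ENNReal.ofReal_pow (by norm_num),
      ENNReal.ofReal_inv_of_pos (by norm_num)] at h2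
    simpa using h2
  have h3 : 2 ^ I.card * ∑ c ∈ C, size c.1.cyl ≤
      2 ^ I.card * ((2⁻¹ : ℝ≥0∞) ^ k * size z.cyl) := by
    rw [← mul_assoc]
    exact h.trans (mul_le_mul_left hfl _)
  exact (ENNReal.mul_le_mul_iff_right (by simp) (by finiteness)).1 h3

/-- The game in zone `i` keeps at most `2^-(i+2)` of the measure of `[z]`; over all zones this adds
up to one half. -/
theorem tsum_size_chosenLevel_le {Z : ℕ → Zone} (hA : A.mass [] < 2) (hB : B.mass [] < 2)
    (hφ : ∀ i, (Z i).φ < 2 ^ (Z i).I.card)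
    (hQ : ∀ i, IsLengthBound (Z i).I.card ((Z i).N + 1) (Z i).φ
      ((2 : ℝ) ^ (((Z i).I.card : ℤ) - ((i : ℤ) + 1) - 1))) (n : ℕ) :
    ∑' c : chosenLevel A B Z n, size c.1.cyl ≤ (2⁻¹ : ℝ≥0∞) ^ n := by
  induction n with
  | zero =>
    have : chosenLevel A B Z 0 = {Restriction.empty} := rfl
    rw [this, tsum_singleton Restriction.empty fun c : Restriction => size c.cyl]
    simpa using prob_le_one
  | succ n ih =>
    have e : chosenLevel A B Z (n + 1) = ⋃ z : chosenLevel A B Z n,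
        ⋃ i : {i // Disjoint z.1.dom (↑(Z i).I : Set ℕ)},
          chosenFrom A B (Z i).I ((Z i).N + 1) (Z i).φ z.1 := by
      ext c
      rw [mem_chosenLevel_succ]
      simp only [Set.mem_iUnion, chosenFrom, Subtype.exists, exists_prop]
      rfl
    have hgeom : ∑' i : ℕ, (2⁻¹ : ℝ≥0∞) ^ (i + 2) = 2⁻¹ := by
      simp only [pow_add]
      rw [ENNReal.tsum_mul_right, ENNReal.tsum_geometric, ENNReal.one_sub_inv_two, inv_inv, pow_two,
        ← mul_assoc, ENNReal.mul_inv_cancel two_ne_zero ENNReal.ofNat_ne_top, one_mul]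
    rw [e]
    calc _ ≤ ∑' z : chosenLevel A B Z n, ∑' c : ⋃ i : {i // Disjoint z.1.dom (↑(Z i).I : Set ℕ)},
          chosenFrom A B (Z i).I ((Z i).N + 1) (Z i).φ z.1, size c.1.cyl :=
          ENNReal.tsum_iUnion_le_tsum (fun c : Restriction => size c.cyl) _
      _ ≤ ∑' z : chosenLevel A B Z n, 2⁻¹ * size z.1.cyl := by
          refine ENNReal.tsum_le_tsum fun z => ?_
          refine (ENNReal.tsum_iUnion_le_tsum (fun c : Restriction => size c.cyl) _).trans ?_
          calc _ ≤ ∑' i : {i // Disjoint z.1.dom (↑(Z i).I : Set ℕ)},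
                (2⁻¹ : ℝ≥0∞) ^ (i.1 + 2) * size z.1.cyl := by
                refine ENNReal.tsum_le_tsum fun i => ?_
                refine tsum_size_chosenFrom_le hA hB (Nat.succ_pos _) (hφ i) ?_ i.2
                convert hQ i using 2
                push_cast
                ring
            _ ≤ ∑' i : ℕ, (2⁻¹ : ℝ≥0∞) ^ (i + 2) * size z.1.cyl :=
                ENNReal.tsum_comp_le_tsum_of_injective Subtype.val_injective
                  fun i : ℕ => (2⁻¹ : ℝ≥0∞) ^ (i + 2) * size z.1.cyl
            _ = 2⁻¹ * size z.1.cyl := by rw [ENNReal.tsum_mul_right, hgeom]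
      _ ≤ (2⁻¹ : ℝ≥0∞) ^ (n + 1) := by
          rw [ENNReal.tsum_mul_left, pow_succ']
          gcongr

theorem size_chosenSet_le {Z : ℕ → Zone} (hA : A.mass [] < 2) (hB : B.mass [] < 2)
    (hφ : ∀ i, (Z i).φ < 2 ^ (Z i).I.card)
    (hQ : ∀ i, IsLengthBound (Z i).I.card ((Z i).N + 1) (Z i).φ
      ((2 : ℝ) ^ (((Z i).I.card : ℤ) - ((i : ℤ) + 1) - 1))) (n : ℕ) :
    size (chosenSet A B Z n) ≤ (2⁻¹ : ℝ≥0∞) ^ n := by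
  have e : chosenSet A B Z n = ⋃ c ∈ chosenLevel A B Z n, c.cyl := by
    ext σ
    simp [chosenSet]
  rw [e]
  exact (measure_biUnion_le size (countable_chosenLevel A B Z n) _).trans
    (tsum_size_chosenLevel_le hA hB hφ hQ n)

end BettingGame

namespace BettingGame

open PartitionRefinement BettingStrategy Restriction

/-! ### The set of sequences on which a strategy stays below `2` -/

section Capital

variable {A : BettingStrategy} {t t' : ℕ} {x y : List Bool} {σ τ : Seq}

theorem isOpen_mem (A : BettingStrategy) (t : ℕ) (x : List Bool) : IsOpen {σ | A.Mem t x σ} := by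
  by_cases hx : A.part t x = none
  · have : {σ | A.Mem t x σ} = ∅ := Set.eq_empty_of_forall_notMem fun σ h => h.defined hx
    exact this ▸ isOpen_empty
  · obtain ⟨v, hv⟩ := Option.ne_none_iff_exists'.1 hx
    have : {σ | A.Mem t x σ} = v := Set.ext fun σ => mem_iff hv
    exact this ▸ (A.clopen t x v hv).2

/-- The capital is at least `2` at some coordinate that continues `x` and contains `σ`. -/
def RichAfter (A : BettingStrategy) (t : ℕ) (x : List Bool) (σ : Seq) : Prop :=
  ∃ y, x <+: y ∧ A.Mem t y σ ∧ 2 ≤ A.capital t y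

theorem achievesBelow_two_iff : A.AchievesBelow 2 σ ↔ ∀ t, ¬ RichAfter A t [] σ := by
  rw [achievesBelow_iff]
  constructor
  · rintro h t ⟨y, -, hy, hc⟩
    obtain ⟨x, hx, hm⟩ := A.exists_terminal t σ
    exact (h t x hx hm).not_ge (le_maxCapital_iff.2 ⟨y, hy.prefix_terminal hx hm, hc⟩)
  · intro h t x hx hm
    rw [← not_le, le_maxCapital_iff]
    rintro ⟨y, hy, hc⟩
    exact h t ⟨y, List.nil_prefix, hm.of_prefix hy, hc⟩

/-- Kolmogorov's inequality, by induction towards the root: a part with capital at least 2 has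
measure at most half of its mass, and in any other part the bounds of the two children add up. -/
theorem size_richAfter_le (t : ℕ) (x : List Bool) (hx : A.part t x ≠ none) :
    size {σ | RichAfter A t x σ} ≤ ENNReal.ofReal (A.mass x / 2) := by
  have hbig : ∀ x, A.part t x ≠ none → 2 ≤ A.capital t x →
      size {σ | RichAfter A t x σ} ≤ ENNReal.ofReal (A.mass x / 2) := by
    intro x hx hc
    obtain ⟨v, hv⟩ := Option.ne_none_iff_exists'.1 hx
    have hsub : {σ | RichAfter A t x σ} ⊆ v := by
      rintro σ ⟨y, hy, hm, -⟩
      exact (mem_iff hv).1 (hm.of_prefix hy)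
    refine (measure_mono hsub).trans ?_
    rw [← ENNReal.ofReal_toReal (measure_ne_top size v)]
    refine ENNReal.ofReal_le_ofReal ?_
    rw [capital, hv, Option.getD_some] at hc
    -- On a part of measure 0 the capital is a division by 0, with value 0, which is not at least 2.
    rcases (ENNReal.toReal_nonneg (a := size v)).eq_or_lt with h0 | h0
    · rw [← h0, div_zero] at hc
      norm_num at hc
    · rw [le_div_iff₀ h0] at hc
      linarith
  refine tree_induction (S := A.toPartitionRefinement)
    (p := fun x => size {σ | RichAfter A t x σ} ≤ ENNReal.ofReal (A.mass x / 2)) t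
    (fun x hx => ?_) (fun x hx hc h0 h1 => ?_) x hx
  · by_cases hcap : 2 ≤ A.capital t x
    · exact hbig x hx.1 hcap
    · have : {σ | RichAfter A t x σ} = ∅ := by
        refine Set.eq_empty_of_forall_notMem ?_
        rintro σ ⟨y, hy, hm, hy2⟩
        have := hx.prefix_of_comparable hm.defined (Or.inl hy)
        rw [this.eq_of_length (le_antisymm this.length_le hy.length_le)] at hy2
        exact hcap hy2
      simp [this]
  · by_cases hcap : 2 ≤ A.capital t x
    · exact hbig x hx hcap
    · have hsub : {σ | RichAfter A t x σ} ⊆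
          {σ | RichAfter A t (x ++ [false]) σ} ∪ {σ | RichAfter A t (x ++ [true]) σ} := by
        rintro σ ⟨y, ⟨l, rfl⟩, hm, hy2⟩
        obtain _ | ⟨b, l⟩ := l
        · exact absurd (by simpa using hy2) hcap
        · cases b
          · exact Or.inl ⟨_, ⟨l, by simp⟩, hm, hy2⟩
          · exact Or.inr ⟨_, ⟨l, by simp⟩, hm, hy2⟩
      refine (measure_mono hsub).trans ((measure_union_le _ _).trans
        ((add_le_add h0 h1).trans_eq ?_))
      rw [← ENNReal.ofReal_add (by linarith [A.mass_nonneg (x ++ [false])])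
        (by linarith [A.mass_nonneg (x ++ [true])]), A.mass_add x]
      congr 1
      ring

theorem RichAfter.mono (h : RichAfter A t [] σ) (ht : t ≤ t') : RichAfter A t' [] σ := by
  obtain ⟨y, hy, hm, hc⟩ := h
  exact ⟨y, hy, hm.mono ht, by rwa [← capital_congr hm.defined (hm.mono ht).defined]⟩

theorem compl_achievesBelow :
    {σ | A.AchievesBelow 2 σ}ᶜ = ⋃ t, {σ | RichAfter A t [] σ} := by
  ext σ
  simp [achievesBelow_two_iff]

theorem isClosed_achievesBelow (A : BettingStrategy) : IsClosed {σ | A.AchievesBelow 2 σ} := by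
  rw [← isOpen_compl_iff, compl_achievesBelow]
  refine isOpen_iUnion fun t => ?_
  have : {σ | RichAfter A t [] σ} = ⋃ y, ⋃ (_ : 2 ≤ A.capital t y), {σ | A.Mem t y σ} := by
    ext σ
    simp [RichAfter, and_comm]
  rw [this]
  exact isOpen_iUnion fun y => isOpen_iUnion fun _ => isOpen_mem A t y

theorem size_compl_achievesBelow_le (A : BettingStrategy) :
    size {σ | A.AchievesBelow 2 σ}ᶜ ≤ ENNReal.ofReal (A.mass [] / 2) := by
  have hmono : Monotone fun t => {σ | RichAfter A t [] σ} := fun t t' ht σ h =>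
    RichAfter.mono h ht
  rw [compl_achievesBelow, hmono.measure_iUnion]
  refine iSup_le fun t => size_richAfter_le t [] ?_
  rw [nil_defined]
  simp

end Capital

/-! ### Sequences in small parts -/

section Small

variable {A : BettingStrategy} {I : Finset ℕ} {N φ t t' : ℕ} {x y : List Bool} {σ τ ρ : Seq}

/-- The terminal part of `σ` at `t` was split at most `N` times on the fibre of `σ` and has at
most `φ` elements in this fibre. -/
def InSmallPart (A : BettingStrategy) (I : Finset ℕ) (N φ t : ℕ) (σ : Seq) : Prop :=
  ∃ x, A.IsTerminal t x ∧ A.Mem t x σ ∧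
    (A.proj (Subtype.val : fib I σ → Seq) x).length ≤ N ∧
    {τ ∈ fib I σ | A.Mem t x τ}.ncard ≤ φ

/-- A Kraft inequality: the count below `x` is weighted by `2` to the number of splits on the fibre
that lead to `x`. A split on the fibre doubles the weight, so the bounds of the children average
out; at any other split only one child meets the fibre. -/
theorem ncard_small_le (ρ : Seq) (t : ℕ) :
    {τ ∈ fib I ρ | InSmallPart A I N φ t τ}.ncard ≤ 2 ^ N * φ := by
  set g : fib I ρ → Seq := Subtype.val with hg
  have key : ∀ x, A.part t x ≠ none →
      {τ ∈ fib I ρ | A.Mem t x τ ∧ InSmallPart A I N φ t τ}.ncard * 2 ^ (A.proj g x).length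
        ≤ 2 ^ N * φ := by
    refine tree_induction (S := A.toPartitionRefinement) t (fun x hx => ?_)
      fun x hx hc h0 h1 => ?_
    · by_cases hne : {τ ∈ fib I ρ | A.Mem t x τ ∧ InSmallPart A I N φ t τ}.Nonempty
      · obtain ⟨τ, hτ, hm, x', hx', hm', hN, hφ⟩ := hne
        obtain rfl := hm'.terminal_unique hx' hm hx
        rw [fib_eq hτ] at hN hφ
        rw [mul_comm]
        refine Nat.mul_le_mul (Nat.pow_le_pow_right two_pos hN) (le_trans ?_ hφ)
        refine Set.ncard_le_ncard (fun σ hσ => ⟨hσ.1, hσ.2.1⟩) ?_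
        exact (finite_fib I ρ).subset fun σ hσ => hσ.1
      · rw [Set.not_nonempty_iff_eq_empty.1 hne]
        simp
    · have hchild := (children (hc false)).2.2.2.1
      have hle : {τ ∈ fib I ρ | A.Mem t x τ ∧ InSmallPart A I N φ t τ}.ncard ≤
          {τ ∈ fib I ρ | A.Mem t (x ++ [false]) τ ∧ InSmallPart A I N φ t τ}.ncard +
          {τ ∈ fib I ρ | A.Mem t (x ++ [true]) τ ∧ InSmallPart A I N φ t τ}.ncard := by
        refine le_trans (Set.ncard_le_ncard ?_ ?_) (Set.ncard_union_le _ _)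
        · rintro τ ⟨hτ, hm, hs⟩
          exact ((hchild τ).1 hm).imp (fun h => ⟨hτ, h, hs⟩) fun h => ⟨hτ, h, hs⟩
        · exact ((finite_fib I ρ).subset fun σ hσ => hσ.1).union
            ((finite_fib I ρ).subset fun σ hσ => hσ.1)
      by_cases hs : A.Splits g x
      · rw [proj_append_of_splits hs, List.length_append, List.length_singleton, pow_succ] at h0 h1
        have := Nat.mul_le_mul_right (2 ^ (A.proj g x).length) hle
        rw [add_mul] at this
        nlinarith
      · rw [proj_append_of_not_splits hs] at h0 h1
        have hempty : ∀ b, ¬ A.Meets g t (x ++ [b]) →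
            {τ ∈ fib I ρ | A.Mem t (x ++ [b]) τ ∧ InSmallPart A I N φ t τ} = ∅ := fun b hb =>
          Set.eq_empty_of_forall_notMem fun τ hτ => hb ⟨⟨τ, hτ.1⟩, hτ.2.1⟩
        by_cases hm : A.Meets g t (x ++ [false])
        · have hm' : ¬ A.Meets g t (x ++ [true]) := fun h => hs ⟨t, hm, h⟩
          rw [hempty true hm', Set.ncard_empty, add_zero] at hle
          exact (Nat.mul_le_mul_right _ hle).trans h0
        · rw [hempty false hm, Set.ncard_empty, zero_add] at hle
          exact (Nat.mul_le_mul_right _ hle).trans h1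
  simpa [mem_nil] using key [] (by rw [nil_defined]; simp)

/-- The numbers of splits and of heads are determined by the tail on the inspected positions, which
`σ` and `τ` share. Measurability follows. -/
theorem inSmallPart_congr (hσ : Set.EqOn σ τ (↑I ∪ A.inspected t))
    (h : InSmallPart A I N φ t σ) : InSmallPart A I N φ t τ := by
  obtain ⟨x, hx, hm, hN, hφ⟩ := h
  set r := ofSeq σ (A.inspected t \ ↑I) with hrdef
  have hr : Disjoint r.dom (↑I : Set ℕ) := by
    rw [hrdef, dom_ofSeq]
    exact Set.disjoint_sdiff_left
  have hK : A.inspected t ⊆ ↑I ∪ r.dom := by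
    rw [hrdef, dom_ofSeq, Set.union_sdiff_self]
    exact Set.subset_union_right
  have hσr : σ ∈ r.cyl := mem_cyl_ofSeq.2 fun _ _ => rfl
  have hτr : τ ∈ r.cyl := mem_cyl_ofSeq.2 (hσ.symm.mono fun p hp => Or.inr hp.1)
  obtain ⟨v, hv, -⟩ := id hm
  refine ⟨x, hx, (mem_congr_of_eqOn Set.subset_union_right hσ).1 hm, ?_, ?_⟩
  · rwa [← splitsOn_eq hr hK hτr hx.1, splitsOn_eq hr hK hσr hx.1]
  · rwa [← ncard_heads hr hK hτr hv, ncard_heads hr hK hσr hv]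

/-- Every fibre has at most `2 ^ N * φ` such elements out of `2 ^ |I|`, and by (III) this is a
fraction of at most `2^-k`. -/
theorem size_inSmallPart_le {k : ℕ} (hφ : 0 < φ)
    (hN : (N : ℝ) ≤ (I.card : ℝ) - Real.logb 2 φ - k) (t : ℕ) :
    size {σ | InSmallPart A I N φ t σ} ≤ (2⁻¹ : ℝ≥0∞) ^ k := by
  have hmeas : MeasurableSet {σ | InSmallPart A I N φ t σ} :=
    measurableSet_of_dependsOn ((Finset.finite_toSet I).union (A.finite_inspected t))
      fun σ τ h => inSmallPart_congr h
  have h1 : 2 ^ I.card * size {σ | InSmallPart A I N φ t σ} ≤ ((2 ^ N * φ : ℕ) : ℝ≥0∞) := by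
    rw [← lintegral_ncard_fib I hmeas]
    refine (lintegral_mono fun ρ => Nat.cast_le.2 (ncard_small_le (A := A) (N := N) (φ := φ)
      ρ t)).trans_eq ?_
    simp
  have h2 : ((2 ^ N * φ : ℕ) : ℝ) ≤ 2 ^ I.card * (2⁻¹) ^ k := by
    have hφ' : (0 : ℝ) < φ := by exact_mod_cast hφ
    have e : (φ : ℝ) = (2 : ℝ) ^ Real.logb 2 φ := (Real.rpow_logb two_pos (by norm_num) hφ').symm
    push_cast
    rw [inv_pow, ← div_eq_mul_inv]
    calc (2 : ℝ) ^ N * φ = (2 : ℝ) ^ ((N : ℝ) + Real.logb 2 φ) := by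
          rw [Real.rpow_add two_pos, ← e, Real.rpow_natCast]
      _ ≤ (2 : ℝ) ^ ((I.card : ℝ) - k) :=
          Real.rpow_le_rpow_of_exponent_le one_le_two (by linarith)
      _ = 2 ^ I.card / 2 ^ k := by
          rw [Real.rpow_sub two_pos, Real.rpow_natCast, Real.rpow_natCast]
  have h3 : ((2 ^ N * φ : ℕ) : ℝ≥0∞) ≤ 2 ^ I.card * (2⁻¹ : ℝ≥0∞) ^ k := by
    have := ENNReal.ofReal_le_ofReal h2
    rw [ENNReal.ofReal_natCast, ENNReal.ofReal_mul (by positivity),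
      ENNReal.ofReal_pow (by norm_num), ENNReal.ofReal_pow (by norm_num),
      ENNReal.ofReal_inv_of_pos (by norm_num)] at this
    simpa using this
  exact (ENNReal.mul_le_mul_iff_right (by simp) (by finiteness)).1 (h1.trans h3)

theorem length_proj_le_of_not_violates (h : ¬ A.Violates I N σ) (hm : A.Mem t x σ) :
    (A.proj (Subtype.val : fib I σ → Seq) x).length ≤ N := by
  have hdom : (outside I σ).dom = (↑I : Set ℕ)ᶜ := by
    ext p
    by_cases hp : p ∈ I <;> simp [outside, dom, hp]
  have hr : Disjoint (outside I σ).dom (↑I : Set ℕ) := by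
    rw [hdom]
    exact disjoint_compl_left
  have hK : A.inspected t ⊆ ↑I ∪ (outside I σ).dom := by
    rw [hdom, Set.union_compl_self]
    exact Set.subset_univ _
  have hσ : σ ∈ (outside I σ).cyl := by
    intro p b hb
    by_cases hp : p ∈ I <;> simp_all [outside]
  obtain ⟨v, hv, hσv⟩ := id hm
  rw [← splitsOn_eq hr hK hσ hm.defined]
  by_contra hc
  exact h ⟨t, x, v, hv, hσv, not_le.1 hc⟩

/-- Sequences without too many splits that are at some time in a small part. -/
def EverSmall (A : BettingStrategy) (I : Finset ℕ) (N φ : ℕ) (σ : Seq) : Prop :=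
  ¬ A.Violates I N σ ∧ ∃ t, InSmallPart A I N φ t σ

/-- Later parts are subsets, so a sequence without too many splits stays in small parts once it is
in one. The bound for a single time thus passes to an increasing union. -/
theorem size_everSmall_le {k : ℕ} (hφ : 0 < φ)
    (hN : (N : ℝ) ≤ (I.card : ℝ) - Real.logb 2 φ - k) :
    size {σ | EverSmall A I N φ σ} ≤ (2⁻¹ : ℝ≥0∞) ^ k := by
  have hsub : {σ | EverSmall A I N φ σ} ⊆ ⋃ T, ⋂ t ≥ T, {σ | InSmallPart A I N φ t σ} := by
    rintro σ ⟨hv, T, x, hx, hm, -, hφ⟩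
    refine Set.mem_iUnion.2 ⟨T, Set.mem_iInter₂.2 fun t ht => ?_⟩
    obtain ⟨x', hx', hm'⟩ := A.exists_terminal t σ
    refine ⟨x', hx', hm', length_proj_le_of_not_violates hv hm', le_trans ?_ hφ⟩
    have hp : x <+: x' := (hm.mono ht).prefix_terminal hx' hm'
    refine Set.ncard_le_ncard (fun τ hτ => ⟨hτ.1, ?_⟩)
      ((finite_fib I σ).subset fun τ hτ => hτ.1)
    exact (mem_congr (hm.mono ht).defined hm.defined).1 (hτ.2.of_prefix hp)
  refine (measure_mono hsub).trans ?_
  rw [Monotone.measure_iUnion]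
  · refine iSup_le fun T => ?_
    refine (measure_mono (Set.iInter₂_subset T le_rfl)).trans (size_inSmallPart_le hφ hN T)
  · intro T T' hT σ hσ
    simp only [Set.mem_iInter] at hσ ⊢
    exact fun t ht => hσ t (hT.trans ht)

end Small

/-! ### The game is never stuck outside a small set -/

variable {A B : BettingStrategy} {I : Finset ℕ} {M N φ : ℕ} {σ ρ : Seq}

theorem FullLexLT.trans {σ τ υ : Seq} (h : FullLexLT I σ τ) (h' : FullLexLT I τ υ) :
    FullLexLT I σ υ := by
  obtain ⟨p, hp, h1, h2, h3⟩ := h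
  obtain ⟨q, hq, h1', h2', h3'⟩ := h'
  rcases lt_trichotomy p q with hpq | rfl | hpq
  · refine ⟨p, hp, h1, by rw [← h3' p hp hpq, h2], fun k hk hkp => ?_⟩
    rw [h3 k hk hkp, h3' k hk (hkp.trans hpq)]
  · rw [h2] at h1'
    exact absurd h1' (by simp)
  · refine ⟨q, hq, by rw [h3 q hq hpq, h1'], h2', fun k hk hkq => ?_⟩
    rw [h3 k hk (hkq.trans hpq), h3' k hk hkq]

theorem FullLexLT.irrefl (σ : Seq) : ¬ FullLexLT I σ σ := by
  rintro ⟨p, -, h1, h2, -⟩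
  rw [h1] at h2
  exact absurd h2 (by simp)

theorem exists_fullLeastGood {t : ℕ} (hσ : σ ∈ fib I ρ) (hA : A.FullGood (fib I ρ) M φ σ t)
    (hB : B.FullGood (fib I ρ) M φ σ t) : ∃ τ, FullLeastGood A B I (fib I ρ) M φ τ t := by
  let r : fib I ρ → fib I ρ → Prop := fun a b => FullLexLT I a b
  have : IsTrans _ r := ⟨fun _ _ _ h h' => FullLexLT.trans h h'⟩
  have : Std.Irrefl r := ⟨fun a => FullLexLT.irrefl a.1⟩
  have hw : WellFounded r := Finite.wellFounded_of_trans_of_irrefl r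
  obtain ⟨a, ⟨h1, h2⟩, h3⟩ := hw.has_min
    {a : fib I ρ | A.FullGood (fib I ρ) M φ a t ∧ B.FullGood (fib I ρ) M φ a t} ⟨⟨σ, hσ⟩, hA, hB⟩
  exact ⟨a, a.2, h1, h2, fun τ hτ h h' => h3 ⟨τ, hτ⟩ ⟨h, h'⟩⟩

/-- Since `σ` itself is always good, there is always something to choose. If every choice became
stale, the game would outlast the bound `q`. -/
theorem exists_last_reach (hA : A.mass [] < 2) (hB : B.mass [] < 2) (hM : 0 < M)
    (hφ : φ < 2 ^ I.card) {q : ℝ} (hq : IsLengthBound I.card M φ q)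
    (hgA : ∀ t, A.FullGood (fib I σ) M φ σ t) (hgB : ∀ t, B.FullGood (fib I σ) M φ σ t) :
    ∃ j τ t, Reach A B I (fib I σ) M φ j τ t ∧
      ∀ t' > t, ¬ (A.FullEvent (fib I σ) τ t' ∨ B.FullEvent (fib I σ) τ t') := by
  by_contra! hc
  have hall : ∀ j, ∃ τ t, Reach A B I (fib I σ) M φ j τ t := by
    intro j
    induction j with
    | zero =>
      refine ⟨fun p => if p ∈ I then false else σ p, 0, .start _ (fun p hp => ?_) fun p hp => ?_⟩
      · have : p ∉ I := hp
        simp [this]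
      · simp [hp]
    | succ j ih =>
      obtain ⟨τ, t, h⟩ := ih
      have hex := hc j τ t h
      classical
      obtain ⟨h1, h2⟩ := Nat.find_spec hex
      have h3 : FullStale A B (fib I σ) τ t (Nat.find hex) :=
        ⟨h1, h2, fun t'' ht ht' he => Nat.find_min hex ht' ⟨ht, he⟩⟩
      obtain ⟨τ', hτ'⟩ := exists_fullLeastGood (self_mem_fib I σ) (hgA (Nat.find hex))
        (hgB (Nat.find hex))
      exact ⟨τ', _, .next j τ τ' t _ h h3 hτ'⟩
  obtain ⟨τ, t, h⟩ := hall ⌈q⌉₊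
  have h1 := h.succ_le hA hB hM hφ hq
  have h2 := Nat.le_ceil q
  linarith

/-- Not violating the bound allows exactly `N` splits, and goodness demands strictly fewer splits
than its parameter; hence `N + 1`. -/
theorem fullGood_of_not_small {t : ℕ} (hP : A.AchievesBelow 2 σ) (hv : ¬ A.Violates I N σ)
    (hs : ¬ EverSmall A I N φ σ) : A.FullGood (fib I σ) (N + 1) φ σ t := by
  obtain ⟨x, hx, hm⟩ := A.exists_terminal t σ
  have hN := length_proj_le_of_not_violates hv hm
  refine ⟨x, hx, hm, Nat.lt_succ_of_le hN, ?_, achievesBelow_iff.1 hP t x hx hm⟩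
  by_contra hc
  exact hs ⟨hv, t, x, hx, hm, hN, not_lt.1 hc⟩

/-- After `t` a capital of 2 would be an event; before `t` it would persist until `t`, against
goodness. -/
theorem achievesBelow_of_last {F : Set Seq} {τ : Seq} {t : ℕ} (hg : A.FullGood F M φ τ t)
    (hlast : ∀ t' > t, ¬ A.FullEvent F τ t') : A.AchievesBelow 2 τ := by
  rw [achievesBelow_iff]
  intro t' x hx hm
  by_contra hc
  rw [not_lt] at hc
  rcases lt_or_ge t t' with ht | ht
  · exact hlast t' ht (Or.inr ⟨x, hx, hm, hc⟩)
  · obtain ⟨y, hy, hym, -, -, hlt⟩ := hg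
    exact hlt.not_ge (maxCapital_mono_prefix 2 t x y ((hm.mono ht).prefix_terminal hy hym)
      (maxCapital_mono_time 2 t' t x hx.1 ht hc))

/-- The sequences on which both strategies stay below `2`. -/
def bothBelow (A B : BettingStrategy) : Set Seq :=
  {σ | A.AchievesBelow 2 σ} ∩ {σ | B.AchievesBelow 2 σ}

theorem isClosed_bothBelow (A B : BettingStrategy) : IsClosed (bothBelow A B) :=
  (isClosed_achievesBelow A).inter (isClosed_achievesBelow B)

/-- The two strategies reach 2 with probabilities that add up to at most half the total mass, that
is, to at most 1/2. -/
theorem size_bothBelow_pos (hmass : A.mass [] + B.mass [] = 1) : 0 < size (bothBelow A B) := by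
  have h1 : size (bothBelow A B)ᶜ ≤ ENNReal.ofReal (1 / 2) := by
    rw [bothBelow, Set.compl_inter]
    refine (measure_union_le _ _).trans ((add_le_add (size_compl_achievesBelow_le A)
      (size_compl_achievesBelow_le B)).trans_eq ?_)
    rw [← ENNReal.ofReal_add (by linarith [A.mass_nonneg []]) (by linarith [B.mass_nonneg []])]
    congr 1
    linarith
  rw [pos_iff_ne_zero]
  intro h0
  have h2 := (prob_compl_eq_one_iff (isClosed_bothBelow A B).measurableSet).2 h0
  rw [h2] at h1
  have : ENNReal.ofReal (1 / 2) < 1 := by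
    rw [← ENNReal.ofReal_one]
    exact (ENNReal.ofReal_lt_ofReal_iff one_pos).2 (by norm_num)
  exact this.not_ge h1

variable {Z : ℕ → Zone} {z : Restriction}

theorem eventually_disjoint (hZ : IsGameZones Z) {S : Set ℕ} (hS : S.Finite) :
    ∀ᶠ i in atTop, Disjoint S (↑(Z i).I : Set ℕ) := by
  rw [← Nat.cofinite_eq_atTop, Filter.eventually_cofinite]
  have hsub : {i | ¬ Disjoint S (↑(Z i).I : Set ℕ)} ⊆ ⋃ p ∈ S, {i | p ∈ (Z i).I} := by
    intro i hi
    obtain ⟨p, hp, hpi⟩ := Set.not_disjoint_iff.1 hi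
    exact Set.mem_biUnion hp hpi
  refine (hS.biUnion fun p _ => Set.Subsingleton.finite fun i hi j hj => ?_).subset hsub
  by_contra hij
  exact Finset.disjoint_left.1 (hZ hij) hi hj

/-- The game maps almost every part of `P ∩ [z]` back into `P`, inside chosen restrictions, by
flipping bits in `I`. Positive measure cannot vanish under countably many measure-preserving flips.
-/
theorem exists_next_level (hmass : A.mass [] + B.mass [] = 1) (hZ : IsGameZones Z)
    (hφ : ∀ i, 0 < (Z i).φ)
    (hφ' : ∀ i, (Z i).φ < 2 ^ (Z i).I.card)
    (hQ : ∀ i, ∃ q, IsLengthBound (Z i).I.card ((Z i).N + 1) (Z i).φ q)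
    (hε : Tendsto (fun i => size (violating A B (Z i))) atTop (𝓝 0))
    (hN : ∀ i, ((Z i).N : ℝ) ≤ ((Z i).I.card : ℝ) - Real.logb 2 (Z i).φ - ((i : ℝ) + 1))
    {n : ℕ} (hz : z ∈ chosenLevel A B Z n) (hpos : 0 < size (bothBelow A B ∩ z.cyl)) :
    ∃ c ∈ chosenLevel A B Z (n + 1), c.cyl ⊆ z.cyl ∧ 0 < size (bothBelow A B ∩ c.cyl) := by
  have hA : A.mass [] < 2 := by linarith [B.mass_nonneg []]
  have hB : B.mass [] < 2 := by linarith [A.mass_nonneg []]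
  have hlim : Tendsto (fun i => size (violating A B (Z i)) +
      ((2⁻¹ : ℝ≥0∞) ^ (i + 1) + (2⁻¹ : ℝ≥0∞) ^ (i + 1))) atTop (𝓝 0) := by
    have hp : Tendsto (fun i : ℕ => (2⁻¹ : ℝ≥0∞) ^ (i + 1)) atTop (𝓝 0) :=
      (ENNReal.tendsto_pow_atTop_nhds_zero_of_lt_one (by norm_num)).comp (tendsto_add_atTop_nat 1)
    simpa using hε.add (hp.add hp)
  -- The zone is so late that the exceptional sets together are smaller than `P ∩ [z]`; only
  -- finitely many zones meet the domain of `z`.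
  obtain ⟨i, hi, hd⟩ := ((hlim.eventually_lt_const hpos).and
    (eventually_disjoint hZ (finite_dom_of_mem_chosenLevel hz))).exists
  have hk : ((Z i).N : ℝ) ≤ ((Z i).I.card : ℝ) - Real.logb 2 (Z i).φ - ((i + 1 : ℕ) : ℝ) := by
    push_cast
    exact hN i
  set bad : Set Seq := violating A B (Z i) ∪
    ({σ | EverSmall A (Z i).I (Z i).N (Z i).φ σ} ∪
      {σ | EverSmall B (Z i).I (Z i).N (Z i).φ σ}) with hbad
  set C := chosenFrom A B (Z i).I ((Z i).N + 1) (Z i).φ z with hCdef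
  have hClevel : C ⊆ chosenLevel A B Z (n + 1) := by
    rintro c ⟨τ, hτ, j, t, h, rfl⟩
    exact mem_chosenLevel_succ.2 ⟨z, hz, i, hd, τ, hτ, j, t, h, rfl⟩
  have hCcount : C.Countable := (countable_chosenLevel A B Z (n + 1)).mono hClevel
  have hbadlt : size bad < size (bothBelow A B ∩ z.cyl) := by
    refine lt_of_le_of_lt ((measure_union_le _ _).trans (add_le_add_right
      ((measure_union_le _ _).trans (add_le_add ?_ ?_)) _)) hi
    · exact size_everSmall_le (hφ i) hk
    · exact size_everSmall_le (hφ i) hk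
  -- Outside the exceptional sets, the last choice in the fibre of `σ` is a flip of `σ` that lies in
  -- `P` and in a chosen restriction.
  have hcover : (bothBelow A B ∩ z.cyl) ⊆ bad ∪
      ⋃ c ∈ C, ⋃ F ∈ (Z i).I.powerset, flip F ⁻¹' (bothBelow A B ∩ c.cyl) := by
    rintro σ ⟨⟨hPA, hPB⟩, hσz⟩
    by_cases hσb : σ ∈ bad
    · exact Or.inl hσb
    · right
      simp only [hbad, violating, Set.mem_union, Set.mem_ofPred_eq, not_or] at hσb
      obtain ⟨⟨hvA, hvB⟩, hsA, hsB⟩ := hσb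
      obtain ⟨q, hq⟩ := hQ i
      obtain ⟨j, τ, t, hr, hlast⟩ := exists_last_reach hA hB (Nat.succ_pos _) (hφ' i) hq
        (fun t => fullGood_of_not_small hPA hvA hsA) fun t => fullGood_of_not_small hPB hvB hsB
      have hg := hr.fullGood hA hB (Nat.succ_pos _) (hφ' i)
      have hτ := hr.mem
      obtain ⟨F, hF, rfl⟩ := exists_flip_of_mem_fib hτ
      rw [← fib_eq hτ] at hr
      refine Set.mem_biUnion (x := ofSeq (flip F σ) _)
        ⟨flip F σ, fib_subset_cyl hd hσz hτ, j, t, hr, rfl⟩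
        (Set.mem_biUnion (Finset.mem_powerset.2 hF) ⟨⟨?_, ?_⟩, ?_⟩)
      · exact achievesBelow_of_last hg.1 fun t' ht h => hlast t' ht (Or.inl h)
      · exact achievesBelow_of_last hg.2 fun t' ht h => hlast t' ht (Or.inr h)
      · exact mem_cyl_ofSeq.2 fun _ _ => rfl
  by_contra! hc
  have hzero : size (⋃ c ∈ C, ⋃ F ∈ (Z i).I.powerset, flip F ⁻¹' (bothBelow A B ∩ c.cyl)) = 0 := by
    refine (measure_biUnion_null_iff hCcount).2 fun c hcC => ?_
    refine (measure_biUnion_null_iff (Finset.countable_toSet _)).2 fun F _ => ?_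
    rw [(measurePreserving_flip F).measure_preimage
      ((isClosed_bothBelow A B).inter (isClosed_cyl c)).measurableSet.nullMeasurableSet]
    exact le_antisymm (hc c (hClevel hcC) (cyl_subset_of_mem_chosenFrom hcC)) zero_le
  have := (measure_mono (μ := size) hcover).trans (measure_union_le _ _)
  rw [hzero, add_zero] at this
  exact hbadlt.not_ge this

/-- The sets `P ∩ [c]` along a chain of chosen restrictions are nested, nonempty and closed in a
compact space. -/
theorem exists_bothBelow_mem_chosenSet (hmass : A.mass [] + B.mass [] = 1) (hZ : IsGameZones Z)
    (hφ : ∀ i, 0 < (Z i).φ)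
    (hφ' : ∀ i, (Z i).φ < 2 ^ (Z i).I.card)
    (hQ : ∀ i, ∃ q, IsLengthBound (Z i).I.card ((Z i).N + 1) (Z i).φ q)
    (hε : Tendsto (fun i => size (violating A B (Z i))) atTop (𝓝 0))
    (hN : ∀ i, ((Z i).N : ℝ) ≤ ((Z i).I.card : ℝ) - Real.logb 2 (Z i).φ - ((i : ℝ) + 1)) :
    ∃ σ ∈ bothBelow A B, ∀ n, σ ∈ chosenSet A B Z n := by
  let T (n : ℕ) := {c : Restriction // c ∈ chosenLevel A B Z n ∧ 0 < size (bothBelow A B ∩ c.cyl)}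
  have h0 : 0 < size (bothBelow A B ∩ Restriction.empty.cyl) := by
    have : Restriction.empty.cyl = Set.univ := by
      ext σ
      simp [Restriction.empty, cyl]
    rw [this, Set.inter_univ]
    exact size_bothBelow_pos hmass
  have hnext : ∀ n (c : T n), ∃ c' : T (n + 1), c'.1.cyl ⊆ c.1.cyl := by
    rintro n ⟨c, hc, hpos⟩
    obtain ⟨c', h1, h2, h3⟩ := exists_next_level hmass hZ hφ hφ' hQ hε hN hc hpos
    exact ⟨⟨c', h1, h3⟩, h2⟩
  choose f hf using hnext
  let u : (n : ℕ) → T n := fun n => Nat.rec ⟨Restriction.empty, rfl, h0⟩ f n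
  obtain ⟨σ, hσ⟩ := IsCompact.nonempty_iInter_of_sequence_nonempty_isCompact_isClosed
    (fun n => bothBelow A B ∩ (u n).1.cyl)
    (fun n => Set.inter_subset_inter_right _ (hf n (u n)))
    (fun n => nonempty_of_measure_ne_zero (u n).2.2.ne')
    ((isClosed_bothBelow A B).inter (isClosed_cyl _)).isCompact
    (fun n => (isClosed_bothBelow A B).inter (isClosed_cyl _))
  rw [Set.mem_iInter] at hσ
  exact ⟨σ, (hσ 0).1, fun n => ⟨(u n).1, (u n).2.1, (hσ n).2⟩⟩

end BettingGame

namespace BettingGame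

open PartitionRefinement BettingStrategy Restriction

/-! ### Decision procedures for the game on sequences of finite support -/

/-- The sequence with prefix `w` followed by zeros. -/
def seqOf (w : List Bool) : Seq := fun p => w.getD p false

namespace Decide

/-! A function `g : ℕ × List Bool → Option (List (List Bool)) × ℕ × ℕ` is read as a betting
strategy: its values are codes of parts, together with a numerator and a denominator of the mass. -/

section Definitions

variable (g g' : ℕ × List Bool → Option (List (List Bool)) × ℕ × ℕ)

def memList (I : List ℕ) (p : ℕ) : Bool := I.any fun q => decide (q = p)

def inClopen (l : List (List Bool)) (w : List Bool) : Bool :=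
  l.any fun s => (List.range s.length).all fun k => w.getD k false == s.getD k false

/-- The total length of the strings in `l` bounds the length of each of them, so the clopen set is a
union of basic sets of strings of that length. -/
def clopenCard (l : List (List Bool)) : ℕ :=
  ((bitStrings l.flatten.length).filter fun u => inClopen l u).length

def coordinates (t : ℕ) : List (List Bool) := (List.range (t + 1)).flatMap fun k => bitStrings k

def heads (I : List ℕ) (w : List Bool) : List (List Bool) :=
  (bitStrings w.length).filter fun a => (List.range w.length).all fun p =>
    memList I p || a.getD p false == w.getD p false

def code (t : ℕ) (x : List Bool) : List (List Bool) := (g (t, x)).1.getD []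

def mem (t : ℕ) (x w : List Bool) : Bool := inClopen (code g t x) w

def terminal (t : ℕ) (x : List Bool) : Bool :=
  (g (t, x)).1.isSome && !(g (t, x ++ [false])).1.isSome

def splits (H : List (List Bool)) (t : ℕ) (x : List Bool) : Bool :=
  (H.any fun a => mem g t (x ++ [false]) a) && H.any fun a => mem g t (x ++ [true]) a

def splitCount (H : List (List Bool)) (t : ℕ) (x : List Bool) : ℕ :=
  ((List.range x.length).filter fun k => splits g H t (x.take k)).length

def headCount (H : List (List Bool)) (t : ℕ) (x : List Bool) : ℕ :=
  (H.filter fun a => mem g t x a).length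

/-- The inequality says that mass divided by measure is at least 2, with the denominators cleared.
-/
def rich (t : ℕ) (x : List Bool) : Bool :=
  (List.range (x.length + 1)).any fun k =>
    Nat.ble (2 * (g (t, x.take k)).2.2 * clopenCard (code g t (x.take k)))
      ((g (t, x.take k)).2.1 * 2 ^ (code g t (x.take k)).flatten.length)

def good (H : List (List Bool)) (M φ : ℕ) (w : List Bool) (t : ℕ) : Bool :=
  (coordinates t).any fun x => terminal g t x && (mem g t x w && (Nat.ble (splitCount g H t x + 1) M &&
    (Nat.ble (φ + 1) (headCount g H t x) && !rich g t x)))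

def event (H : List (List Bool)) (w : List Bool) (t : ℕ) : Bool :=
  ((coordinates t).any fun x => mem g t x w && ((Nat.ble 1 t && (terminal g (t - 1) x &&
    (g (t, x ++ [false])).1.isSome)) && splits g H t x)) ||
  (coordinates t).any fun x => terminal g t x && (mem g t x w && rich g t x)

def stale (H : List (List Bool)) (w : List Bool) (t t' : ℕ) : Bool :=
  Nat.ble (t + 1) t' && ((event g H w t' || event g' H w t') &&
    (List.range t').all fun u => !(Nat.ble (t + 1) u && (event g H w u || event g' H w u)))

def lexLT (I : List ℕ) (a b : List Bool) : Bool :=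
  I.any fun p => !a.getD p false && (b.getD p false &&
    I.all fun q => Nat.ble p q || a.getD q false == b.getD q false)

def leastGood (I : List ℕ) (H : List (List Bool)) (M φ : ℕ)
    (w : List Bool) (t : ℕ) : Bool :=
  (H.any fun a => decide (a = w)) && (good g H M φ w t && (good g' H M φ w t &&
    H.all fun a => !(good g H M φ a t && (good g' H M φ a t && lexLT I a w))))

/-- A play of the game is certified by the list `r` of its choices with their times. -/
def run (I : List ℕ) (H : List (List Bool)) (M φ : ℕ)
    (r : List (List Bool × ℕ)) : Bool :=
  ((H.any fun a => decide (a = (r.getD 0 ([], 0)).1)) &&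
    ((I.all fun p => !(r.getD 0 ([], 0)).1.getD p false) && decide ((r.getD 0 ([], 0)).2 = 0))) &&
  (List.range (r.length - 1)).all fun k =>
    stale g g' H (r.getD k ([], 0)).1 (r.getD k ([], 0)).2 (r.getD (k + 1) ([], 0)).2 &&
    leastGood g g' I H M φ (r.getD (k + 1) ([], 0)).1 (r.getD (k + 1) ([], 0)).2

/-- A sufficient condition for the first `n` bits to determine the parts at `t`; it holds for all
large `n`. -/
def bounded (n t : ℕ) : Bool :=
  (coordinates t).all fun x => (code g t x).all fun s => Nat.ble s.length n

def inspected (n t p : ℕ) : Bool :=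
  (bitStrings n).any fun u => (bitStrings n).any fun u' =>
    ((List.range n).all fun q => decide (q = p) || u.getD q false == u'.getD q false) &&
    (coordinates t).any fun x => mem g t x u && !mem g t x u'

def inPathDom (zI : ℕ → List ℕ) (n : ℕ) (l : List (ℕ × ℕ)) (p : ℕ) : Bool :=
  l.any fun it => memList (zI it.1) p || (inspected g n it.2 p || inspected g' n it.2 p)

def step (zI : ℕ → List ℕ) (zN zφ : ℕ → ℕ) (w : List Bool) (it : ℕ × ℕ)
    (l : List (ℕ × ℕ)) (r : List (List Bool × ℕ)) : Bool :=
  (bounded g w.length it.2 && (bounded g' w.length it.2 &&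
    (zI it.1).all fun p => Nat.ble (p + 1) w.length && !inPathDom g g' zI w.length l p)) &&
  (run g g' (zI it.1) (heads (zI it.1) w) (zN it.1 + 1) (zφ it.1) r &&
    decide (r.getD (r.length - 1) ([], 0) = (w, it.2)))

/-- Entry `k` of `rs` certifies the play behind choice `k` of `l`. The latest choice comes first, so
`l.drop (k + 1)` holds the earlier ones. -/
def path (zI : ℕ → List ℕ) (zN zφ : ℕ → ℕ) (w : List Bool)
    (l : List (ℕ × ℕ)) (rs : List (List (List Bool × ℕ))) : Bool :=
  (List.range l.length).all fun k =>
    step g g' zI zN zφ w (l.getD k (0, 0)) (l.drop (k + 1)) (rs.getD k [])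

end Definitions

section Computability

variable {α : Type*} [Primcodable α] {g g' : ℕ × List Bool → Option (List (List Bool)) × ℕ × ℕ}
  {zI : ℕ → List ℕ} {zN zφ : ℕ → ℕ}
  {I : α → List ℕ} {H c : α → List (List Bool)} {w w' x : α → List Bool}
  {t t' p M φ : α → ℕ} {r : α → List (List Bool × ℕ)} {l : α → List (ℕ × ℕ)} {it : α → ℕ × ℕ}
  {rs : α → List (List (List Bool × ℕ))}

@[fun_prop] theorem computable_memList (hI : Computable I) (hp : Computable p) :
    Computable fun a => memList (I a) (p a) := by
  unfold memList
  fun_prop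

@[fun_prop] theorem computable_inClopen (hc : Computable c) (hw : Computable w) :
    Computable fun a => inClopen (c a) (w a) := by
  unfold inClopen
  fun_prop

@[fun_prop] theorem computable_clopenCard (hc : Computable c) :
    Computable fun a => clopenCard (c a) := by
  unfold clopenCard
  fun_prop

@[fun_prop] theorem computable_coordinates (ht : Computable t) :
    Computable fun a => coordinates (t a) := by
  unfold coordinates
  fun_prop

@[fun_prop] theorem computable_heads (hI : Computable I) (hw : Computable w) :
    Computable fun a => heads (I a) (w a) := by
  unfold heads
  fun_prop

@[fun_prop] theorem computable_code (hg : Computable g) (ht : Computable t) (hx : Computable x) :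
    Computable fun a => code g (t a) (x a) := by
  unfold code
  fun_prop

@[fun_prop] theorem computable_mem (hg : Computable g) (ht : Computable t) (hx : Computable x)
    (hw : Computable w) : Computable fun a => mem g (t a) (x a) (w a) := by
  unfold mem
  fun_prop

@[fun_prop] theorem computable_terminal (hg : Computable g) (ht : Computable t)
    (hx : Computable x) : Computable fun a => terminal g (t a) (x a) := by
  unfold terminal
  fun_prop

@[fun_prop] theorem computable_splits (hg : Computable g) (hH : Computable H) (ht : Computable t)
    (hx : Computable x) : Computable fun a => splits g (H a) (t a) (x a) := by
  unfold splits
  fun_prop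

@[fun_prop] theorem computable_splitCount (hg : Computable g) (hH : Computable H)
    (ht : Computable t) (hx : Computable x) :
    Computable fun a => splitCount g (H a) (t a) (x a) := by
  unfold splitCount
  fun_prop

@[fun_prop] theorem computable_headCount (hg : Computable g) (hH : Computable H)
    (ht : Computable t) (hx : Computable x) :
    Computable fun a => headCount g (H a) (t a) (x a) := by
  unfold headCount
  fun_prop

@[fun_prop] theorem computable_rich (hg : Computable g) (ht : Computable t) (hx : Computable x) :
    Computable fun a => rich g (t a) (x a) := by
  unfold rich
  fun_prop

@[fun_prop] theorem computable_good (hg : Computable g) (hH : Computable H) (hM : Computable M)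
    (hφ : Computable φ) (hw : Computable w) (ht : Computable t) :
    Computable fun a => good g (H a) (M a) (φ a) (w a) (t a) := by
  unfold good
  fun_prop

@[fun_prop] theorem computable_event (hg : Computable g) (hH : Computable H) (hw : Computable w)
    (ht : Computable t) : Computable fun a => event g (H a) (w a) (t a) := by
  unfold event
  fun_prop

@[fun_prop] theorem computable_stale (hg : Computable g) (hg' : Computable g')
    (hH : Computable H) (hw : Computable w) (ht : Computable t) (ht' : Computable t') :
    Computable fun a => stale g g' (H a) (w a) (t a) (t' a) := by
  unfold stale
  fun_prop

@[fun_prop] theorem computable_lexLT (hI : Computable I) (hw : Computable w)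
    (hw' : Computable w') : Computable fun a => lexLT (I a) (w a) (w' a) := by
  unfold lexLT
  fun_prop

@[fun_prop] theorem computable_leastGood (hg : Computable g) (hg' : Computable g')
    (hI : Computable I) (hH : Computable H) (hM : Computable M) (hφ : Computable φ)
    (hw : Computable w) (ht : Computable t) :
    Computable fun a => leastGood g g' (I a) (H a) (M a) (φ a) (w a) (t a) := by
  unfold leastGood
  fun_prop

@[fun_prop] theorem computable_run (hg : Computable g) (hg' : Computable g')
    (hI : Computable I) (hH : Computable H) (hM : Computable M) (hφ : Computable φ)
    (hr : Computable r) : Computable fun a => run g g' (I a) (H a) (M a) (φ a) (r a) := by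
  unfold run
  fun_prop

@[fun_prop] theorem computable_bounded (hg : Computable g) (hp : Computable p)
    (ht : Computable t) : Computable fun a => bounded g (p a) (t a) := by
  unfold bounded
  fun_prop

@[fun_prop] theorem computable_inspected (hg : Computable g) (ht' : Computable t')
    (ht : Computable t) (hp : Computable p) :
    Computable fun a => inspected g (t' a) (t a) (p a) := by
  unfold inspected
  fun_prop

@[fun_prop] theorem computable_inPathDom (hg : Computable g) (hg' : Computable g')
    (hz : Computable zI) (ht : Computable t) (hl : Computable l) (hp : Computable p) :
    Computable fun a => inPathDom g g' zI (t a) (l a) (p a) := by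
  unfold inPathDom
  fun_prop

@[fun_prop] theorem computable_step (hg : Computable g) (hg' : Computable g')
    (hI : Computable zI) (hN : Computable zN) (hφ : Computable zφ) (hw : Computable w)
    (hit : Computable it) (hl : Computable l) (hr : Computable r) :
    Computable fun a => step g g' zI zN zφ (w a) (it a) (l a) (r a) := by
  unfold step
  fun_prop

@[fun_prop] theorem computable_path (hg : Computable g) (hg' : Computable g')
    (hI : Computable zI) (hN : Computable zN) (hφ : Computable zφ) (hw : Computable w)
    (hl : Computable l) (hrs : Computable rs) :
    Computable fun a => path g g' zI zN zφ (w a) (l a) (rs a) := by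
  unfold path
  fun_prop

end Computability

end Decide

end BettingGame

namespace BettingGame

open PartitionRefinement BettingStrategy Restriction

/-! ### Prefixes of sequences -/

/-- The prefix of length `n` of a sequence. -/
def pre (σ : Seq) (n : ℕ) : List Bool := (List.range n).map σ

@[simp] theorem length_pre (σ : Seq) (n : ℕ) : (pre σ n).length = n := by simp [pre]

theorem seqOf_pre_eqOn (σ : Seq) (n : ℕ) : Set.EqOn (seqOf (pre σ n)) σ (Set.Iio n) := by
  intro p hp
  have hp' : p < n := hp
  simp [seqOf, pre, hp']

theorem seqOf_of_le {w : List Bool} {p : ℕ} (h : w.length ≤ p) : seqOf w p = false := by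
  simp [seqOf, h]

theorem eq_of_eqOn_seqOf {u w : List Bool} (h : u.length = w.length)
    (he : Set.EqOn (seqOf u) (seqOf w) (Set.Iio w.length)) : u = w := by
  refine List.ext_getElem h fun k hk hk' => ?_
  have := he (show k ∈ Set.Iio w.length from hk')
  simpa [seqOf, hk, hk'] using this

theorem mem_basic_iff {σ : Seq} {u : List Bool} :
    σ ∈ basic u ↔ Set.EqOn σ (seqOf u) (Set.Iio u.length) := by
  constructor
  · intro h p hp
    have hp' : p < u.length := hp
    rw [h p hp']
    simp [seqOf, hp']
  · intro h k hk
    rw [h hk]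
    simp [seqOf, hk]

theorem mem_clopenOf_congr {l : List (List Bool)} {n : ℕ} {σ τ : Seq}
    (hn : ∀ s ∈ l, s.length ≤ n) (h : Set.EqOn σ τ (Set.Iio n)) (hσ : σ ∈ clopenOf l) :
    τ ∈ clopenOf l := by
  obtain ⟨s, hs, hσs⟩ := hσ
  refine ⟨s, hs, fun k hk => ?_⟩
  rw [← h (lt_of_lt_of_le hk (hn s hs)), hσs k hk]

theorem size_basic (u : List Bool) : size (basic u) = (2⁻¹ : ℝ≥0∞) ^ u.length := by
  have e : basic u = Set.pi ↑(Finset.range u.length) fun p => {seqOf u p} := by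
    ext σ
    rw [mem_basic_iff]
    simp [Set.pi, Set.EqOn]
  rw [e, size, Measure.infinitePi_pi _ fun p _ => measurableSet_singleton _]
  have : ∀ b : Bool, (PMF.uniformOfFintype Bool).toMeasure {b} = 2⁻¹ := fun b => by
    rw [PMF.toMeasure_apply_singleton _ _ (measurableSet_singleton _)]
    simp
  simp [this]

theorem measurableSet_basic (u : List Bool) : MeasurableSet (basic u) := by
  refine measurableSet_of_dependsOn (Set.finite_Iio u.length) fun σ τ h hσ => ?_
  rw [mem_basic_iff] at hσ ⊢
  exact h.symm.trans hσ

namespace Decide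

theorem mem_memList {I : List ℕ} {p : ℕ} : memList I p = true ↔ p ∈ I := by
  simp [memList]

theorem inClopen_iff {l : List (List Bool)} {w : List Bool} :
    inClopen l w = true ↔ seqOf w ∈ clopenOf l := by
  simp only [inClopen, List.any_eq_true, List.all_eq_true, List.mem_range, beq_iff_eq, clopenOf,
    Set.mem_ofPred_eq, basic]
  refine exists_congr fun s => and_congr_right fun _ => forall_congr' fun k =>
    forall_congr' fun hk => ?_
  simp [seqOf, hk]

theorem length_le_flatten {l : List (List Bool)} {s : List Bool} (hs : s ∈ l) :
    s.length ≤ l.flatten.length :=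
  (List.sublist_flatten_of_mem hs).length_le

theorem size_clopenOf (l : List (List Bool)) :
    (size (clopenOf l)).toReal = clopenCard l / 2 ^ l.flatten.length := by
  classical
  set n := l.flatten.length with hn
  have hl : ∀ s ∈ l, s.length ≤ n := fun s hs => length_le_flatten hs
  set U := ((bitStrings n).filter fun u => inClopen l u).toFinset with hU
  have hUn : ∀ u ∈ U, u.length = n := fun u hu => by
    simp only [hU, List.mem_toFinset, List.mem_filter, mem_bitStrings] at hu
    exact hu.1
  have e : clopenOf l = ⋃ u ∈ U, basic u := by
    ext σ
    simp only [hU, List.mem_toFinset, List.mem_filter, mem_bitStrings, Set.mem_iUnion, exists_prop,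
      inClopen_iff, mem_basic_iff]
    constructor
    · intro hσ
      have h1 := seqOf_pre_eqOn σ n
      refine ⟨pre σ n, ⟨length_pre σ n, mem_clopenOf_congr hl h1.symm hσ⟩, ?_⟩
      rw [length_pre]
      exact h1.symm
    · rintro ⟨u, ⟨hu, hm⟩, hσ⟩
      rw [hu] at hσ
      exact mem_clopenOf_congr hl hσ.symm hm
  have hd : Set.PairwiseDisjoint (↑U : Set (List Bool)) basic := by
    intro u hu v hv huv
    refine Set.disjoint_left.2 fun σ hσ hσ' => huv ?_
    rw [mem_basic_iff] at hσ hσ'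
    have hlen := (hUn u hu).trans (hUn v hv).symm
    rw [hlen] at hσ
    exact eq_of_eqOn_seqOf hlen (hσ.symm.trans hσ')
  rw [e, measure_biUnion_finset hd fun u _ => measurableSet_basic u]
  have : ∀ u ∈ U, size (basic u) = (2⁻¹ : ℝ≥0∞) ^ n := fun u hu => by
    rw [size_basic, hUn u hu]
  rw [Finset.sum_congr rfl this, Finset.sum_const, hU, List.toFinset_card_of_nodup
    ((nodup_bitStrings n).filter _), nsmul_eq_mul, ENNReal.toReal_mul, ENNReal.toReal_pow]
  simp [clopenCard, div_eq_mul_inv, ← hn]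

theorem mem_coordinates {t : ℕ} {x : List Bool} : x ∈ coordinates t ↔ x.length ≤ t := by
  simp [coordinates, mem_bitStrings]

/-! ### Correctness of the decision procedures -/

/-- `g` computes the parts and the masses of `A`. -/
structure Codes (A : BettingStrategy)
    (g : ℕ × List Bool → Option (List (List Bool)) × ℕ × ℕ) : Prop where
  part : ∀ t x, A.part t x = (g (t, x)).1.map clopenOf
  mass : ∀ t x, A.part t x ≠ none →
    0 < (g (t, x)).2.2 ∧ A.mass x = ((g (t, x)).2.1 : ℝ) / ((g (t, x)).2.2 : ℝ)

theorem exists_codes {A : BettingStrategy} (hA : A.IsComputable) :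
    ∃ g, Computable g ∧ Codes A g := by
  classical
  obtain ⟨⟨f, hf, hpart⟩, m, hm, hmass⟩ := hA
  have hdef : ∀ t x, A.part t x ≠ none ↔ (f t x).isSome = true := fun t x => by
    rw [hpart]
    cases f t x <;> simp
  -- The algorithm for the mass may diverge on coordinates that are never defined; it is consulted
  -- only after the part is seen to be defined, which makes `h` total.
  let h : ℕ × List Bool →. ℕ × ℕ := fun p => bif (f p.1 p.2).isSome then m p.2 else Part.some (0, 0)
  have hf' : Computable fun p : ℕ × List Bool => f p.1 p.2 := hf
  have hcomp : Partrec h := Partrec.cond (Computable.fun_isSome hf')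
    (hm.comp Computable.snd) (Computable.const (0, 0)).partrec
  have htot : ∀ p, (h p).Dom := by
    rintro ⟨t, x⟩
    by_cases hx : (f t x).isSome = true
    · obtain ⟨a, b, hab, -⟩ := hmass t x ((hdef t x).2 hx)
      simp only [h, hx, cond_true]
      exact (Part.mem_eq _ _ ▸ hab).1
    · simp only [h, hx, cond_false]
      trivial
  have hget : Computable fun p => (h p).get (htot p) :=
    hcomp.of_eq_tot fun p => Part.get_mem _
  refine ⟨fun p => (f p.1 p.2, (h p).get (htot p)), hf'.pair hget, hpart, fun t x hx => ?_⟩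
  obtain ⟨a, b, hab, hb, hq⟩ := hmass t x hx
  have : (a, b) ∈ h (t, x) := by
    simp only [h, (hdef t x).1 hx, cond_true]
    exact hab
  rw [Part.get_eq_of_mem this]
  exact ⟨hb, hq⟩

section Strategy

variable {A : BettingStrategy} {g : ℕ × List Bool → Option (List (List Bool)) × ℕ × ℕ}
  (hg : Codes A g) {t t' n M φ : ℕ} {x w : List Bool} {H : List (List Bool)} {F : Set Seq}

include hg

theorem part_isSome : (g (t, x)).1.isSome = true ↔ A.part t x ≠ none := by
  rw [hg.part]
  cases (g (t, x)).1 <;> simp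

theorem part_eq_code (h : A.part t x ≠ none) : A.part t x = some (clopenOf (code g t x)) := by
  rw [← part_isSome hg, Option.isSome_iff_exists] at h
  obtain ⟨l, hl⟩ := h
  simp [hg.part, code, hl]

theorem mem_spec : mem g t x w = true ↔ A.Mem t x (seqOf w) := by
  by_cases h : A.part t x = none
  · have h' : (g (t, x)).1 = none := by
      rw [hg.part] at h
      simpa using h
    simp [mem, code, h', inClopen, PartitionRefinement.Mem, h]
  · rw [mem, inClopen_iff, PartitionRefinement.mem_iff (part_eq_code hg h)]

theorem terminal_spec : terminal g t x = true ↔ A.IsTerminal t x := by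
  rw [isTerminal_iff, terminal, Bool.and_eq_true, part_isSome hg, Bool.not_eq_true',
    ← Bool.not_eq_true, part_isSome hg, not_not]

theorem two_le_capital_iff (h : A.part t x ≠ none) : 2 ≤ A.capital t x ↔
    2 * (g (t, x)).2.2 * clopenCard (code g t x) ≤
      (g (t, x)).2.1 * 2 ^ (code g t x).flatten.length := by
  obtain ⟨hb, hm⟩ := hg.mass t x h
  have hb' : (0 : ℝ) < (g (t, x)).2.2 := by exact_mod_cast hb
  have hp : (0 : ℝ) < 2 ^ (code g t x).flatten.length := by positivity
  -- A part is nonempty, so its measure is positive and the division can be cleared.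
  have hcard : (0 : ℝ) < clopenCard (code g t x) := by
    obtain ⟨σ, hσ⟩ := PartitionRefinement.exists_mem h
    rw [PartitionRefinement.mem_iff (part_eq_code hg h)] at hσ
    have h1 := seqOf_pre_eqOn σ (code g t x).flatten.length
    have : pre σ (code g t x).flatten.length ∈
        (bitStrings (code g t x).flatten.length).filter fun u => inClopen (code g t x) u := by
      rw [List.mem_filter, mem_bitStrings, inClopen_iff]
      exact ⟨length_pre _ _, mem_clopenOf_congr (fun s hs => length_le_flatten hs) h1.symm hσ⟩
    exact_mod_cast List.length_pos_of_mem this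
  rw [capital, part_eq_code hg h, Option.getD_some, size_clopenOf, hm, div_div_div_eq,
    le_div_iff₀ (by positivity), ← mul_assoc]
  exact_mod_cast Iff.rfl

theorem rich_spec (h : A.part t x ≠ none) : rich g t x = true ↔ 2 ≤ A.maxCapital t x := by
  rw [le_maxCapital_iff]
  simp only [rich, List.any_eq_true, List.mem_range, Nat.ble_eq]
  constructor
  · rintro ⟨k, -, hk⟩
    exact ⟨_, List.take_prefix k x, (two_le_capital_iff hg
      (defined_of_prefix h (List.take_prefix k x))).2 hk⟩
  · rintro ⟨y, hy, hc⟩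
    refine ⟨y.length, Nat.lt_succ_of_le hy.length_le, ?_⟩
    rw [← List.prefix_iff_eq_take.1 hy]
    exact (two_le_capital_iff hg (defined_of_prefix h hy)).1 hc

variable (hF : ∀ σ, σ ∈ F ↔ ∃ a ∈ H, seqOf a = σ)

include hF

/-- `Splits` allows any time, but parts never change once defined, so a time at which both children
are defined decides it. -/
theorem splits_spec (hd : ∀ b, A.part t (x ++ [b]) ≠ none) :
    splits g H t x = true ↔ A.Splits (Subtype.val : F → Seq) x := by
  have hmeets : ∀ y, (∃ a ∈ H, mem g t y a = true) ↔ A.Meets (Subtype.val : F → Seq) t y := by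
    intro y
    constructor
    · rintro ⟨a, ha, hm⟩
      exact ⟨⟨seqOf a, (hF _).2 ⟨a, ha, rfl⟩⟩, (mem_spec hg).1 hm⟩
    · rintro ⟨⟨σ, hσ⟩, hm⟩
      obtain ⟨a, ha, rfl⟩ := (hF σ).1 hσ
      exact ⟨a, ha, (mem_spec hg).2 hm⟩
  rw [splits, Bool.and_eq_true, List.any_eq_true, List.any_eq_true, hmeets, hmeets]
  exact ⟨fun h => ⟨t, h⟩, fun h => ⟨h.meets_child false (hd false) false,
    h.meets_child false (hd false) true⟩⟩

theorem splitCount_spec (h : A.part t x ≠ none) :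
    splitCount g H t x = (A.proj (Subtype.val : F → Seq) x).length := by
  classical
  rw [length_proj, splitCount, ← List.toFinset_card_of_nodup (List.nodup_range.filter _),
    ← Set.ncard_coe_finset]
  congr 1
  ext k
  simp only [List.coe_toFinset, List.mem_filter, List.mem_range, Set.mem_ofPred_eq]
  exact and_congr_right fun hk =>
    splits_spec hg hF fun b => children_defined_of_lt h hk b

variable (hlen : ∀ a ∈ H, a.length = n) (hnd : H.Nodup)

include hlen hnd

theorem headCount_spec : headCount g H t x = {σ ∈ F | A.Mem t x σ}.ncard := by
  classical
  rw [headCount, ← List.toFinset_card_of_nodup (hnd.filter _), ← Set.ncard_coe_finset]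
  have hinj : Set.InjOn seqOf ↑(H.filter fun a => mem g t x a).toFinset := by
    intro a ha b hb hab
    simp only [List.coe_toFinset, List.mem_filter, Set.mem_ofPred_eq] at ha hb
    exact eq_of_eqOn_seqOf ((hlen a ha.1).trans (hlen b hb.1).symm) fun p _ => congrFun hab p
  rw [← hinj.ncard_image]
  congr 1
  ext σ
  simp only [List.coe_toFinset, List.mem_filter, Set.mem_image, Set.mem_ofPred_eq]
  constructor
  · rintro ⟨a, ⟨ha, hm⟩, rfl⟩
    exact ⟨(hF _).2 ⟨a, ha, rfl⟩, (mem_spec hg).1 hm⟩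
  · rintro ⟨hσ, hm⟩
    obtain ⟨a, ha, rfl⟩ := (hF σ).1 hσ
    exact ⟨a, ⟨ha, (mem_spec hg).2 hm⟩, rfl⟩

theorem good_spec : good g H M φ w t = true ↔ A.FullGood F M φ (seqOf w) t := by
  simp only [good, List.any_eq_true, Bool.and_eq_true, Nat.ble_eq, Nat.succ_le_iff,
    Bool.not_eq_true', terminal_spec hg, mem_spec hg, headCount_spec hg hF hlen hnd,
    mem_coordinates]
  constructor
  · rintro ⟨x, -, hT, hm, hM, hφ, hr⟩
    rw [splitCount_spec hg hF hT.1] at hM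
    refine ⟨x, hT, hm, hM, hφ, ?_⟩
    rwa [← not_le, ← rich_spec hg hT.1, Bool.not_eq_true]
  · rintro ⟨x, hT, hm, hM, hφ, hr⟩
    refine ⟨x, PartitionRefinement.length_le hT.1, hT, hm, ?_, hφ, ?_⟩
    · rwa [splitCount_spec hg hF hT.1]
    · rwa [← not_le, ← rich_spec hg hT.1, Bool.not_eq_true] at hr

omit hlen hnd in
theorem event_spec : event g H w t = true ↔ A.FullEvent F (seqOf w) t := by
  simp only [event, List.any_eq_true, Bool.and_eq_true, Bool.or_eq_true, Nat.ble_eq,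
    terminal_spec hg, mem_spec hg, part_isSome hg, mem_coordinates]
  refine or_congr ⟨?_, ?_⟩ ⟨?_, ?_⟩
  · rintro ⟨x, -, hm, ⟨ht, hT, hc⟩, hs⟩
    have hc' : ∀ b, A.part t (x ++ [b]) ≠ none := child_defined hc
    exact ⟨x, hm, splitAt_iff.2 ⟨t - 1, by omega, hT, hc'⟩, (splits_spec hg hF hc').1 hs⟩
  · rintro ⟨x, hm, hS, hs⟩
    obtain ⟨t', rfl, hT, hc⟩ := splitAt_iff.1 hS
    exact ⟨x, PartitionRefinement.length_le hm.defined, hm, ⟨by omega, hT, hc false⟩,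
      (splits_spec hg hF hc).2 hs⟩
  · rintro ⟨x, -, hT, hm, hr⟩
    exact ⟨x, hT, hm, (rich_spec hg hT.1).1 hr⟩
  · rintro ⟨x, hT, hm, hr⟩
    exact ⟨x, PartitionRefinement.length_le hT.1, hT, hm, (rich_spec hg hT.1).2 hr⟩

omit hF hlen hnd

theorem bounded_spec (h : bounded g n t = true) : A.Determines t (Set.Iio n) := by
  simp only [bounded, List.all_eq_true, Nat.ble_eq] at h
  intro σ τ hστ x hx
  have hd := hx.defined
  rw [PartitionRefinement.mem_iff (part_eq_code hg hd)] at hx ⊢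
  exact mem_clopenOf_congr (h x (mem_coordinates.2 (PartitionRefinement.length_le hd))) hστ hx

theorem inspected_spec (h : bounded g n t = true) {p : ℕ} :
    inspected g n t p = true ↔ p ∈ A.inspected t := by
  have hdet := bounded_spec hg h
  simp only [inspected, List.any_eq_true, Bool.and_eq_true, List.all_eq_true, List.mem_range,
    Bool.or_eq_true, decide_eq_true_eq, beq_iff_eq, mem_spec hg, Bool.not_eq_true', mem_bitStrings,
    ← Bool.not_eq_true, mem_inspected_iff]
  constructor
  · rintro ⟨u, hu, u', hu', hq, x, -, h1, h2⟩
    refine ⟨seqOf u, seqOf u', fun q hqp => ?_, x, h1, h2⟩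
    rcases lt_or_ge q n with hqn | hqn
    · exact (hq q hqn).resolve_left hqp
    · rw [seqOf_of_le (by omega), seqOf_of_le (by omega)]
  · rintro ⟨σ, τ, hst, x, h1, h2⟩
    have hσ := seqOf_pre_eqOn σ n
    have hτ := seqOf_pre_eqOn τ n
    refine ⟨pre σ n, length_pre _ _, pre τ n, length_pre _ _, fun q hq => ?_, x,
      mem_coordinates.2 (PartitionRefinement.length_le h1.defined), hdet _ _ hσ.symm x h1,
      fun h => h2 (hdet _ _ hτ x h)⟩
    by_cases hqp : q = p
    · exact Or.inl hqp
    · exact Or.inr ((hσ hq).trans ((hst hqp).trans (hτ hq).symm))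

omit hg in
theorem exists_bounded (g : ℕ × List Bool → Option (List (List Bool)) × ℕ × ℕ) (t : ℕ) :
    ∃ n, ∀ m ≥ n, bounded g m t = true := by
  refine ⟨((coordinates t).map fun x => (code g t x).flatten.length).sum, fun m hm => ?_⟩
  simp only [bounded, List.all_eq_true, Nat.ble_eq]
  intro x hx s hs
  refine (length_le_flatten hs).trans (le_trans ?_ hm)
  exact List.le_sum_of_mem (List.mem_map.2 ⟨x, hx, rfl⟩)

end Strategy

end Decide

end BettingGame

namespace BettingGame

open PartitionRefinement BettingStrategy Restriction

namespace Decide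

/-! ### Fibres as finite lists of strings -/

section Heads

variable {I : List ℕ} {w a b : List Bool} {σ : Seq}

theorem mem_heads : a ∈ heads I w ↔
    a.length = w.length ∧ ∀ p < w.length, p ∈ I ∨ seqOf a p = seqOf w p := by
  simp [heads, mem_bitStrings, mem_memList, seqOf]

theorem nodup_heads (I : List ℕ) (w : List Bool) : (heads I w).Nodup :=
  (nodup_bitStrings _).filter _

/-- All of `I` lies within the length of `w`, so every element of the fibre continues with zeros
beyond it, as `seqOf` prescribes. -/
theorem mem_fib_iff_heads (hI : ∀ p ∈ I, p < w.length) :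
    σ ∈ fib I.toFinset (seqOf w) ↔ ∃ a ∈ heads I w, seqOf a = σ := by
  constructor
  · intro h
    have hσ := seqOf_pre_eqOn σ w.length
    have hout : ∀ p, p ∉ I → σ p = seqOf w p := fun p hp =>
      h (show p ∈ (↑I.toFinset : Set ℕ)ᶜ by simpa using hp)
    refine ⟨pre σ w.length, mem_heads.2 ⟨length_pre _ _, fun p hp => ?_⟩, funext fun p => ?_⟩
    · by_cases hpI : p ∈ I
      · exact Or.inl hpI
      · exact Or.inr ((hσ hp).trans (hout p hpI))
    · rcases lt_or_ge p w.length with hp | hp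
      · exact hσ hp
      · rw [seqOf_of_le (by simpa using hp), hout p fun hpI => (hI p hpI).not_ge hp,
          seqOf_of_le hp]
  · rintro ⟨a, ha, rfl⟩ p hp
    obtain ⟨hlen, ha⟩ := mem_heads.1 ha
    have hpI : p ∉ I := by simpa using hp
    rcases lt_or_ge p w.length with hpw | hpw
    · exact (ha p hpw).resolve_left hpI
    · rw [seqOf_of_le (hlen ▸ hpw), seqOf_of_le hpw]

theorem lexLT_spec : lexLT I a b = true ↔ FullLexLT I.toFinset (seqOf a) (seqOf b) := by
  simp only [lexLT, List.any_eq_true, Bool.and_eq_true, List.all_eq_true, Bool.or_eq_true,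
    Nat.ble_eq, Bool.not_eq_true', beq_iff_eq, FullLexLT, List.mem_toFinset]
  refine exists_congr fun p => and_congr_right fun _ => and_congr_right fun _ =>
    and_congr_right fun _ => forall_congr' fun q => forall_congr' fun _ => ?_
  rw [← not_lt]
  exact (imp_iff_not_or (a := q < p)).symm

end Heads

/-! ### Plays and paths of choices as finite certificates -/

section Game

variable {A B : BettingStrategy} {g g' : ℕ × List Bool → Option (List (List Bool)) × ℕ × ℕ}
  (hg : Codes A g) (hg' : Codes B g') {t t' n M φ j : ℕ} {w : List Bool} {I : List ℕ}
  {H : List (List Bool)} {F : Set Seq} {τ : Seq} {r : List (List Bool × ℕ)}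
  (hF : ∀ σ, σ ∈ F ↔ ∃ a ∈ H, seqOf a = σ)

include hg hg' hF

theorem stale_spec : stale g g' H w t t' = true ↔ FullStale A B F (seqOf w) t t' := by
  simp only [stale, Bool.and_eq_true, Nat.ble_eq, Nat.succ_le_iff, Bool.or_eq_true,
    event_spec hg hF, event_spec hg' hF, List.all_eq_true, List.mem_range, Bool.not_eq_true',
    FullStale]
  refine and_congr_right fun _ => and_congr_right fun _ => forall_congr' fun u => ?_
  rw [← Bool.not_eq_true, Bool.and_eq_true, Nat.ble_eq, Nat.succ_le_iff, Bool.or_eq_true,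
    event_spec hg hF, event_spec hg' hF]
  tauto

variable (hlen : ∀ a ∈ H, a.length = n) (hnd : H.Nodup)

include hlen hnd

theorem leastGood_spec (hw : w.length = n) : leastGood g g' I H M φ w t = true ↔
    FullLeastGood A B I.toFinset F M φ (seqOf w) t := by
  have hmem : w ∈ H ↔ seqOf w ∈ F := by
    rw [hF]
    refine ⟨fun h => ⟨w, h, rfl⟩, ?_⟩
    rintro ⟨a, ha, h⟩
    obtain rfl := eq_of_eqOn_seqOf ((hlen a ha).trans hw.symm) fun p _ => congrFun h p
    exact ha
  simp only [leastGood, Bool.and_eq_true, List.any_eq_true, decide_eq_true_eq, exists_eq_right,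
    good_spec hg hF hlen hnd, good_spec hg' hF hlen hnd, List.all_eq_true, Bool.not_eq_true',
    FullLeastGood, hmem]
  refine and_congr_right fun _ => and_congr_right fun _ => and_congr_right fun _ => ?_
  have key : ∀ a, (good g H M φ a t && (good g' H M φ a t && lexLT I a w)) = false ↔
      (A.FullGood F M φ (seqOf a) t → B.FullGood F M φ (seqOf a) t →
        ¬ FullLexLT I.toFinset (seqOf a) (seqOf w)) := fun a => by
    rw [← Bool.not_eq_true, Bool.and_eq_true, Bool.and_eq_true, good_spec hg hF hlen hnd,
      good_spec hg' hF hlen hnd, lexLT_spec]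
    tauto
  constructor
  · intro h σ hσ
    obtain ⟨a, ha, rfl⟩ := (hF σ).1 hσ
    exact (key a).1 (h a ha)
  · intro h a ha
    exact (key a).2 (h _ ((hF _).2 ⟨a, ha, rfl⟩))

theorem reach_of_run (h : run g g' I H M φ r = true) (k : ℕ) (hk : k ≤ r.length - 1) :
    (r.getD k ([], 0)).1 ∈ H ∧
    Reach A B I.toFinset F M φ k (seqOf (r.getD k ([], 0)).1) (r.getD k ([], 0)).2 := by
  simp only [run, Bool.and_eq_true, List.any_eq_true, decide_eq_true_eq, exists_eq_right,
    List.all_eq_true, List.mem_range, Bool.not_eq_true'] at h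
  obtain ⟨⟨h0, h1, h2⟩, h3⟩ := h
  induction k with
  | zero =>
    refine ⟨h0, ?_⟩
    rw [h2]
    refine .start _ ((hF _).2 ⟨_, h0, rfl⟩) fun p hp => ?_
    exact h1 p (List.mem_toFinset.1 hp)
  | succ k ih =>
    obtain ⟨-, ih⟩ := ih (by omega)
    obtain ⟨h4, h5⟩ := h3 k (by omega)
    have hm : (r.getD (k + 1) ([], 0)).1 ∈ H := by
      simp only [leastGood, Bool.and_eq_true, List.any_eq_true, decide_eq_true_eq,
        exists_eq_right] at h5
      exact h5.1
    exact ⟨hm, .next k _ _ _ _ ih ((stale_spec hg hg' hF).1 h4)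
      ((leastGood_spec hg hg' hF hlen hnd (hlen _ hm)).1 h5)⟩

theorem exists_run (h : Reach A B I.toFinset F M φ j τ t) :
    ∃ r, run g g' I H M φ r = true ∧ r.length = j + 1 ∧
      ∃ a ∈ H, seqOf a = τ ∧ r.getD j ([], 0) = (a, t) := by
  induction h with
  | start τ hτ h0 =>
    obtain ⟨a, ha, rfl⟩ := (hF τ).1 hτ
    refine ⟨[(a, 0)], ?_, rfl, a, ha, rfl, rfl⟩
    simp only [run, Bool.and_eq_true, List.any_eq_true, decide_eq_true_eq, exists_eq_right,
      List.all_eq_true, List.mem_range, Bool.not_eq_true']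
    refine ⟨⟨ha, fun p hp => h0 p (List.mem_toFinset.2 hp), rfl⟩, fun k hk => ?_⟩
    simp at hk
  | next j τ τ' t t' h hs hl ih =>
    obtain ⟨r, hr, hrl, a, ha, rfl, hra⟩ := ih
    obtain ⟨b, hb, rfl⟩ := (hF τ').1 hl.1
    have hold : ∀ k < r.length, (r ++ [(b, t')]).getD k ([], 0) = r.getD k ([], 0) :=
      fun k hk => List.getD_append _ _ _ _ hk
    have hnew : (r ++ [(b, t')]).getD (j + 1) ([], 0) = (b, t') := by
      rw [List.getD_append_right _ _ _ _ hrl.le, hrl]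
      simp
    refine ⟨r ++ [(b, t')], ?_, by simp [hrl], b, hb, rfl, hnew⟩
    simp only [run, Bool.and_eq_true, List.all_eq_true, List.mem_range] at hr ⊢
    rw [hold 0 (by omega)]
    refine ⟨hr.1, fun k hk => ?_⟩
    simp only [List.length_append, List.length_singleton, hrl] at hk
    rcases Nat.lt_or_eq_of_le (show k ≤ j by omega) with hkj | rfl
    · rw [hold k (by omega), hold (k + 1) (by omega)]
      exact hr.2 k (by omega)
    · rw [hold k (by omega), hnew, hra]
      exact ⟨(stale_spec hg hg' hF).2 hs,
        (leastGood_spec hg hg' hF hlen hnd (hlen b hb)).2 hl⟩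

omit hF hlen hnd

variable {Z : ℕ → Zone} {zI : ℕ → List ℕ} {zN zφ : ℕ → ℕ} (hI : ∀ i, (zI i).toFinset = (Z i).I)
  (hN : ∀ i, zN i = (Z i).N) (hφ : ∀ i, zφ i = (Z i).φ) {l : List (ℕ × ℕ)}
  {rs : List (List (List Bool × ℕ))}

include hI

theorem inPathDom_spec (hl : ∀ it ∈ l, bounded g n it.2 = true ∧ bounded g' n it.2 = true)
    {p : ℕ} : inPathDom g g' zI n l p = true ↔ p ∈ pathDom A B Z l := by
  induction l with
  | nil => simp [inPathDom, pathDom]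
  | cons it l ih =>
    obtain ⟨i, t⟩ := it
    have h1 := hl (i, t) List.mem_cons_self
    have ih := ih fun it hit => hl it (List.mem_cons_of_mem _ hit)
    simp only [inPathDom, List.any_cons, Bool.or_eq_true, mem_memList, inspected_spec hg h1.1,
      inspected_spec hg' h1.2, pathDom, inspectedBy, Set.mem_union, Finset.mem_coe, ← hI,
      List.mem_toFinset] at ih ⊢
    rw [ih]
    tauto

include hN hφ

theorem step_spec {i : ℕ} (hl : ∀ it ∈ l, bounded g w.length it.2 = true ∧
      bounded g' w.length it.2 = true) :
    (∃ r, step g g' zI zN zφ w (i, t) l r = true) ↔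
      (bounded g w.length t = true ∧ bounded g' w.length t = true ∧
        ∀ p ∈ (Z i).I, p < w.length) ∧ Disjoint (pathDom A B Z l) ↑(Z i).I ∧
      ∃ j, Reach A B (Z i).I (fib (Z i).I (seqOf w)) ((Z i).N + 1) (Z i).φ j (seqOf w) t := by
  simp only [step, Bool.and_eq_true, List.all_eq_true, Nat.ble_eq, Nat.succ_le_iff,
    decide_eq_true_eq, Bool.not_eq_true', ← Bool.not_eq_true, inPathDom_spec hg hg' hI hl,
    hN, hφ, ← hI, List.mem_toFinset, Set.disjoint_right, Finset.mem_coe]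
  constructor
  · rintro ⟨r, ⟨hb, hb', hp⟩, hr, hlast⟩
    have hF := fun σ => mem_fib_iff_heads (σ := σ) fun p hpI => (hp p hpI).1
    have := (reach_of_run hg hg' hF (fun a ha => (mem_heads.1 ha).1) (nodup_heads _ _) hr _ le_rfl).2
    rw [hlast] at this
    exact ⟨⟨hb, hb', fun p hpI => (hp p hpI).1⟩, fun p hpI => (hp p hpI).2, _, this⟩
  · rintro ⟨⟨hb, hb', hp⟩, hd, j, hj⟩
    have hF := fun σ => mem_fib_iff_heads (σ := σ) hp
    obtain ⟨r, hr, hrl, a, ha, haw, hlast⟩ := exists_run hg hg' hF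
      (fun a ha => (mem_heads.1 ha).1) (nodup_heads _ _) hj
    refine ⟨r, ⟨hb, hb', fun p hpI => ⟨hp p hpI, hd hpI⟩⟩, hr, ?_⟩
    rw [hrl, Nat.add_sub_cancel, hlast,
      eq_of_eqOn_seqOf (mem_heads.1 ha).1 fun p _ => congrFun haw p]

theorem isPath_iff_steps : (∀ k < l.length, ∃ r, step g g' zI zN zφ w (l.getD k (0, 0))
      (l.drop (k + 1)) r = true) ↔
    IsPath A B Z (seqOf w) l ∧ ∀ it ∈ l, bounded g w.length it.2 = true ∧
      bounded g' w.length it.2 = true ∧ ∀ p ∈ (Z it.1).I, p < w.length := by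
  induction l with
  | nil => simp [IsPath]
  | cons it l ih =>
    obtain ⟨i, t⟩ := it
    have hsplit : (∀ k < (((i, t) :: l).length), ∃ r, step g g' zI zN zφ w
        (((i, t) :: l).getD k (0, 0)) (((i, t) :: l).drop (k + 1)) r = true) ↔
        (∃ r, step g g' zI zN zφ w (i, t) l r = true) ∧
        ∀ k < l.length, ∃ r, step g g' zI zN zφ w (l.getD k (0, 0)) (l.drop (k + 1)) r = true := by
      rw [List.length_cons, Nat.forall_lt_succ_left]
      simp
    rw [hsplit, ih, List.forall_mem_cons, IsPath]
    constructor
    · rintro ⟨h1, h2, h3⟩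
      rw [step_spec hg hg' hI hN hφ fun it hit => ⟨(h3 it hit).1, (h3 it hit).2.1⟩] at h1
      exact ⟨⟨h2, h1.2.1, h1.2.2⟩, h1.1, h3⟩
    · rintro ⟨⟨h2, h4, h5⟩, h1, h3⟩
      rw [step_spec hg hg' hI hN hφ fun it hit => ⟨(h3 it hit).1, (h3 it hit).2.1⟩]
      exact ⟨⟨h1, h4, h5⟩, h2, h3⟩

theorem exists_path_iff : (∃ rs, path g g' zI zN zφ w l rs = true) ↔
    IsPath A B Z (seqOf w) l ∧ ∀ it ∈ l, bounded g w.length it.2 = true ∧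
      bounded g' w.length it.2 = true ∧ ∀ p ∈ (Z it.1).I, p < w.length := by
  rw [← isPath_iff_steps hg hg' hI hN hφ]
  simp only [path, List.all_eq_true, List.mem_range]
  constructor
  · rintro ⟨rs, h⟩ k hk
    exact ⟨_, h k hk⟩
  · intro h
    choose! r hr using h
    refine ⟨(List.range l.length).map r, fun k hk => ?_⟩
    have : ((List.range l.length).map r).getD k [] = r k := by simp [hk]
    rw [this]
    exact hr k hk

/-- A prefix of `σ`, continued by zeros, has the same path once it covers the positions restricted
by the path and the codes of the parts involved. Conversely `bounded` and the bound on the zones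
keep all restricted positions within `w`, so the path transfers to `σ`. -/
theorem mem_chosenSet_iff_exists_path {σ : Seq} {m : ℕ} : σ ∈ chosenSet A B Z m ↔
    ∃ w l rs, l.length = m ∧ path g g' zI zN zφ w l rs = true ∧ σ ∈ basic w := by
  rw [mem_chosenSet_iff]
  constructor
  · rintro ⟨l, hl, hp⟩
    choose b hb using exists_bounded g
    choose b' hb' using exists_bounded g'
    obtain ⟨n₀, hn₀⟩ := (finite_pathDom A B Z l).bddAbove
    have hn : ∃ n, (∀ p ∈ pathDom A B Z l, p < n) ∧ ∀ it ∈ l, b it.2 ≤ n ∧ b' it.2 ≤ n := by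
      refine ⟨n₀ + 1 + ((l.map fun it => b it.2).sum + (l.map fun it => b' it.2).sum),
        fun p hp => ?_, fun it hit => ?_⟩
      · have := hn₀ hp
        omega
      · have h1 := List.le_sum_of_mem (List.mem_map.2 ⟨it, hit, rfl⟩ :
          b it.2 ∈ l.map fun it => b it.2)
        have h2 := List.le_sum_of_mem (List.mem_map.2 ⟨it, hit, rfl⟩ :
          b' it.2 ∈ l.map fun it => b' it.2)
        omega
    obtain ⟨n, hn1, hn2⟩ := hn
    have hpre := seqOf_pre_eqOn σ n
    have hdomI : ∀ (l : List (ℕ × ℕ)), ∀ it ∈ l, ∀ p ∈ (Z it.1).I, p ∈ pathDom A B Z l := by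
      intro l
      induction l with
      | nil => simp
      | cons it l ih =>
        intro it' hit' p hp
        rcases List.mem_cons.1 hit' with rfl | h
        · exact Or.inl hp
        · exact Or.inr (Or.inr (ih it' h p hp))
    obtain ⟨rs, hrs⟩ := (exists_path_iff hg hg' hI hN hφ (w := pre σ n) (l := l)).2
      ⟨hp.congr (hpre.mono hn1), fun it hit => by
        rw [length_pre]
        exact ⟨hb _ _ (hn2 it hit).1, hb' _ _ (hn2 it hit).2,
          fun p hp => hn1 p (hdomI l it hit p hp)⟩⟩
    refine ⟨pre σ n, l, rs, hl, hrs, ?_⟩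
    rw [mem_basic_iff, length_pre]
    exact hpre.symm
  · rintro ⟨w, l, rs, hl, hrs, hσ⟩
    obtain ⟨hp, hb⟩ := (exists_path_iff hg hg' hI hN hφ).1 ⟨rs, hrs⟩
    refine ⟨l, hl, hp.congr ((mem_basic_iff.1 hσ).mono ?_)⟩
    clear hl hrs hp hσ
    induction l with
    | nil => simp [pathDom]
    | cons it l ih =>
      obtain ⟨i, t⟩ := it
      have h1 := hb (i, t) List.mem_cons_self
      refine Set.union_subset h1.2.2 (Set.union_subset (Set.union_subset ?_ ?_)
        (ih fun it hit => hb it (List.mem_cons_of_mem _ hit)))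
      · exact inspected_subset_of_determines (bounded_spec hg h1.1)
      · exact inspected_subset_of_determines (bounded_spec hg' h1.2.1)

end Game

/-! ### Enumeration of the levels and the Martin-Löf test -/

theorem exists_enumeration {β : Type*} [Primcodable β] {v : ℕ × β → Bool} (hv : Computable v)
    {w : β → List Bool} (hw : Computable w) (hne : ∀ n, ∃ b, v (n, b) = true) :
    ∃ f : ℕ → ℕ → List Bool, Computable₂ f ∧
      ∀ n u, (∃ k, f n k = u) ↔ ∃ b, v (n, b) = true ∧ w b = u := by
  let h : ℕ → ℕ → Option (List Bool) := fun n k => (Encodable.decode (α := β) k).bind fun b =>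
    bif v (n, b) then some (w b) else none
  have hh : Computable₂ h := by
    have h1 : Computable fun p : ℕ × ℕ => Encodable.decode (α := β) p.2 :=
      Computable.decode.comp Computable.snd
    refine Computable.option_bind h1 (Computable.cond ?_ (Computable.option_some.comp ?_)
      (Computable.const none))
    · exact hv.comp (g := fun x : (ℕ × ℕ) × β => (x.1.1, x.2)) (by fun_prop)
    · fun_prop
  have hmem : ∀ n k u, h n k = some u → ∃ b, v (n, b) = true ∧ w b = u := by
    intro n k u hu
    simp only [h, Option.bind_eq_some_iff] at hu
    obtain ⟨b, -, hb⟩ := hu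
    cases hvb : v (n, b)
    · simp [hvb] at hb
    · simp only [hvb, cond_true, Option.some.injEq] at hb
      exact ⟨b, hvb, hb⟩
  have hval : ∀ n b, v (n, b) = true → h n (Encodable.encode b) = some (w b) := by
    intro n b hb
    simp [h, hb]
  have hdom : ∀ n, (Nat.rfindOpt (h n)).Dom := fun n => by
    obtain ⟨b, hb⟩ := hne n
    exact Nat.rfindOpt_dom.2 ⟨_, _, hval n b hb⟩
  -- Every index must yield a string. Those that code no witness repeat the first string found by
  -- search, which terminates because the level is nonempty.
  have hd : Computable fun n => (Nat.rfindOpt (h n)).get (hdom n) :=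
    (Partrec.rfindOpt hh).of_eq_tot fun n => Part.get_mem _
  refine ⟨fun n k => (h n k).getD ((Nat.rfindOpt (h n)).get (hdom n)),
    Computable.option_getD hh (hd.comp Computable.fst), fun n u => ⟨?_, ?_⟩⟩
  · rintro ⟨k, rfl⟩
    show ∃ b, v (n, b) = true ∧ w b = (h n k).getD ((Nat.rfindOpt (h n)).get (hdom n))
    cases hk : h n k with
    | none =>
      obtain ⟨k', hk'⟩ := Nat.rfindOpt_spec (Part.get_mem (hdom n))
      rw [Option.getD_none]
      exact hmem n k' _ hk'
    | some u =>
      rw [Option.getD_some]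
      exact hmem n k u hk
  · rintro ⟨b, hb, rfl⟩
    exact ⟨Encodable.encode b, by simp [hval n b hb]⟩

end Decide

variable {A B : BettingStrategy} {Z : ℕ → Zone}

theorem exists_computable_chosenSet (hA : A.IsComputable) (hB : B.IsComputable)
    (hZ : ComputableZones Z) (hne : ∀ n, (chosenSet A B Z n).Nonempty) :
    ∃ f : ℕ → ℕ → List Bool, Computable₂ f ∧ ∀ n, chosenSet A B Z n = ⋃ k, basic (f n k) := by
  obtain ⟨g, hgc, hg⟩ := Decide.exists_codes hA
  obtain ⟨g', hgc', hg'⟩ := Decide.exists_codes hB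
  obtain ⟨⟨zI, hzI, hI⟩, hzN, hzφ⟩ := hZ
  have key := fun (n : ℕ) (σ : Seq) => Decide.mem_chosenSet_iff_exists_path hg hg' hI
    (fun _ => rfl) (fun _ => rfl) (σ := σ) (m := n)
  have hv : Computable fun p : ℕ × List Bool × List (ℕ × ℕ) × List (List (List Bool × ℕ)) =>
      decide (p.2.2.1.length = p.1) && Decide.path g g' zI (fun i => (Z i).N) (fun i => (Z i).φ)
        p.2.1 p.2.2.1 p.2.2.2 :=
    Computable.fun_and (by fun_prop) (Decide.computable_path hgc hgc' hzI hzN hzφ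
      (by fun_prop) (by fun_prop) (by fun_prop))
  obtain ⟨f, hf, hfs⟩ := Decide.exists_enumeration hv
    (w := fun b : List Bool × List (ℕ × ℕ) × List (List (List Bool × ℕ)) => b.1) (by fun_prop)
    fun n => by
      obtain ⟨σ, hσ⟩ := hne n
      obtain ⟨w, l, rs, hl, hp, -⟩ := (key n σ).1 hσ
      exact ⟨(w, l, rs), by simp [hl, hp]⟩
  refine ⟨f, hf, fun n => ?_⟩
  ext σ
  rw [key, Set.mem_iUnion]
  constructor
  · rintro ⟨w, l, rs, hl, hp, hσ⟩
    obtain ⟨k, hk⟩ := (hfs n w).2 ⟨(w, l, rs), by simp [hl, hp], rfl⟩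
    exact ⟨k, by rwa [hk]⟩
  · rintro ⟨k, hσ⟩
    obtain ⟨⟨w, l, rs⟩, h, hw⟩ := (hfs n (f n k)).1 ⟨k, rfl⟩
    simp only [Bool.and_eq_true, decide_eq_true_eq] at h
    exact ⟨w, l, rs, h.1, h.2, by rwa [← hw] at hσ⟩

/-- The test of chosen restrictions, for zones with a bound on the length of sequences of parts
that are split at most `N` times. -/
theorem chosenSet_test (hA : A.IsComputable) (hB : B.IsComputable)
    (hmass : A.mass [] + B.mass [] = 1) (hZ : IsGameZones Z) (hZc : ComputableZones Z)
    (hφ : ∀ i, 0 < (Z i).φ)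
    (hQ : ∀ i, IsLengthBound (Z i).I.card ((Z i).N + 1) (Z i).φ
      ((2 : ℝ) ^ (((Z i).I.card : ℤ) - ((i : ℤ) + 1) - 1)))
    (hε : Tendsto (fun i => size (violating A B (Z i))) atTop (𝓝 0))
    (hN : ∀ i, ((Z i).N : ℝ) ≤ ((Z i).I.card : ℝ) - Real.logb 2 (Z i).φ - ((i : ℝ) + 1)) :
    IsMLTest (chosenSet A B Z) ∧
      ∃ σ : Seq, (∀ n, σ ∈ chosenSet A B Z n) ∧ ¬ IsMLRandom σ ∧ ¬ A.Wins σ ∧ ¬ B.Wins σ ∧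
        A.AchievesBelow 2 σ ∧ B.AchievesBelow 2 σ := by
  have hφ' : ∀ i, (Z i).φ < 2 ^ (Z i).I.card := by
    intro i
    have h0 : (0 : ℝ) < (Z i).φ := by exact_mod_cast hφ i
    have h1 : Real.logb 2 (Z i).φ < (Z i).I.card := by
      have := hN i
      have := Nat.cast_nonneg (α := ℝ) (Z i).N
      have := Nat.cast_nonneg (α := ℝ) i
      linarith
    rw [Real.logb_lt_iff_lt_rpow one_lt_two h0, Real.rpow_natCast] at h1
    exact_mod_cast h1
  -- This sequence comes first because it also shows that all levels are nonempty, as the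
  -- enumeration requires.
  obtain ⟨σ, hσ, hall⟩ := exists_bothBelow_mem_chosenSet hmass hZ hφ hφ' (fun i => ⟨_, hQ i⟩) hε hN
  have htest : IsMLTest (chosenSet A B Z) :=
    ⟨exists_computable_chosenSet hA hB hZc fun n => ⟨σ, hall n⟩,
      size_chosenSet_le (by linarith [B.mass_nonneg []]) (by linarith [A.mass_nonneg []]) hφ' hQ,
      chosenSet_succ_subset⟩
  refine ⟨htest, σ, hall, fun hr => ?_, hσ.1.not_wins, hσ.2.not_wins, hσ.1, hσ.2⟩
  obtain ⟨n, hn⟩ := hr _ htest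
  exact hn (hall n)

end BettingGame

theorem mainTheorem4 (A B : BettingGame.BettingStrategy)
    (hA : A.IsComputable) (hB : B.IsComputable)
    (hmass : A.mass [] + B.mass [] = 1)
    (Z : ℕ → BettingGame.Zone)
    (hZ : BettingGame.IsGameZones Z) (hZc : BettingGame.ComputableZones Z)
    (hφ : ∀ i, 0 < (Z i).φ)
    (hQ : ∀ i, BettingGame.IsLengthBound (Z i).I.card (Z i).N (Z i).φ
      ((2 : ℝ) ^ (((Z i).I.card : ℤ) - ((i : ℤ) + 1) - 1)))
    (hε : Tendsto (fun i => BettingGame.size (BettingGame.violating A B (Z i))) atTop (𝓝 0))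
    (hN : ∀ i, ((Z i).N : ℝ) ≤ ((Z i).I.card : ℝ) - Real.logb 2 (Z i).φ - ((i : ℝ) + 1)) :
    (∃ σ : BettingGame.Seq, ¬ BettingGame.IsMLRandom σ ∧ ¬ A.Wins σ ∧ ¬ B.Wins σ ∧
      A.AchievesBelow 2 σ ∧ B.AchievesBelow 2 σ) ∧
    ((∀ i, BettingGame.IsLengthBound (Z i).I.card ((Z i).N + 1) (Z i).φ
        ((2 : ℝ) ^ (((Z i).I.card : ℤ) - ((i : ℤ) + 1) - 1))) →
      BettingGame.IsMLTest (BettingGame.chosenSet A B Z) ∧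
      ∃ σ : BettingGame.Seq, (∀ n, σ ∈ BettingGame.chosenSet A B Z n) ∧
        ¬ BettingGame.IsMLRandom σ ∧ ¬ A.Wins σ ∧ ¬ B.Wins σ ∧
        A.AchievesBelow 2 σ ∧ B.AchievesBelow 2 σ) := by
  refine ⟨?_, fun hQ' => BettingGame.chosenSet_test hA hB hmass hZ hZc hφ hQ' hε hN⟩
  have hshift : Computable fun i : ℕ => i + 3 := by fun_prop
  obtain ⟨⟨zI, hzI, hI⟩, hzN, hzφ⟩ := hZc
  -- The length bound `2 * 2 ^ (N + 1) = 2 ^ (N + 2)` has to be at most `2 ^ (|I| - (i + 1) - 1)`,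
  -- that is, `N + 3 ≤ |I| - (i + 1)`; the shift of the index provides the summand 3.
  have hN' : ∀ i, ((Z (i + 3)).N : ℝ) + 3 ≤
      ((Z (i + 3)).I.card : ℝ) - Real.logb 2 (Z (i + 3)).φ - ((i : ℝ) + 1) := by
    intro i
    have h := hN (i + 3)
    push_cast at h
    linarith
  -- From index 3 on, `isLengthBound_two_pow` gives the bound even with `N + 1` for `N`.
  have hQ' : ∀ i, BettingGame.IsLengthBound (Z (i + 3)).I.card ((Z (i + 3)).N + 1) (Z (i + 3)).φ
      ((2 : ℝ) ^ (((Z (i + 3)).I.card : ℤ) - ((i : ℤ) + 1) - 1)) := by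
    intro i Ω _ hΩ P P' k C hC
    have hlog : 0 ≤ Real.logb 2 (Z (i + 3)).φ :=
      Real.logb_nonneg one_lt_two (by exact_mod_cast hφ (i + 3))
    refine (BettingGame.isLengthBound_two_pow _ _ _ Ω hΩ P P' k C hC).trans ?_
    calc (2 : ℝ) * 2 ^ ((Z (i + 3)).N + 1) = (2 : ℝ) ^ (((Z (i + 3)).N : ℝ) + 2) := by
          rw [Real.rpow_add two_pos, Real.rpow_natCast, Real.rpow_ofNat]
          ring
      _ ≤ (2 : ℝ) ^ (((((Z (i + 3)).I.card : ℤ) - ((i : ℤ) + 1) - 1 : ℤ)) : ℝ) := by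
          refine Real.rpow_le_rpow_of_exponent_le one_le_two ?_
          push_cast
          linarith [hN' i]
      _ = _ := Real.rpow_intCast _ _
  obtain ⟨-, σ, -, hσ⟩ := BettingGame.chosenSet_test (Z := fun i => Z (i + 3)) hA hB hmass
    (fun i j hij => hZ (by omega)) ⟨⟨fun i => zI (i + 3), hzI.comp hshift, fun i => hI (i + 3)⟩,
      hzN.comp hshift, hzφ.comp hshift⟩ (fun i => hφ (i + 3)) hQ'
    (hε.comp (tendsto_add_atTop_nat 3)) (fun i => by linarith [hN' i])
  exact ⟨σ, hσ⟩
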